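/- Let $n\ge 2$. For $x,z\in\mathbb C^n$ write $x\cdot z=\sum_{j=1}^n x_j\overline{z_j}$ and $|z|=\sqrt{z\cdot z}$. Let $\mathbf S^n=\{x\in\mathbb C^n : |x|=1\}$, let $\sigma$ be the normalized surface measure on $\mathbf S^n$, and let $\langle f,g\rangle=\int_{\mathbf S^n} f\,\overline g\,d\sigma$ be the inner product of $L^2(\mathbf S^n)=L^2(\mathbf S^n,\sigma)$. Let $\mathcal O\subset L^2(\mathbf S^n)$ be the closed subspace of those $f$ whose Poisson extension $z\mapsto\int_{\mathbf S^n}\frac{1-|z|^2}{|x-z|^{2n}}f(x)\,d\sigma(x)$ is holomorphic in the unit ball $|z|<1$, and let $P:L^2(\mathbf S^n)\to\mathcal O$ be the orthogonal projection. For $\hbar>0$ and $z\in\mathbb C^n$ put $$K_{-1}^{\hbar}(x,z)=\sum_{\ell=0}^\infty\frac{c_\ell}{\ell!}\Big(\frac{x\cdot z}{\hbar}\Big)^\ell,\qquad c_\ell=\sqrt{\frac{(n)_\ell}{(n-1)_\ell}}=\sqrt{\frac{\ell}{n-1}+1},\qquad x\in\mathbf S^n,$$ where $(a)_\ell=a(a+1)\cdots(a+\ell-1)$.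 For a complex-valued $\phi\in C^\infty(\mathbf S^n)$ let $\mathcal T_\phi\psi=P(\phi\psi)$ be the Toeplitz operator with symbol $\phi$, and let $$B_{\hbar,-1}(\phi)(z)=\frac{\langle \mathcal T_\phi K_{-1}^{\hbar}(\cdot,z),K_{-1}^{\hbar}(\cdot,z)\rangle}{\langle K_{-1}^{\hbar}(\cdot,z),K_{-1}^{\hbar}(\cdot,z)\rangle}$$ be its Berezin transform. Let $z\in\mathbb C^n\setminus\{0\}$, $r=|z|$ and $\phi\in C^\infty(\mathbf S^n)$. Then $\phi$ extends to a smooth function on an open neighbourhood of $\mathbf S^n$ in $\mathbb C^n\cong\mathbb R^{2n}$, and for every such extension, again denoted $\phi$, as $\hbar\searrow0$, $$B_{\hbar,-1}(\phi)(z)=\phi\Big(\frac z{|z|}\Big)+\frac{\hbar}{4r}\Big(\big[4\Delta_{x\overline x}-\mathcal R^2-(2n-2)\mathcal R\big]\phi\Big)\Big(\frac z{|z|}\Big)+O(\hbar^2),$$ where $\Delta_{x\overline x}=\sum_{j=1}^n\frac{\partial^2}{\partial x_j\partial\overline x_j}$, $\mathcal R=\sum_{j=1}^n\big(x_j\frac{\partial}{\partial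 x_j}+\overline x_j\frac{\partial}{\partial\overline x_j}\big)$ and $\mathcal R^2=\mathcal R\circ\mathcal R$. The constant in $O(\hbar^2)$ may depend on $n$, $z$ and $\phi$. -/

import Mathlib

open MeasureTheory Metric Set Filter Topology Asymptotics
open scoped ENNReal ContDiff Manifold InnerProductSpace

noncomputable section

namespace BerezinSphere

/-- Complex Euclidean space `ℂⁿ`. The product `x · z = ∑ⱼ xⱼ * conj zⱼ` is `inner ℂ z x`. -/
abbrev Cn (n : ℕ) : Type := EuclideanSpace ℂ (Fin n)

/-- The unit sphere of `ℂⁿ`, of real dimension `2n - 1`. -/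
abbrev Sph (n : ℕ) : Type := sphere (0 : Cn n) 1

instance finrank_fact (n : ℕ) [NeZero n] :
    Fact (Module.finrank ℝ (Cn n) = (2 * n - 1) + 1) := ⟨by
  have h : Module.finrank ℝ (Cn n) = 2 * n := by
    rw [← Module.finrank_mul_finrank ℝ ℂ (Cn n), Complex.finrank_real_complex,
      finrank_euclideanSpace_fin]
  have := NeZero.pos n
  omega⟩

/-- The normalized surface measure on the sphere. -/
def sigma (n : ℕ) : Measure (Sph n) :=
  ((volume : Measure (Cn n)).toSphere univ)⁻¹ • (volume : Measure (Cn n)).toSphere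

instance sigma_finite (n : ℕ) : IsFiniteMeasure (sigma n) := by
  refine ⟨?_⟩
  rw [sigma, Measure.smul_apply, smul_eq_mul]
  exact lt_of_le_of_lt (ENNReal.inv_mul_le_one _) ENNReal.one_lt_top

/-- The Hilbert space of square integrable functions on the sphere. Mathlib's inner product is
conjugate-linear in the first argument: `∫ f * conj g` is `inner ℂ g f`. -/
abbrev L2 (n : ℕ) : Type := Lp ℂ 2 (sigma n)

/-! ### The Hardy space -/

/-- The Poisson kernel of the unit ball of `ℂⁿ = ℝ²ⁿ`, for the normalized surface measure. -/
def poissonKernel {n : ℕ} (z : Cn n) (x : Sph n) : ℝ :=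
  (1 - ‖z‖ ^ 2) / ‖(x : Cn n) - z‖ ^ (2 * n)

/-- The Poisson extension of `f` into the open unit ball. -/
def poissonExt {n : ℕ} (f : L2 n) (z : Cn n) : ℂ :=
  ∫ x, (poissonKernel z x : ℂ) * f x ∂(sigma n)

/-- The pairing `∫ g f` of a square integrable function `f` with a continuous function `g`. -/
def pairing {n : ℕ} (f : L2 n) : C(Sph n, ℂ) →L[ℂ] ℂ :=
  ((ContinuousLinearMap.mul ℂ ℂ).lpPairing (sigma n) 2 2 f).comp
    (ContinuousMap.toLp 2 (sigma n) ℂ)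

theorem pairing_apply {n : ℕ} (f : L2 n) (g : C(Sph n, ℂ)) :
    pairing f g = ∫ x, g x * f x ∂(sigma n) := by
  rw [pairing, ContinuousLinearMap.comp_apply, ContinuousLinearMap.lpPairing_eq_integral]
  refine integral_congr_ae ?_
  filter_upwards [ContinuousMap.coeFn_toLp (p := 2) (𝕜 := ℂ) (sigma n) g] with x h1
  rw [h1, ContinuousLinearMap.mul_apply', mul_comm]

theorem pairing_add {n : ℕ} (f f' : L2 n) (g : C(Sph n, ℂ)) :
    pairing (f + f') g = pairing f g + pairing f' g := by
  simp [pairing]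

theorem pairing_smul {n : ℕ} (c : ℂ) (f : L2 n) (g : C(Sph n, ℂ)) :
    pairing (c • f) g = c * pairing f g := by
  simp [pairing]

theorem continuous_pairing {n : ℕ} (g : C(Sph n, ℂ)) :
    Continuous fun f : L2 n => pairing f g :=
  (((ContinuousLinearMap.mul ℂ ℂ).lpPairing (sigma n) 2 2).flip
    (ContinuousMap.toLp 2 (sigma n) ℂ g)).continuous

/-- The real-linear map `z ↦ (x ↦ Re (x · z))`. -/
def reInner (n : ℕ) : Cn n →ₗ[ℝ] C(Sph n, ℂ) where
  toFun z := ⟨fun x => ((inner ℂ z (x : Cn n)).re : ℂ), by fun_prop⟩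
  map_add' z w := by ext x; simp
  map_smul' c z := by
    ext x
    simp [inner_smul_left_eq_smul]

/-- The function `x ↦ ‖x - z‖²` on the sphere. -/
def distSq {n : ℕ} (z : Cn n) : C(Sph n, ℂ) :=
  ⟨fun x => ((‖(x : Cn n) - z‖ ^ 2 : ℝ) : ℂ), by fun_prop⟩

theorem distSq_eq {n : ℕ} (z : Cn n) :
    distSq z = (1 + ‖z‖ ^ 2) • (1 : C(Sph n, ℂ)) - (2 : ℝ) • reInner n z := by
  ext x
  have hx : ‖(x : Cn n)‖ = 1 := by simp
  have h := norm_sub_sq (𝕜 := ℂ) (x : Cn n) z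
  rw [hx, inner_re_symm] at h
  simp only [distSq, reInner, ContinuousMap.coe_mk, h]
  simp
  ring

theorem differentiable_distSq (n : ℕ) : Differentiable ℝ (distSq (n := n)) := by
  have h : (distSq (n := n)) = fun z =>
      (1 + ‖z‖ ^ 2) • (1 : C(Sph n, ℂ)) - (2 : ℝ) • (reInner n).toContinuousLinearMap z := by
    funext z
    exact distSq_eq z
  rw [h]
  have h1 : Differentiable ℝ fun z : Cn n => ‖z‖ ^ 2 :=
    (contDiff_norm_sq (n := 1) ℝ).differentiable (by simp)
  fun_prop

/-- The Poisson kernel as a continuous function on the sphere. -/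
def poissonMap {n : ℕ} (z : Cn n) : C(Sph n, ℂ) :=
  (1 - ‖z‖ ^ 2) • Ring.inverse (distSq z) ^ n

theorem isUnit_distSq {n : ℕ} {z : Cn n} (hz : z ∈ ball (0 : Cn n) 1) : IsUnit (distSq z) := by
  rw [ContinuousMap.isUnit_iff_forall_ne_zero]
  intro x h
  simp only [distSq, ContinuousMap.coe_mk, Complex.ofReal_eq_zero] at h
  have h' : (x : Cn n) = z := by simpa [sub_eq_zero] using h
  have hx : ‖(x : Cn n)‖ = 1 := by simp
  rw [mem_ball_zero_iff, ← h'] at hz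
  linarith

theorem differentiableAt_poissonMap {n : ℕ} {z : Cn n} (hz : z ∈ ball (0 : Cn n) 1) :
    DifferentiableAt ℝ (poissonMap (n := n)) z := by
  have h1 : DifferentiableAt ℝ (fun z : Cn n => ‖z‖ ^ 2) z :=
    (contDiff_norm_sq (n := 1) ℝ).differentiable (by simp) z
  have h2 : DifferentiableAt ℝ (fun z : Cn n => Ring.inverse (distSq z)) z :=
    (differentiableAt_inverse (𝕜 := ℝ) (isUnit_distSq hz)).comp z (differentiable_distSq n z)
  exact ((differentiableAt_const (1 : ℝ)).sub h1).smul (h2.pow n)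

theorem poissonMap_apply {n : ℕ} {z : Cn n} (hz : z ∈ ball (0 : Cn n) 1) (x : Sph n) :
    poissonMap z x = (poissonKernel z x : ℂ) := by
  have h : Ring.inverse (distSq z) x = (distSq z x)⁻¹ := by
    have h1 := Ring.inverse_mul_cancel _ (isUnit_distSq hz)
    have h2 := congrArg (fun g : C(Sph n, ℂ) => g x) h1
    exact eq_inv_of_mul_eq_one_left h2
  rw [poissonMap, ContinuousMap.smul_apply, ContinuousMap.pow_apply, h, poissonKernel]
  simp [distSq, div_eq_mul_inv, pow_mul]

theorem poissonExt_eq {n : ℕ} (f : L2 n) {z : Cn n} (hz : z ∈ ball (0 : Cn n) 1) :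
    poissonExt f z = pairing f (poissonMap z) := by
  simp only [pairing_apply, poissonExt, poissonMap_apply hz]

theorem hasFDerivAt_poissonExt {n : ℕ} (f : L2 n) {z : Cn n} (hz : z ∈ ball (0 : Cn n) 1) :
    HasFDerivAt (poissonExt f)
      (((pairing f).restrictScalars ℝ).comp (fderiv ℝ (poissonMap (n := n)) z)) z := by
  have h := ((pairing f).restrictScalars ℝ).hasFDerivAt.comp z
    (differentiableAt_poissonMap hz).hasFDerivAt
  refine h.congr_of_eventuallyEq ?_
  filter_upwards [isOpen_ball.mem_nhds hz] with w hw
  exact poissonExt_eq f hw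

/-- Holomorphy of the Poisson extension, as a family of closed linear conditions on `f`. -/
theorem differentiableOn_poissonExt_iff {n : ℕ} (f : L2 n) :
    DifferentiableOn ℂ (poissonExt f) (ball 0 1) ↔
      ∀ z ∈ ball (0 : Cn n) 1, ∀ v : Cn n,
        pairing f (fderiv ℝ (poissonMap (n := n)) z (Complex.I • v)) =
          Complex.I * pairing f (fderiv ℝ (poissonMap (n := n)) z v) := by
  constructor
  · intro h z hz v
    have h1 := (h.differentiableAt (isOpen_ball.mem_nhds hz)).hasFDerivAt.restrictScalars ℝ
    have h2 := h1.unique (hasFDerivAt_poissonExt f hz)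
    have h3 : ∀ w, pairing f (fderiv ℝ (poissonMap (n := n)) z w) =
        fderiv ℂ (poissonExt f) z w := fun w => (DFunLike.congr_fun h2 w).symm
    rw [h3, h3, map_smul, smul_eq_mul]
  · intro h z hz
    have hd := hasFDerivAt_poissonExt f hz
    refine DifferentiableAt.differentiableWithinAt ?_
    rw [differentiableAt_iff_restrictScalars ℝ hd.differentiableAt, hd.fderiv]
    set L := ((pairing f).restrictScalars ℝ).comp (fderiv ℝ (poissonMap (n := n)) z) with hL
    have hI : ∀ v, L (Complex.I • v) = Complex.I * L v := fun v => h z hz v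
    refine ⟨⟨⟨⟨L, map_add L⟩, ?_⟩, L.continuous⟩, ?_⟩
    · intro c v
      have hc : c • v = c.re • v + c.im • (Complex.I • v) := by
        conv_lhs => rw [← Complex.re_add_im c]
        rw [add_smul, mul_smul]
        rfl
      change L (c • v) = c * L v
      rw [hc, map_add, map_smul, map_smul, hI]
      conv_rhs => rw [← Complex.re_add_im c]
      simp only [Complex.real_smul]
      ring
    · ext v
      rfl

/-- The space `𝒪` of the functions in `L²` of the sphere whose Poisson extension into the
open unit ball is holomorphic. -/
def hardy (n : ℕ) : Submodule ℂ (L2 n) where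
  carrier := {f | DifferentiableOn ℂ (poissonExt f) (ball 0 1)}
  add_mem' {f g} hf hg := by
    simp only [mem_ofPred_eq, differentiableOn_poissonExt_iff] at hf hg ⊢
    intro z hz v
    rw [pairing_add, pairing_add, hf z hz v, hg z hz v, mul_add]
  zero_mem' := by
    simp only [mem_ofPred_eq, differentiableOn_poissonExt_iff]
    intro z hz v
    simp [pairing]
  smul_mem' c f hf := by
    simp only [mem_ofPred_eq, differentiableOn_poissonExt_iff] at hf ⊢
    intro z hz v
    rw [pairing_smul, pairing_smul, hf z hz v]
    ring

theorem isClosed_hardy (n : ℕ) : IsClosed (hardy n : Set (L2 n)) := by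
  have h : (hardy n : Set (L2 n)) = {f | ∀ z ∈ ball (0 : Cn n) 1, ∀ v : Cn n,
        pairing f (fderiv ℝ (poissonMap (n := n)) z (Complex.I • v)) =
          Complex.I * pairing f (fderiv ℝ (poissonMap (n := n)) z v)} := by
    ext f
    exact differentiableOn_poissonExt_iff f
  rw [h]
  simp only [ofPred_forall]
  refine isClosed_iInter fun z => isClosed_iInter fun _ => isClosed_iInter fun v => ?_
  exact isClosed_eq (continuous_pairing _) (continuous_const.mul (continuous_pairing _))

instance hardy_complete (n : ℕ) : CompleteSpace (hardy n) :=
  (isClosed_hardy n).completeSpace_coe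

/-! ### The family `K_p`, the covariant symbol and the Berezin transform -/

/-- `c_{ℓ,p} = √((n)_ℓ / (n + p)_ℓ)`, with `(a)_ℓ = a (a + 1) ⋯ (a + ℓ - 1)`. -/
def coeff (n : ℕ) (p : ℝ) (l : ℕ) : ℝ :=
  Real.sqrt ((ascPochhammer ℝ l).eval (n : ℝ) / (ascPochhammer ℝ l).eval ((n : ℝ) + p))

/-- The function `K_p(x, z) = ∑_ℓ c_{ℓ,p} / ℓ! * ((x · z) / ħ) ^ ℓ`. -/
def kernelFun {n : ℕ} (h p : ℝ) (x z : Cn n) : ℂ :=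
  ∑' l : ℕ, ((coeff n p l / (l.factorial : ℝ) : ℝ) : ℂ) * (inner ℂ z x / (h : ℂ)) ^ l

theorem summable_coeff (n : ℕ) (p R : ℝ) :
    Summable fun l : ℕ => coeff n p l / (l.factorial : ℝ) * R ^ l := by
  have hN : ∀ᶠ l : ℕ in atTop, |2 * p| + 1 + 4 * |R| ≤ l :=
    (tendsto_natCast_atTop_atTop (R := ℝ)).eventually_ge_atTop _
  refine summable_of_ratio_norm_eventually_le (r := 1 / 2) (by norm_num) ?_
  filter_upwards [hN] with l hl
  have hp := neg_abs_le (2 * p)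
  have hR := abs_nonneg R
  have hp' := abs_nonneg (2 * p)
  have hn : (0 : ℝ) ≤ n := Nat.cast_nonneg n
  have hden : 0 < (n : ℝ) + p + l := by linarith
  have hle : ((n : ℝ) + l) / ((n : ℝ) + p + l) ≤ 2 ^ 2 := by
    rw [div_le_iff₀ hden]
    linarith
  have hnn : 0 ≤ ((n : ℝ) + l) / ((n : ℝ) + p + l) := by positivity
  have hc : coeff n p (l + 1) ≤ coeff n p l * 2 := by
    rw [coeff, coeff, ascPochhammer_succ_eval, ascPochhammer_succ_eval, mul_div_mul_comm,
      Real.sqrt_mul' _ hnn]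
    exact mul_le_mul_of_nonneg_left (Real.sqrt_le_iff.2 ⟨by norm_num, hle⟩) (Real.sqrt_nonneg _)
  have hc0 : ∀ k, 0 ≤ coeff n p k := fun k => Real.sqrt_nonneg _
  rw [norm_mul, norm_mul, norm_div, norm_div, norm_pow, norm_pow, Real.norm_of_nonneg (hc0 _),
    Real.norm_of_nonneg (hc0 _), Nat.factorial_succ, Nat.cast_mul, pow_succ]
  simp only [norm_mul, RCLike.norm_natCast, Real.norm_eq_abs]
  have hf : (0 : ℝ) < l.factorial := by positivity
  have hl1 : (0 : ℝ) < ((l + 1 : ℕ) : ℝ) := by positivity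
  have e : coeff n p (l + 1) / (((l + 1 : ℕ) : ℝ) * l.factorial) * (|R| ^ l * |R|) =
      coeff n p (l + 1) * (|R| / ((l + 1 : ℕ) : ℝ)) * (|R| ^ l / l.factorial) := by
    field_simp
  have e' : 1 / 2 * (coeff n p l / (l.factorial : ℝ) * |R| ^ l) =
      coeff n p l * 2 * (1 / 4) * (|R| ^ l / l.factorial) := by
    ring
  rw [e, e']
  have hq : |R| / ((l + 1 : ℕ) : ℝ) ≤ 1 / 4 := by
    rw [div_le_iff₀ hl1]
    push_cast
    linarith
  have := hc0 l
  gcongr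

theorem continuous_kernelFun {n : ℕ} (h p : ℝ) (z : Cn n) :
    Continuous fun x : Sph n => kernelFun h p (x : Cn n) z := by
  refine continuous_tsum (u := fun l => coeff n p l / (l.factorial : ℝ) * (‖z‖ / |h|) ^ l)
    (fun l => by fun_prop) (summable_coeff n p _) ?_
  intro l x
  have hx : ‖(x : Cn n)‖ = 1 := by simp
  have hc0 : 0 ≤ coeff n p l / (l.factorial : ℝ) :=
    div_nonneg (Real.sqrt_nonneg _) (Nat.cast_nonneg _)
  rw [norm_mul, norm_pow, norm_div, Complex.norm_real, Complex.norm_real,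
    Real.norm_of_nonneg hc0, Real.norm_eq_abs]
  have := norm_inner_le_norm (𝕜 := ℂ) z (x : Cn n)
  rw [hx, mul_one] at this
  gcongr

/-- `K_p(·, z)` as an element of `L²` of the sphere. -/
def kernelL2 (n : ℕ) (h p : ℝ) (z : Cn n) : L2 n :=
  ContinuousMap.toLp 2 (sigma n) ℂ ⟨fun x => kernelFun h p (x : Cn n) z, continuous_kernelFun h p z⟩

/-- The covariant symbol `⟨A K_p(·,z), K_p(·,z)⟩ / ⟨K_p(·,z), K_p(·,z)⟩` of an operator `A`. -/
def covariantSymbol {n : ℕ} (h p : ℝ) (A : L2 n →L[ℂ] L2 n) (z : Cn n) : ℂ :=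
  inner ℂ (kernelL2 n h p z) (A (kernelL2 n h p z)) /
    inner ℂ (kernelL2 n h p z) (kernelL2 n h p z)

/-- Multiplication by a continuous function, as a bounded operator on `L²` of the sphere. -/
def mulOp {n : ℕ} (φ : C(Sph n, ℂ)) : L2 n →L[ℂ] L2 n :=
  (ContinuousLinearMap.mul ℂ ℂ).holderL (sigma n) ∞ 2 2 (ContinuousMap.toLp ∞ (sigma n) ℂ φ)

/-- The Toeplitz operator `ψ ↦ P (φ ψ)`, where `P` is the orthogonal projection of `L²` of the
sphere onto `𝒪`. -/
def toeplitz {n : ℕ} (φ : C(Sph n, ℂ)) : L2 n →L[ℂ] L2 n :=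
  (hardy n).starProjection.comp (mulOp φ)

/-- Complex-valued smooth functions on the sphere, a real manifold of dimension `2n - 1`. -/
abbrev SmoothFun (n : ℕ) [NeZero n] : Type :=
  C^∞⟮𝓡 (2 * n - 1), Sph n; 𝓘(ℝ, ℂ), ℂ⟯

/-- The Berezin transform `B_{ħ,p}(φ)(z)`. -/
def berezin {n : ℕ} [NeZero n] (h p : ℝ) (φ : SmoothFun n) (z : Cn n) : ℂ :=
  covariantSymbol h p (toeplitz (φ : C(Sph n, ℂ))) z

/-! ### Differential operators on `ℂⁿ = ℝ²ⁿ` -/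

/-- The Wirtinger derivative `∂/∂x_j`. -/
def dz {n : ℕ} (j : Fin n) (F : Cn n → ℂ) (x : Cn n) : ℂ :=
  (1 / 2) * (fderiv ℝ F x (EuclideanSpace.single j 1) -
    Complex.I * fderiv ℝ F x (EuclideanSpace.single j Complex.I))

/-- The Wirtinger derivative `∂/∂x̄_j`. -/
def dzbar {n : ℕ} (j : Fin n) (F : Cn n → ℂ) (x : Cn n) : ℂ :=
  (1 / 2) * (fderiv ℝ F x (EuclideanSpace.single j 1) +
    Complex.I * fderiv ℝ F x (EuclideanSpace.single j Complex.I))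

/-- The Laplace operator `∑_j ∂²/∂x_j ∂x̄_j`. -/
def laplace {n : ℕ} (F : Cn n → ℂ) (x : Cn n) : ℂ :=
  ∑ j, dz j (dzbar j F) x

/-- The radial derivative `∑_j (x_j ∂/∂x_j + x̄_j ∂/∂x̄_j)`. -/
def radial {n : ℕ} (F : Cn n → ℂ) (x : Cn n) : ℂ :=
  ∑ j, (x j * dz j F x + (starRingEnd ℂ) (x j) * dzbar j F x)

/-- `F` is smooth on an open neighbourhood of the sphere and restricts to `φ` there. -/
def IsSmoothExtension {n : ℕ} (φ : Sph n → ℂ) (F : Cn n → ℂ) : Prop :=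
  (∃ U : Set (Cn n), IsOpen U ∧ sphere 0 1 ⊆ U ∧ ContDiffOn ℝ ∞ F U) ∧
    ∀ x : Sph n, F x = φ x

/-- The point `z / |z|` of the sphere. -/
def direction {n : ℕ} (z : Cn n) (hz : z ≠ 0) : Sph n :=
  ⟨((‖z‖⁻¹ : ℝ) : ℂ) • z, by
    rw [mem_sphere_zero_iff_norm, norm_smul, Complex.norm_real, norm_inv, norm_norm,
      inv_mul_cancel₀ (norm_ne_zero_iff.2 hz)]⟩

end BerezinSphere

end

noncomputable section

namespace BerezinSphere

/-! ### Asymptotics of a Bessel-type distribution -/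

/-! Put `n = m + 2`, `ζ = z / |z|`, `ρ = |z| / ħ` and `X = x · ζ`. The kernel is itself in `𝒪`, so
the projection drops out of the quotient and the Berezin transform is the mean of `φ` for the
probability measure `ν` proportional to `|K|² σ`. The claim is that `ν` concentrates at `ζ` on the
scale `ρ^(-1/2)`, and its moments are needed up to `O(ρ⁻²)`.

`K` is a power series in `X`, and distinct powers of `X` are orthogonal on the sphere. The mass of
`|K|² σ` is therefore a single series with terms `ρ^(2l) m! / (l! (l+m)!)`, and the moments of `X`
under `ν` become means over this Bessel distribution: `E X = ρ E[1/√((l+m+1)(l+m+2))]`, and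
similarly for `X²` and `|X|²`. The distribution obeys the Stein identity `E[l(l+m) g(l)] = ρ²
E[g(l+1)]`. Applied to powers of `l + m/2 - R`, with `R² = ρ² + m²/4`, it gives a recursion for the
centred moments (`devMoment_bounds`). These feed finite geometric expansions of the inverse moments
(`inv_moment`, `inv_sq_moment`) and then `moment_asymptotics`: `E[Re X - 1] ≈ -(2m+3)/(4ρ)`, `E[(Im
X)²] ≈ 1/(2ρ)`, `E[(Re X - 1)²] = O(ρ⁻²)`, `E[1 - |X|²] ≈ (m+1)/ρ`.

`ν` is invariant under real isometries that fix or conjugate `X`. Hence the mean of `x - ζ` is along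
`ζ`, and the second moments are diagonal in a real orthonormal basis containing `ζ` and `iζ`:
`O(ρ⁻²)` along `ζ` and `1/(2ρ) + O(ρ⁻²)` in all other directions. In the third order Taylor
expansion of an extension `F` at `ζ` the remainder is `O(|x-ζ|⁴)`, and `|x-ζ|⁴ = 4 (Re X - 1)²` on
the sphere; the cubic term is odd up to an error of the same size. What is left, `-(2m+3)/(4ρ)
DF(ζ)ζ + (1/(4ρ)) (tr D²F(ζ) - D²F(ζ)(ζ,ζ))`, is the asserted operator, because `4Δ = tr D²F` and
`ℛ²F(ζ) = D²F(ζ)(ζ,ζ) + DF(ζ)ζ`. Only the values of `F` on the sphere enter the integral, so the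
expansion holds for every extension.

The membership of `K` in `𝒪` rests on `integral_poisson_pow`, proved by expanding the Poisson kernel
and summing a random-walk series. -/

/-- `p` is a probability distribution on `ℕ` with all moments, proportional to
`ρ ^ (2 l) / (l! (l + m)!)`. -/
structure IsBesselWeight (m : ℕ) (ρ : ℝ) (p : ℕ → ℝ) : Prop where
  nonneg : ∀ l, 0 ≤ p l
  hasSum : HasSum p 1
  recurrence : ∀ l : ℕ, p (l + 1) * (((l : ℝ) + 1) * (l + 1 + m)) = ρ ^ 2 * p l
  summable_pow : ∀ k : ℕ, Summable fun l : ℕ => p l * (l : ℝ) ^ k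

/-- The centre `√(ρ² + m² / 4)` of the distribution. -/
def centre (m : ℕ) (ρ : ℝ) : ℝ := √(ρ ^ 2 + (m : ℝ) ^ 2 / 4)

/-- The deviation `l + m / 2 - √(ρ² + m² / 4)`. -/
def deviation (m : ℕ) (ρ : ℝ) (l : ℕ) : ℝ := (l : ℝ) + m / 2 - centre m ρ

/-- The moments of the deviation. -/
def devMoment (m : ℕ) (ρ : ℝ) (p : ℕ → ℝ) (k : ℕ) : ℝ := ∑' l, p l * deviation m ρ l ^ k

theorem centre_sq (m : ℕ) (ρ : ℝ) : centre m ρ ^ 2 = ρ ^ 2 + (m : ℝ) ^ 2 / 4 :=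
  Real.sq_sqrt (by positivity)

theorem le_centre (m : ℕ) (ρ : ℝ) : ρ ≤ centre m ρ :=
  Real.le_sqrt_of_sq_le (by linarith [sq_nonneg (m : ℝ)])

theorem neg_centre_le_deviation (m : ℕ) (ρ : ℝ) (l : ℕ) : -centre m ρ ≤ deviation m ρ l := by
  unfold deviation
  have : (0 : ℝ) ≤ (l : ℝ) + m / 2 := by positivity
  linarith

namespace IsBesselWeight

variable {m : ℕ} {ρ : ℝ} {p : ℕ → ℝ}

theorem summable_add_pow (h : IsBesselWeight m ρ p) (c : ℝ) (k : ℕ) :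
    Summable fun l : ℕ => p l * ((l : ℝ) + c) ^ k := by
  have key : ∀ k j : ℕ, Summable fun l : ℕ => p l * (l : ℝ) ^ j * ((l : ℝ) + c) ^ k := by
    intro k
    induction k with
    | zero => intro j; simpa using h.summable_pow j
    | succ k ih =>
      intro j
      refine ((ih (j + 1)).add ((ih j).mul_left c)).congr fun l => ?_
      ring
  simpa using key k 0

theorem hasSum_dev (h : IsBesselWeight m ρ p) (k : ℕ) :
    HasSum (fun l => p l * deviation m ρ l ^ k) (devMoment m ρ p k) := by
  refine Summable.hasSum ((h.summable_add_pow ((m : ℝ) / 2 - centre m ρ) k).congr fun l => ?_)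
  unfold deviation
  ring

theorem devMoment_zero (h : IsBesselWeight m ρ p) : devMoment m ρ p 0 = 1 := by
  refine (h.hasSum_dev 0).unique ?_
  simpa using h.hasSum

/-- The Stein identity of the distribution. -/
theorem hasSum_stein (h : IsBesselWeight m ρ p) {g : ℕ → ℝ} {s : ℝ}
    (hg : HasSum (fun l => p l * g (l + 1)) s) :
    HasSum (fun l => p l * ((l : ℝ) * (l + m) * g l)) (ρ ^ 2 * s) := by
  -- The factor `l` kills the term `l = 0`; after the shift, `recurrence` applies to each term.
  rw [← hasSum_nat_add_iff' 1]
  simp only [Finset.range_one, Finset.sum_singleton, Nat.cast_zero, zero_mul, mul_zero, sub_zero]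
  refine (hg.mul_left (ρ ^ 2)).congr_fun ?_
  intro l
  have := h.recurrence l
  push_cast
  linear_combination (g (l + 1)) * this

theorem deviation_succ (l : ℕ) : deviation m ρ (l + 1) = deviation m ρ l + 1 := by
  unfold deviation; push_cast; ring

/-- The `m² / 4` in the centre makes the constant term exactly `ρ²`, which cancels the leading part
of the right-hand side of the Stein identity. -/
theorem sq_sub (m : ℕ) (ρ : ℝ) (l : ℕ) :
    (l : ℝ) * (l + m) = ρ ^ 2 + 2 * centre m ρ * deviation m ρ l + deviation m ρ l ^ 2 := by
  have := centre_sq m ρ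
  unfold deviation
  linear_combination this

/-- Stein identity for the `k`-th power of the deviation. The sum `s` is left free so that each use
can supply its binomial expansion; the `k`-th moments then cancel. -/
theorem devMoment_rec (h : IsBesselWeight m ρ p) (k : ℕ) {s : ℝ}
    (hs : HasSum (fun l => p l * (deviation m ρ l + 1) ^ k) s) :
    2 * centre m ρ * devMoment m ρ p (k + 1) + devMoment m ρ p (k + 2) =
      ρ ^ 2 * (s - devMoment m ρ p k) := by
  have h1 := h.hasSum_stein (g := fun l => deviation m ρ l ^ k) (s := s)
    (by simpa only [deviation_succ] using hs)
  have h2 := (((h.hasSum_dev k).mul_left (ρ ^ 2)).add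
    ((h.hasSum_dev (k + 1)).mul_left (2 * centre m ρ))).add (h.hasSum_dev (k + 2))
  have h3 := h1.unique (h2.congr_fun fun l => by rw [sq_sub m ρ]; ring)
  linarith

theorem devMoment_even_nonneg (h : IsBesselWeight m ρ p) (k : ℕ) :
    0 ≤ devMoment m ρ p (2 * k) := by
  refine (h.hasSum_dev (2 * k)).nonneg fun l => ?_
  rw [pow_mul]
  exact mul_nonneg (h.nonneg l) (by positivity)

/-- Centre plus deviation is `l + m/2 ≥ 0`. In the recursion this absorbs the unknown higher odd
moment: `2R M₂ₖ + M₂ₖ₊₁ ≥ R M₂ₖ`. -/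
theorem neg_le_devMoment_odd (h : IsBesselWeight m ρ p) (k : ℕ) :
    -(centre m ρ * devMoment m ρ p (2 * k)) ≤ devMoment m ρ p (2 * k + 1) := by
  have h1 := ((h.hasSum_dev (2 * k)).mul_left (centre m ρ)).add (h.hasSum_dev (2 * k + 1))
  have : 0 ≤ centre m ρ * devMoment m ρ p (2 * k) + devMoment m ρ p (2 * k + 1) := by
    refine h1.nonneg fun l => ?_
    have h2 := neg_centre_le_deviation m ρ l
    have h3 := h.nonneg l
    have e : centre m ρ * (p l * deviation m ρ l ^ (2 * k)) + p l * deviation m ρ l ^ (2 * k + 1)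
      = p l * (deviation m ρ l ^ k) ^ 2 * (centre m ρ + deviation m ρ l) := by ring
    rw [e]
    have : 0 ≤ centre m ρ + deviation m ρ l := by linarith
    positivity
  linarith

/-- From `2d ≤ 1 + d²`, weighted by an even power of the deviation. -/
theorem devMoment_odd_le (h : IsBesselWeight m ρ p) (k : ℕ) :
    2 * devMoment m ρ p (2 * k + 1) ≤ devMoment m ρ p (2 * k) + devMoment m ρ p (2 * (k + 1)) := by
  have h1 := ((h.hasSum_dev (2 * k)).add (h.hasSum_dev (2 * (k + 1)))).sub
    ((h.hasSum_dev (2 * k + 1)).mul_left 2)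
  have := h1.nonneg fun l => by
    have h3 := h.nonneg l
    have e : p l * deviation m ρ l ^ (2 * k) + p l * deviation m ρ l ^ (2 * (k + 1)) -
      2 * (p l * deviation m ρ l ^ (2 * k + 1))
      = p l * (deviation m ρ l ^ k) ^ 2 * (deviation m ρ l - 1) ^ 2 := by ring
    rw [e]
    positivity
  linarith

set_option maxHeartbeats 400000 in
/-- Bounds for the moments of the deviation. -/
theorem devMoment_bounds (h : IsBesselWeight m ρ p) (hρ : 1 ≤ ρ) :
    |devMoment m ρ p 1 + 1 / 4| ≤ (m ^ 2 + 1) / centre m ρ ∧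
    |devMoment m ρ p 2 - centre m ρ / 2| ≤ m ^ 2 + 1 ∧
    |devMoment m ρ p 3| ≤ 4 * centre m ρ ∧
    devMoment m ρ p 4 ≤ 4 * centre m ρ ^ 2 ∧
    devMoment m ρ p 6 ≤ 51 * centre m ρ ^ 3 ∧
    devMoment m ρ p 8 ≤ 2000 * centre m ρ ^ 4 := by
  have d0 := h.devMoment_zero
  have s2 := h.devMoment_rec 2 (((h.hasSum_dev 2).add ((h.hasSum_dev 1).mul_left 2)).add
    (h.hasSum_dev 0) |>.congr_fun fun l => by ring)
  have s0 := h.devMoment_rec 0 ((h.hasSum_dev 0).congr_fun fun l => by ring)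
  have s1 := h.devMoment_rec 1 (((h.hasSum_dev 1).add (h.hasSum_dev 0)).congr_fun fun l => by ring)
  have s3 := h.devMoment_rec 3 ((((h.hasSum_dev 3).add ((h.hasSum_dev 2).mul_left 3)).add
    ((h.hasSum_dev 1).mul_left 3)).add (h.hasSum_dev 0) |>.congr_fun fun l => by ring)
  have s5 := h.devMoment_rec 5 ((((((h.hasSum_dev 5).add ((h.hasSum_dev 4).mul_left 5)).add
    ((h.hasSum_dev 3).mul_left 10)).add ((h.hasSum_dev 2).mul_left 10)).add
    ((h.hasSum_dev 1).mul_left 5)).add (h.hasSum_dev 0) |>.congr_fun fun l => by ring)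
  have s7 := h.devMoment_rec 7 ((((((((h.hasSum_dev 7).add ((h.hasSum_dev 6).mul_left 7)).add
    ((h.hasSum_dev 5).mul_left 21)).add ((h.hasSum_dev 4).mul_left 35)).add
    ((h.hasSum_dev 3).mul_left 35)).add ((h.hasSum_dev 2).mul_left 21)).add
    ((h.hasSum_dev 1).mul_left 7)).add (h.hasSum_dev 0) |>.congr_fun fun l => by ring)
  have p2 := h.devMoment_even_nonneg 1
  have p4 := h.devMoment_even_nonneg 2
  have p6 := h.devMoment_even_nonneg 3
  have p8 := h.devMoment_even_nonneg 4
  have o3 := h.neg_le_devMoment_odd 1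
  have o5 := h.neg_le_devMoment_odd 2
  have o7 := h.neg_le_devMoment_odd 3
  have o9 := h.neg_le_devMoment_odd 4
  have u5 := h.devMoment_odd_le 2
  have hR2 := centre_sq m ρ
  have hRρ := le_centre m ρ
  norm_num at s0 s1 s2 s3 s5 s7 p2 p4 p6 p8 o3 o5 o7 o9 u5
  generalize centre m ρ = R at *
  generalize devMoment m ρ p 0 = d0 at *
  generalize devMoment m ρ p 1 = d1 at *
  generalize devMoment m ρ p 2 = d2 at *
  generalize devMoment m ρ p 3 = d3 at *
  generalize devMoment m ρ p 4 = d4 at *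
  generalize devMoment m ρ p 5 = d5 at *
  generalize devMoment m ρ p 6 = d6 at *
  generalize devMoment m ρ p 7 = d7 at *
  generalize devMoment m ρ p 8 = d8 at *
  generalize devMoment m ρ p 9 = d9 at *
  subst d0
  have hR1 : 1 ≤ R := hρ.trans hRρ
  have hR0 : 0 < R := by linarith
  have hR12 : R ≤ R ^ 2 := by nlinarith
  have hρR : ρ ^ 2 ≤ R ^ 2 := by linarith [sq_nonneg (m : ℝ)]
  have hρ0 : 0 ≤ ρ ^ 2 := sq_nonneg _
  -- Even moments are bounded in increasing order. The recursion with odd index and the matching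
  -- lower bound (`o3`, `o5`, `o7`, `o9`) give `R M₂ₖ ≤ ρ² · (lower moments)`; here this reads `R d2
  -- ≤ ρ² ≤ R²`. The constants 4, 51 and 2000 come from adding up the binomial coefficients against
  -- the earlier bounds.
  have b2 : d2 ≤ R := by
    have : R * d2 ≤ R * R := by linarith
    exact le_of_mul_le_mul_left this hR0
  have b1 : d1 ≤ 0 := by
    by_contra hc
    push Not at hc
    nlinarith
  have b1' : -1 ≤ 2 * d1 := by
    by_contra hc
    push Not at hc
    nlinarith
  have b4 : d4 ≤ 4 * R ^ 2 := by
    have h1 : ρ ^ 2 * (3 * d2 + 3 * d1 + 1) ≤ R ^ 2 * (4 * R) :=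
      (mul_le_mul_of_nonneg_left (by linarith) hρ0).trans
        (mul_le_mul_of_nonneg_right hρR (by linarith))
    have : R * d4 ≤ R * (4 * R ^ 2) := by linarith
    exact le_of_mul_le_mul_left this hR0
  have b3 : |d3| ≤ 2 * R := by
    have h1 : ρ ^ 2 * (2 * d1 + 1) ≤ R ^ 2 :=
      (mul_le_of_le_one_right hρ0 (by linarith)).trans hρR
    have h2 : 0 ≤ ρ ^ 2 * (2 * d1 + 1) := mul_nonneg hρ0 (by linarith)
    rw [abs_le]
    constructor
    · have : R * (-(2 * R)) ≤ R * d3 := by linarith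
      exact le_of_mul_le_mul_left this hR0
    · have : R * d3 ≤ R * (2 * R) := by linarith
      exact le_of_mul_le_mul_left this hR0
  obtain ⟨b3a, b3b⟩ := abs_le.1 b3
  have b2' : |d2 - R / 2| ≤ m ^ 2 + 1 := by
    -- The recursion `2R d2 + d3 = ρ²` with `ρ² = R² - m²/4`; the third moment is already known to
    -- be `O(R)`.
    have e : 2 * R * (d2 - R / 2) = -(m ^ 2 / 4) - d3 := by linarith [hR2]
    have hm : (0 : ℝ) ≤ (m : ℝ) ^ 2 := sq_nonneg _
    have hmR : (m : ℝ) ^ 2 ≤ R * m ^ 2 := le_mul_of_one_le_left hm hR1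
    rw [abs_le]
    constructor
    · have : R * (-((m : ℝ) ^ 2 + 1)) ≤ R * (d2 - R / 2) := by linarith
      exact le_of_mul_le_mul_left this hR0
    · have : R * (d2 - R / 2) ≤ R * ((m : ℝ) ^ 2 + 1) := by linarith
      exact le_of_mul_le_mul_left this hR0
  have b6 : d6 ≤ 51 * R ^ 3 := by
    have h1 : 5 * d4 + 10 * d3 + 10 * d2 + 5 * d1 + 1 ≤ 51 * R ^ 2 := by linarith
    have h2 : ρ ^ 2 * (5 * d4 + 10 * d3 + 10 * d2 + 5 * d1 + 1) ≤ R ^ 2 * (51 * R ^ 2) :=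
      (mul_le_mul_of_nonneg_left h1 hρ0).trans
        (mul_le_mul_of_nonneg_right hρR (by positivity))
    have : R * d6 ≤ R * (51 * R ^ 3) := by linarith
    exact le_of_mul_le_mul_left this hR0
  have hR23 : R ^ 2 ≤ R ^ 3 := pow_le_pow_right₀ hR1 (by norm_num)
  refine ⟨?_, b2', by linarith, b4, b6, ?_⟩
  · have e : d1 + 1 / 4 = -(d2 - R / 2) / (2 * R) := by field_simp; linarith
    rw [e, abs_div, abs_neg, abs_of_pos (by linarith : 0 < 2 * R)]
    exact div_le_div₀ (by positivity) b2' hR0 (by linarith)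
  · have h1 : 7 * d6 + 21 * d5 + 35 * d4 + 35 * d3 + 21 * d2 + 7 * d1 + 1 ≤ 2000 * R ^ 3 := by
      linarith
    have h2 : ρ ^ 2 * (7 * d6 + 21 * d5 + 35 * d4 + 35 * d3 + 21 * d2 + 7 * d1 + 1) ≤
        R ^ 2 * (2000 * R ^ 3) :=
      (mul_le_mul_of_nonneg_left h1 hρ0).trans
        (mul_le_mul_of_nonneg_right hρR (by positivity))
    have : R * d8 ≤ R * (2000 * R ^ 4) := by linarith
    exact le_of_mul_le_mul_left this hR0

end IsBesselWeight

/-! ### Inverse moments of the Bessel distribution -/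

namespace IsBesselWeight

variable {m : ℕ} {ρ : ℝ} {p : ℕ → ℝ}

theorem centre_pos (m : ℕ) {ρ : ℝ} (hρ : 1 ≤ ρ) : 0 < centre m ρ := by
  linarith [le_centre m ρ]

theorem summable_mul_of_bdd (h : IsBesselWeight m ρ p) {f : ℕ → ℝ} {C : ℝ}
    (hf : ∀ l, |f l| ≤ C) : Summable fun l => p l * f l := by
  refine Summable.of_norm_bounded (h.hasSum.summable.mul_right C) fun l => ?_
  rw [norm_mul, Real.norm_of_nonneg (h.nonneg l)]
  exact mul_le_mul_of_nonneg_left (hf l) (h.nonneg l)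

theorem summable_shift (h : IsBesselWeight m ρ p) (e : ℝ) (k : ℕ) :
    Summable fun l => p l * (deviation m ρ l + e) ^ k := by
  refine (h.summable_add_pow ((m : ℝ) / 2 - centre m ρ + e) k).congr fun l => ?_
  unfold deviation
  ring

/-- Even moments of the shifted deviation have the expected order. -/
theorem shift_moment_le (m : ℕ) (e : ℝ) :
    ∃ C : ℝ, 0 ≤ C ∧ ∀ (ρ : ℝ) (p : ℕ → ℝ), IsBesselWeight m ρ p → 1 ≤ ρ →
      ∑' l, p l * (deviation m ρ l + e) ^ 4 ≤ C * centre m ρ ^ 2 ∧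
      ∑' l, p l * (deviation m ρ l + e) ^ 6 ≤ C * centre m ρ ^ 3 ∧
      ∑' l, p l * (deviation m ρ l + e) ^ 8 ≤ C * centre m ρ ^ 4 := by
  -- From `(a + b)^k ≤ 2^(k-1) (a^k + b^k)` for `k = 4, 6, 8` and the constants of
  -- `devMoment_bounds`; the three results are added to get one constant.
  refine ⟨8 * (4 + e ^ 4) + 32 * (51 + e ^ 6) + 128 * (2000 + e ^ 8), by positivity, ?_⟩
  intro ρ p h hρ
  obtain ⟨-, -, -, h4, h6, h8⟩ := h.devMoment_bounds hρ
  have hR1 : 1 ≤ centre m ρ := hρ.trans (le_centre m ρ)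
  have key : ∀ k : ℕ, Even k → ∀ B : ℝ, devMoment m ρ p k ≤ B * centre m ρ ^ (k / 2) →
      ∑' l, p l * (deviation m ρ l + e) ^ k ≤ 2 ^ (k - 1) * (B + e ^ k) * centre m ρ ^ (k / 2) := by
    intro k hk B hB
    have hs := ((h.hasSum_dev k).add (h.hasSum.mul_right (e ^ k))).mul_left (2 ^ (k - 1))
    have h1 : ∑' l, p l * (deviation m ρ l + e) ^ k ≤
        2 ^ (k - 1) * (devMoment m ρ p k + 1 * e ^ k) := by
      refine hasSum_le (fun l => ?_) (h.summable_shift e k).hasSum hs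
      have := mul_le_mul_of_nonneg_left (hk.add_pow_le (a := deviation m ρ l) (b := e)) (h.nonneg l)
      linarith
    refine h1.trans ?_
    have h2 : e ^ k ≤ e ^ k * centre m ρ ^ (k / 2) :=
      le_mul_of_one_le_right (hk.pow_nonneg e) (one_le_pow₀ hR1)
    rw [mul_assoc]
    refine mul_le_mul_of_nonneg_left ?_ (by positivity)
    linarith
  have k4 := key 4 (by decide) 4 (by simpa using h4)
  have k6 := key 6 (by decide) 51 (by simpa using h6)
  have k8 := key 8 (by decide) 2000 (by simpa using h8)
  norm_num at k4 k6 k8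
  have e4 : 0 ≤ 8 * (4 + e ^ 4) := by positivity
  have e6 : 0 ≤ 32 * (51 + e ^ 6) := by positivity
  have e8 : 0 ≤ 128 * (2000 + e ^ 8) := by positivity
  refine ⟨k4.trans ?_, k6.trans ?_, k8.trans ?_⟩ <;>
    exact mul_le_mul_of_nonneg_right (by linarith) (by positivity)

/-- If `A ≥ R/2`, the first term suffices. Otherwise `|2(A - R)/R| > 1`, so the second term exceeds
1, while `A ≥ 1` bounds the left side by 1. Values of `l` far below the centre are thus paid for by
even moments of the deviation, without a tail estimate. -/
theorem inv_pow_le {R A : ℝ} (hR : 0 < R) (hA : 1 ≤ A) (k : ℕ) :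
    (A ^ k)⁻¹ ≤ (2 / R) ^ k + (2 * (A - R) / R) ^ (2 * k) := by
  have h0 : 0 ≤ (2 * (A - R) / R) ^ (2 * k) := by rw [pow_mul]; positivity
  by_cases h : R / 2 ≤ A
  · have : A⁻¹ ≤ 2 / R := by
      rw [inv_le_comm₀ (by linarith) (by positivity), inv_div]; exact h
    have : (A ^ k)⁻¹ ≤ (2 / R) ^ k := by
      rw [← inv_pow]; exact pow_le_pow_left₀ (by positivity) this k
    linarith
  · push Not at h
    have h1 : (1 : ℝ) ≤ (2 * (A - R) / R) ^ (2 * k) := by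
      rw [pow_mul]
      refine one_le_pow₀ ?_
      rw [div_pow, le_div_iff₀ (by positivity)]
      nlinarith
    have h2 : (A ^ k)⁻¹ ≤ 1 := inv_le_one_of_one_le₀ (one_le_pow₀ hA)
    have : 0 ≤ (2 / R) ^ k := by positivity
    linarith

theorem inv_abs_le_one {A : ℝ} (hA : 1 ≤ A) (k : ℕ) : |(A ^ k)⁻¹| ≤ 1 := by
  rw [abs_of_nonneg (by positivity)]
  exact inv_le_one_of_one_le₀ (one_le_pow₀ hA)

theorem one_le_shift {e : ℝ} (he : 1 ≤ (m : ℝ) / 2 + e) (l : ℕ) :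
    1 ≤ centre m ρ + (deviation m ρ l + e) := by
  unfold deviation
  have : (0 : ℝ) ≤ l := Nat.cast_nonneg l
  linarith

theorem shift_eq (m : ℕ) (ρ e : ℝ) (l : ℕ) :
    centre m ρ + (deviation m ρ l + e) = l + m / 2 + e := by
  unfold deviation; ring

/-- Inverse third and fourth moments. -/
theorem inv_pow_moment_le (m : ℕ) {e : ℝ} (he : 1 ≤ (m : ℝ) / 2 + e) :
    ∃ C : ℝ, 0 ≤ C ∧ ∀ (ρ : ℝ) (p : ℕ → ℝ), IsBesselWeight m ρ p → 1 ≤ ρ →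
      ∑' l : ℕ, p l * (((l : ℝ) + m / 2 + e) ^ 3)⁻¹ ≤ C / centre m ρ ^ 3 ∧
      ∑' l : ℕ, p l * (((l : ℝ) + m / 2 + e) ^ 4)⁻¹ ≤ C / centre m ρ ^ 4 := by
  obtain ⟨C, hC, hb⟩ := shift_moment_le m e
  refine ⟨16 + 256 * C, by positivity, fun ρ p h hρ => ?_⟩
  obtain ⟨-, h6, h8⟩ := hb ρ p h hρ
  have hR := centre_pos m hρ
  set R := centre m ρ with hRdef
  have key : ∀ k : ℕ, ∑' l : ℕ, p l * (((l : ℝ) + m / 2 + e) ^ k)⁻¹ ≤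
      (2 / R) ^ k + (2 / R) ^ (2 * k) * ∑' l, p l * (deviation m ρ l + e) ^ (2 * k) := by
    intro k
    have h1 := (h.hasSum.mul_left ((2 / R) ^ k)).add
      ((h.summable_shift e (2 * k)).hasSum.mul_left ((2 / R) ^ (2 * k)))
    rw [mul_one] at h1
    refine hasSum_le (fun l => ?_) (Summable.hasSum ?_) h1
    · have h2 := inv_pow_le hR (one_le_shift (ρ := ρ) he l) k
      rw [← hRdef, shift_eq m ρ] at h2
      have h3 := mul_le_mul_of_nonneg_left h2 (h.nonneg l)
      refine h3.trans (le_of_eq ?_)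
      have : (l : ℝ) + m / 2 + e - R = deviation m ρ l + e := by rw [← shift_eq m ρ]; ring
      rw [this, mul_div_right_comm, mul_pow]
      ring
    · refine h.summable_mul_of_bdd (C := 1) fun l => inv_abs_le_one ?_ k
      rw [← shift_eq m ρ]
      exact one_le_shift he l
  constructor
  · refine (key 3).trans ?_
    norm_num
    calc (2 / R) ^ 3 + (2 / R) ^ 6 * ∑' l, p l * (deviation m ρ l + e) ^ 6
        ≤ (2 / R) ^ 3 + (2 / R) ^ 6 * (C * R ^ 3) := by gcongr
      _ = (8 + 64 * C) / R ^ 3 := by field_simp; ring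
      _ ≤ _ := by gcongr <;> norm_num
  · refine (key 4).trans ?_
    norm_num
    calc (2 / R) ^ 4 + (2 / R) ^ 8 * ∑' l, p l * (deviation m ρ l + e) ^ 8
        ≤ (2 / R) ^ 4 + (2 / R) ^ 8 * (C * R ^ 4) := by gcongr
      _ = (16 + 256 * C) / R ^ 4 := by field_simp; ring

theorem hasSum_shift (h : IsBesselWeight m ρ p) (e : ℝ) :
    HasSum (fun l => p l * (deviation m ρ l + e)) (devMoment m ρ p 1 + e) ∧
    HasSum (fun l => p l * (deviation m ρ l + e) ^ 2)
      (devMoment m ρ p 2 + 2 * e * devMoment m ρ p 1 + e ^ 2) ∧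
    HasSum (fun l => p l * (deviation m ρ l + e) ^ 3)
      (devMoment m ρ p 3 + 3 * e * devMoment m ρ p 2 + 3 * e ^ 2 * devMoment m ρ p 1 + e ^ 3) := by
  have h1 := h.hasSum_dev 1
  have h2 := h.hasSum_dev 2
  have h3 := h.hasSum_dev 3
  have h0 := h.hasSum
  refine ⟨?_, ?_, ?_⟩
  · convert h1.add (h0.mul_right e) using 1
    · ext l; ring
    · ring
  · convert (h2.add (h1.mul_left (2 * e))).add (h0.mul_right (e ^ 2)) using 1
    · ext l; ring
    · ring
  · convert ((h3.add (h2.mul_left (3 * e))).add (h1.mul_left (3 * e ^ 2))).add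
      (h0.mul_right (e ^ 3)) using 1
    · ext l; ring
    · ring

/-- Boundedness of the error terms in the expansions of the inverse moments. -/
theorem exists_error_bound (e B₁ B₂ : ℝ) (u v w : ℝ) :
    ∃ C : ℝ, ∀ a b c s q : ℝ, |a| ≤ B₁ → |b| ≤ B₁ → |c| ≤ 4 → |s| ≤ 1 → |q| ≤ B₂ →
      |u * a + v * (b + (2 * e * (a * s - 1 / 4) + e ^ 2)) + w * (c + 3 * e * (b * s + 1 / 2) +
        3 * e ^ 2 * (a * s - 1 / 4) * s + e ^ 3 * s) + q| ≤ C := by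
  -- In the applications `a = (M₁ + 1/4) R`, `b = M₂ - R/2`, `c = M₃/R`, `s = 1/R`, and `q` is the
  -- rescaled remainder. All stay bounded, so continuity on a compact box replaces an explicit
  -- constant.
  have hK : IsCompact (Icc (-B₁) B₁ ×ˢ Icc (-B₁) B₁ ×ˢ Icc (-4 : ℝ) 4 ×ˢ Icc (-1 : ℝ) 1 ×ˢ
      Icc (-B₂) B₂) :=
    isCompact_Icc.prod (isCompact_Icc.prod (isCompact_Icc.prod (isCompact_Icc.prod isCompact_Icc)))
  obtain ⟨C, hC⟩ := hK.exists_bound_of_continuousOn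
    (f := fun x : ℝ × ℝ × ℝ × ℝ × ℝ => u * x.1 + v * (x.2.1 + (2 * e * (x.1 * x.2.2.2.1 - 1 / 4) +
      e ^ 2)) + w * (x.2.2.1 + 3 * e * (x.2.1 * x.2.2.2.1 + 1 / 2) +
        3 * e ^ 2 * (x.1 * x.2.2.2.1 - 1 / 4) * x.2.2.2.1 + e ^ 3 * x.2.2.2.1) + x.2.2.2.2)
    (Continuous.continuousOn (by fun_prop))
  refine ⟨C, fun a b c s q ha hb hc hs hq => ?_⟩
  exact hC (a, b, c, s, q) ⟨abs_le.1 ha, abs_le.1 hb, abs_le.1 hc, abs_le.1 hs, abs_le.1 hq⟩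

/-- Expansion of the inverse first moment. -/
theorem inv_moment (m : ℕ) {e : ℝ} (he : 1 ≤ (m : ℝ) / 2 + e) :
    ∃ C : ℝ, ∀ (ρ : ℝ) (p : ℕ → ℝ), IsBesselWeight m ρ p → 1 ≤ ρ →
      |∑' l : ℕ, p l * ((l : ℝ) + m / 2 + e)⁻¹ -
        (1 / centre m ρ - (e - 3 / 4) / centre m ρ ^ 2)| ≤ C / centre m ρ ^ 3 := by
  obtain ⟨C, hC, hb⟩ := shift_moment_le m e
  obtain ⟨C', hC'⟩ := exists_error_bound e ((m : ℝ) ^ 2 + 1) (6 * C) (-1) 1 (-1)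
  refine ⟨C', fun ρ p h hρ => ?_⟩
  obtain ⟨h4, h6, -⟩ := hb ρ p h hρ
  obtain ⟨b1, b2, b3, -, -, -⟩ := h.devMoment_bounds hρ
  obtain ⟨s1, s2, s3⟩ := h.hasSum_shift e
  have hR := centre_pos m hρ
  have hR1 : 1 ≤ centre m ρ := hρ.trans (le_centre m ρ)
  set R := centre m ρ with hRdef
  have hA : ∀ l : ℕ, 1 ≤ R + (deviation m ρ l + e) := fun l => one_le_shift he l
  have hsum : HasSum (fun l : ℕ => p l * ((l : ℝ) + m / 2 + e)⁻¹)
      (∑' l : ℕ, p l * ((l : ℝ) + m / 2 + e)⁻¹) := by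
    refine Summable.hasSum (h.summable_mul_of_bdd (C := 1) fun l => ?_)
    rw [← shift_eq m ρ]
    simpa using inv_abs_le_one (hA l) 1
  set E := ∑' l : ℕ, p l * ((l : ℝ) + m / 2 + e)⁻¹ with hE
  -- `T` is the mean of the geometric expansion of `1/(R + t)` through `t³`, with `t` the shifted
  -- deviation; the remainder is `t⁴ / (R⁴ (R + t))`. As `E t³ = O(R)` and `E t⁴ = O(R²)`,
  -- everything beyond the `R⁻²` coefficient is `O(R⁻³)`. That coefficient collects `-(e - 1/4)`
  -- from `E t` and `1/2` from `E t²`.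
  set T := 1 / R - (devMoment m ρ p 1 + e) / R ^ 2 +
    (devMoment m ρ p 2 + 2 * e * devMoment m ρ p 1 + e ^ 2) / R ^ 3 -
    (devMoment m ρ p 3 + 3 * e * devMoment m ρ p 2 + 3 * e ^ 2 * devMoment m ρ p 1 + e ^ 3) / R ^ 4
    with hT
  have hrem := hsum.sub ((((h.hasSum.div_const R).sub (s1.div_const (R ^ 2))).add
    (s2.div_const (R ^ 3))).sub (s3.div_const (R ^ 4)))
  rw [← hT] at hrem
  have hrem' : HasSum (fun l => p l * ((deviation m ρ l + e) ^ 4 *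
      (R + (deviation m ρ l + e))⁻¹ / R ^ 4)) (E - T) := by
    refine hrem.congr_fun fun l => ?_
    rw [← shift_eq m ρ, ← hRdef]
    have : R + (deviation m ρ l + e) ≠ 0 := by linarith [hA l]
    field_simp
    ring
  have q0 : 0 ≤ E - T := hrem'.nonneg fun l => by
    have := h.nonneg l
    have := hA l
    have : 0 ≤ R + (deviation m ρ l + e) := by linarith
    positivity
  have q1 : E - T ≤ 2 / R ^ 5 * (C * R ^ 2) + 4 / R ^ 6 * (C * R ^ 3) := by
    have hs := (((h.summable_shift e 4).hasSum.mul_left (2 / R ^ 5)).add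
      ((h.summable_shift e 6).hasSum.mul_left (4 / R ^ 6)))
    have : E - T ≤ _ := hasSum_le (fun l => ?_) hrem' hs
    · refine this.trans ?_
      gcongr
    -- The factor `(R + t)⁻¹` is replaced by `2/R + (2t/R)²`, which costs the fourth and sixth
    -- moments.
    · have h2 := inv_pow_le hR (hA l) 1
      rw [add_sub_cancel_left] at h2
      simp only [pow_one, mul_one] at h2
      calc p l * ((deviation m ρ l + e) ^ 4 * (R + (deviation m ρ l + e))⁻¹ / R ^ 4)
          ≤ p l * ((deviation m ρ l + e) ^ 4 *
            (2 / R + (2 * (deviation m ρ l + e) / R) ^ 2) / R ^ 4) := by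
              have := h.nonneg l
              gcongr
        _ = _ := by field_simp; ring
  have hq : |(E - T) * R ^ 3| ≤ 6 * C := by
    rw [abs_of_nonneg (by positivity)]
    calc (E - T) * R ^ 3 ≤ (2 / R ^ 5 * (C * R ^ 2) + 4 / R ^ 6 * (C * R ^ 3)) * R ^ 3 := by gcongr
      _ = 6 * C := by field_simp; norm_num
  have hfin := hC' ((devMoment m ρ p 1 + 1 / 4) * R) (devMoment m ρ p 2 - R / 2)
    (devMoment m ρ p 3 / R) (1 / R) ((E - T) * R ^ 3)
    (by rw [abs_mul, abs_of_pos hR]; exact (le_div_iff₀ hR).1 b1) b2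
    (by rw [abs_div, abs_of_pos hR]; exact (div_le_iff₀ hR).2 b3)
    (by rw [abs_of_pos (by positivity)]; exact (div_le_one hR).2 hR1) hq
  rw [le_div_iff₀ (by positivity), ← abs_of_pos (show 0 < R ^ 3 by positivity), ← abs_mul]
  refine le_of_eq_of_le (congrArg abs ?_) hfin
  rw [hT]
  field_simp
  ring

/-- Expansion of the inverse second moment. -/
theorem inv_sq_moment (m : ℕ) {e : ℝ} (he : 1 ≤ (m : ℝ) / 2 + e) :
    ∃ C : ℝ, ∀ (ρ : ℝ) (p : ℕ → ℝ), IsBesselWeight m ρ p → 1 ≤ ρ →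
      |∑' l : ℕ, p l * (((l : ℝ) + m / 2 + e) ^ 2)⁻¹ -
        (1 / centre m ρ ^ 2 - (2 * e - 2) / centre m ρ ^ 3)| ≤ C / centre m ρ ^ 4 := by
  obtain ⟨C, hC, hb⟩ := shift_moment_le m e
  obtain ⟨C', hC'⟩ := exists_error_bound e ((m : ℝ) ^ 2 + 1) (44 * C) (-2) 3 (-4)
  refine ⟨C', fun ρ p h hρ => ?_⟩
  obtain ⟨h4, h6, h8⟩ := hb ρ p h hρ
  obtain ⟨b1, b2, b3, -, -, -⟩ := h.devMoment_bounds hρ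
  obtain ⟨s1, s2, s3⟩ := h.hasSum_shift e
  have hR := centre_pos m hρ
  have hR1 : 1 ≤ centre m ρ := hρ.trans (le_centre m ρ)
  set R := centre m ρ with hRdef
  have hA : ∀ l : ℕ, 1 ≤ R + (deviation m ρ l + e) := fun l => one_le_shift he l
  have hsum : HasSum (fun l : ℕ => p l * (((l : ℝ) + m / 2 + e) ^ 2)⁻¹)
      (∑' l : ℕ, p l * (((l : ℝ) + m / 2 + e) ^ 2)⁻¹) := by
    refine Summable.hasSum (h.summable_mul_of_bdd (C := 1) fun l => ?_)
    rw [← shift_eq m ρ]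
    exact inv_abs_le_one (hA l) 2
  set E := ∑' l : ℕ, p l * (((l : ℝ) + m / 2 + e) ^ 2)⁻¹ with hE
  -- The same for `1/(R + t)² = 1/R² - 2t/R³ + 3t²/R⁴ - 4t³/R⁵ + …`. The remainder is written as
  -- `t⁴/(R⁴ (R+t)²) + 4t⁴/(R⁵ (R+t))`, which is visibly nonnegative.
  set T := 1 / R ^ 2 - (devMoment m ρ p 1 + e) / (R ^ 3 / 2) +
    (devMoment m ρ p 2 + 2 * e * devMoment m ρ p 1 + e ^ 2) / (R ^ 4 / 3) -
    (devMoment m ρ p 3 + 3 * e * devMoment m ρ p 2 + 3 * e ^ 2 * devMoment m ρ p 1 + e ^ 3) /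
      (R ^ 5 / 4) with hT
  have hrem := hsum.sub ((((h.hasSum.div_const (R ^ 2)).sub (s1.div_const (R ^ 3 / 2))).add
    (s2.div_const (R ^ 4 / 3))).sub (s3.div_const (R ^ 5 / 4)))
  rw [← hT] at hrem
  have hrem' : HasSum (fun l => p l * ((deviation m ρ l + e) ^ 4 *
      ((R + (deviation m ρ l + e)) ^ 2)⁻¹ / R ^ 4 + 4 * ((deviation m ρ l + e) ^ 4 *
      (R + (deviation m ρ l + e))⁻¹ / R ^ 5))) (E - T) := by
    refine hrem.congr_fun fun l => ?_
    rw [← shift_eq m ρ, ← hRdef]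
    have : R + (deviation m ρ l + e) ≠ 0 := by linarith [hA l]
    field_simp
    ring
  have q0 : 0 ≤ E - T := hrem'.nonneg fun l => by
    have := h.nonneg l
    have := hA l
    have : 0 ≤ R + (deviation m ρ l + e) := by linarith
    positivity
  have q1 : E - T ≤ 12 / R ^ 6 * (C * R ^ 2) + 16 / R ^ 8 * (C * R ^ 4) +
      16 / R ^ 7 * (C * R ^ 3) := by
    have hs := (((h.summable_shift e 4).hasSum.mul_left (12 / R ^ 6)).add
      ((h.summable_shift e 8).hasSum.mul_left (16 / R ^ 8))).add
      ((h.summable_shift e 6).hasSum.mul_left (16 / R ^ 7))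
    have : E - T ≤ _ := hasSum_le (fun l => ?_) hrem' hs
    · refine this.trans ?_
      gcongr
    · have h2 := inv_pow_le hR (hA l) 1
      have h3 := inv_pow_le hR (hA l) 2
      rw [add_sub_cancel_left] at h2 h3
      simp only [pow_one, mul_one, Nat.reduceMul] at h2 h3
      calc p l * ((deviation m ρ l + e) ^ 4 *
            ((R + (deviation m ρ l + e)) ^ 2)⁻¹ / R ^ 4 + 4 * ((deviation m ρ l + e) ^ 4 *
            (R + (deviation m ρ l + e))⁻¹ / R ^ 5))
          ≤ p l * ((deviation m ρ l + e) ^ 4 *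
            ((2 / R) ^ 2 + (2 * (deviation m ρ l + e) / R) ^ 4) / R ^ 4 +
            4 * ((deviation m ρ l + e) ^ 4 *
            (2 / R + (2 * (deviation m ρ l + e) / R) ^ 2) / R ^ 5)) := by
              have := h.nonneg l
              gcongr
        _ = _ := by field_simp; ring
  have hq : |(E - T) * R ^ 4| ≤ 44 * C := by
    rw [abs_of_nonneg (by positivity)]
    calc (E - T) * R ^ 4 ≤ (12 / R ^ 6 * (C * R ^ 2) + 16 / R ^ 8 * (C * R ^ 4) +
          16 / R ^ 7 * (C * R ^ 3)) * R ^ 4 := by gcongr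
      _ = 44 * C := by field_simp; norm_num
  have hfin := hC' ((devMoment m ρ p 1 + 1 / 4) * R) (devMoment m ρ p 2 - R / 2)
    (devMoment m ρ p 3 / R) (1 / R) ((E - T) * R ^ 4)
    (by rw [abs_mul, abs_of_pos hR]; exact (le_div_iff₀ hR).1 b1) b2
    (by rw [abs_div, abs_of_pos hR]; exact (div_le_iff₀ hR).2 b3)
    (by rw [abs_of_pos (by positivity)]; exact (div_le_one hR).2 hR1) hq
  rw [le_div_iff₀ (by positivity), ← abs_of_pos (show 0 < R ^ 4 by positivity), ← abs_mul]
  refine le_of_eq_of_le (congrArg abs ?_) hfin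
  rw [hT]
  field_simp
  ring

end IsBesselWeight

/-! ### Removing the square roots and replacing the centre by `ρ` -/

/-- The squares of the geometric mean of `M`, `M + 1` and of their arithmetic mean differ by exactly
`1/4`, so the inverses differ only at third order. -/
theorem inv_sqrt_mul_bounds {M : ℝ} (hM : 1 ≤ M) :
    0 ≤ (√(M * (M + 1)))⁻¹ - (M + 1 / 2)⁻¹ ∧
      (√(M * (M + 1)))⁻¹ - (M + 1 / 2)⁻¹ ≤ (M ^ 3)⁻¹ := by
  have hx2 : √(M * (M + 1)) ^ 2 = M * (M + 1) := Real.sq_sqrt (by positivity)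
  have hx : M ≤ √(M * (M + 1)) := Real.le_sqrt_of_sq_le (by nlinarith)
  set x := √(M * (M + 1))
  have hx0 : 0 < x := by linarith
  have e : x⁻¹ - (M + 1 / 2)⁻¹ = (4 * (x * (M + 1 / 2) * (x + (M + 1 / 2))))⁻¹ := by
    field_simp
    linear_combination (-16) * hx2
  rw [e]
  refine ⟨by positivity, ?_⟩
  apply inv_anti₀ (by positivity)
  calc M ^ 3 = M * M * M := by ring
    _ ≤ x * (M + 1 / 2) * (x + (M + 1 / 2)) := by gcongr <;> linarith
    _ ≤ _ := by
      have : 0 ≤ x * (M + 1 / 2) * (x + (M + 1 / 2)) := by positivity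
      linarith

/-- The same comparison for `B - 1` and `B + 1`, whose geometric mean has square `B² - 1`. -/
theorem inv_mul_sqrt_bounds {B : ℝ} (hB : 2 ≤ B) :
    0 ≤ (B * √((B - 1) * (B + 1)))⁻¹ - (B ^ 2)⁻¹ ∧
      (B * √((B - 1) * (B + 1)))⁻¹ - (B ^ 2)⁻¹ ≤ 2 * (B ^ 4)⁻¹ := by
  have hx2 : √((B - 1) * (B + 1)) ^ 2 = (B - 1) * (B + 1) := Real.sq_sqrt (by nlinarith)
  have hx : B / 2 ≤ √((B - 1) * (B + 1)) := Real.le_sqrt_of_sq_le (by nlinarith)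
  set x := √((B - 1) * (B + 1))
  have hx0 : 0 < x := by linarith
  have e : (B * x)⁻¹ - (B ^ 2)⁻¹ = (B ^ 2 * (x * (B + x)))⁻¹ := by
    field_simp
    linear_combination (-1) * hx2
  rw [e]
  refine ⟨by positivity, ?_⟩
  have e' : 2 * (B ^ 4)⁻¹ = (B ^ 2 * (B / 2 * B))⁻¹ := by field_simp
  rw [e']
  apply inv_anti₀ (by positivity)
  gcongr
  linarith

/-- Since `R² - ρ² = m²/4`, replacing `R` by `ρ` costs a relative error `O(ρ⁻²)`, which is below the
required precision. -/
theorem centre_compare (m : ℕ) {ρ : ℝ} (hρ : 1 ≤ ρ) :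
    |1 / centre m ρ - 1 / ρ| ≤ m ^ 2 / ρ ^ 3 ∧
    |1 / centre m ρ ^ 2 - 1 / ρ ^ 2| ≤ m ^ 2 / ρ ^ 4 ∧
    |1 / centre m ρ ^ 3 - 1 / ρ ^ 3| ≤ 3 * m ^ 2 / ρ ^ 5 := by
  have hρ0 : 0 < ρ := by linarith
  have h2 := centre_sq m ρ
  have hR := le_centre m ρ
  set R := centre m ρ
  have hR0 : 0 < R := by linarith
  have k1 : 1 / ρ - 1 / R ≤ m ^ 2 / ρ ^ 3 := by
    have e : 1 / ρ - 1 / R = (m ^ 2 / 4) / (ρ * R * (R + ρ)) := by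
      field_simp; linear_combination 4 * h2
    rw [e]
    apply div_le_div₀ (by positivity) (by linarith [sq_nonneg (m : ℝ)]) (by positivity)
    calc ρ ^ 3 = ρ * ρ * ρ := by ring
      _ ≤ ρ * R * (R + ρ) := by gcongr; linarith
  have k0 : 0 ≤ 1 / ρ - 1 / R := sub_nonneg.2 (one_div_le_one_div_of_le hρ0 hR)
  have hb : 1 / R ≤ 1 / ρ := by linarith
  have hb0 : 0 ≤ 1 / R := by positivity
  refine ⟨by rw [abs_sub_comm, abs_of_nonneg k0]; exact k1, ?_, ?_⟩
  · have e : 1 / ρ ^ 2 - 1 / R ^ 2 = (m ^ 2 / 4) / (ρ ^ 2 * R ^ 2) := by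
      field_simp; linear_combination 4 * h2
    rw [abs_sub_comm, e, abs_of_nonneg (by positivity)]
    apply div_le_div₀ (by positivity) (by linarith [sq_nonneg (m : ℝ)]) (by positivity)
    calc ρ ^ 4 = ρ ^ 2 * ρ ^ 2 := by ring
      _ ≤ _ := by gcongr
  · have e : 1 / ρ ^ 3 - 1 / R ^ 3 = (1 / ρ - 1 / R) *
        ((1 / ρ) ^ 2 + (1 / ρ) * (1 / R) + (1 / R) ^ 2) := by ring
    rw [abs_sub_comm, e, abs_of_nonneg (by positivity)]
    calc _ ≤ m ^ 2 / ρ ^ 3 * ((1 / ρ) ^ 2 + (1 / ρ) * (1 / ρ) + (1 / ρ) ^ 2) := by gcongr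
      _ = _ := by field_simp; norm_num

namespace IsBesselWeight

/-- This mean enters `E|X|²` without a factor of `ρ`, so its leading term is enough; the next two
enter with `ρ` and `ρ²` and need one more term. -/
theorem expansion_inv (m : ℕ) :
    ∃ C : ℝ, ∀ (ρ : ℝ) (p : ℕ → ℝ), IsBesselWeight m ρ p → 1 ≤ ρ →
      |∑' l : ℕ, p l * ((l : ℝ) + m + 2)⁻¹ - 1 / ρ| ≤ C / ρ ^ 2 := by
  obtain ⟨C, hC⟩ := inv_moment m (e := (m : ℝ) / 2 + 2)
    (by have : (0 : ℝ) ≤ m := Nat.cast_nonneg m; linarith)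
  refine ⟨|C| + ((m : ℝ) / 2 + 2) + m ^ 2, fun ρ p h hρ => ?_⟩
  have h1 := hC ρ p h hρ
  have hρ0 : 0 < ρ := by linarith
  have hR := le_centre m ρ
  obtain ⟨c1, -, -⟩ := centre_compare m hρ
  have e : ∀ l : ℕ, (l : ℝ) + m / 2 + ((m : ℝ) / 2 + 2) = l + m + 2 := fun l => by ring
  simp only [e] at h1
  set E := ∑' l : ℕ, p l * ((l : ℝ) + m + 2)⁻¹
  set R := centre m ρ
  have hR0 : 0 < R := by linarith
  have e2 : E - 1 / ρ = (E - (1 / R - ((m : ℝ) / 2 + 2 - 3 / 4) / R ^ 2)) + (1 / R - 1 / ρ)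
    - ((m : ℝ) / 2 + 2 - 3 / 4) / R ^ 2 := by ring
  have h23 : ρ ^ 2 ≤ ρ ^ 3 := pow_le_pow_right₀ hρ (by norm_num)
  have b1 : C / R ^ 3 ≤ |C| / ρ ^ 2 := div_le_div₀ (abs_nonneg _) (le_abs_self _) (by positivity)
    (h23.trans (by gcongr))
  have b2 : (m : ℝ) ^ 2 / ρ ^ 3 ≤ m ^ 2 / ρ ^ 2 := by gcongr
  have b3 : |((m : ℝ) / 2 + 2 - 3 / 4) / R ^ 2| ≤ ((m : ℝ) / 2 + 2) / ρ ^ 2 := by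
    have hm : (0 : ℝ) ≤ m := Nat.cast_nonneg m
    have h0 : 0 ≤ (m : ℝ) / 2 + 2 - 3 / 4 := by linarith
    rw [abs_of_nonneg (by positivity)]
    exact div_le_div₀ (by positivity) (by linarith) (by positivity) (by gcongr)
  rw [e2, add_div, add_div]
  refine (abs_sub _ _).trans ?_
  have := abs_add_le (E - (1 / R - ((m : ℝ) / 2 + 2 - 3 / 4) / R ^ 2)) (1 / R - 1 / ρ)
  linarith

/-- The root is replaced by the arithmetic mean `l + m + 3/2`, that is `e = m/2 + 3/2` in
`inv_moment`; the error is an inverse third moment. The coefficient is `e - 3/4 = (2m + 3)/4`. -/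
theorem expansion_inv_sqrt (m : ℕ) :
    ∃ C : ℝ, ∀ (ρ : ℝ) (p : ℕ → ℝ), IsBesselWeight m ρ p → 1 ≤ ρ →
      |ρ * ∑' l : ℕ, p l * (√(((l : ℝ) + m + 1) * (l + m + 2)))⁻¹ -
        (1 - (2 * m + 3) / (4 * ρ))| ≤ C / ρ ^ 2 := by
  have hm : (0 : ℝ) ≤ m := Nat.cast_nonneg m
  obtain ⟨C, hC⟩ := inv_moment m (e := (m : ℝ) / 2 + 3 / 2) (by linarith)
  obtain ⟨C₂, hC₂0, hC₂⟩ := inv_pow_moment_le m (e := (m : ℝ) / 2 + 1) (by linarith)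
  refine ⟨C₂ + |C| + m ^ 2 + (2 * m + 3) / 4 * m ^ 2, fun ρ p h hρ => ?_⟩
  have h1 := hC ρ p h hρ
  obtain ⟨h2, -⟩ := hC₂ ρ p h hρ
  have hρ0 : 0 < ρ := by linarith
  have hR := le_centre m ρ
  obtain ⟨c1, c2, -⟩ := centre_compare m hρ
  have e : ∀ l : ℕ, (l : ℝ) + m / 2 + ((m : ℝ) / 2 + 3 / 2) = (l + m + 1) + 1 / 2 :=
    fun l => by ring
  have e' : ∀ l : ℕ, (l : ℝ) + m / 2 + ((m : ℝ) / 2 + 1) = l + m + 1 := fun l => by ring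
  have e'' : ∀ l : ℕ, (l : ℝ) + m + 2 = (l + m + 1) + 1 := fun l => by ring
  simp only [e] at h1
  simp only [e'] at h2
  simp only [e'']
  have hM : ∀ l : ℕ, 1 ≤ (l : ℝ) + m + 1 := fun l => by
    have : (0 : ℝ) ≤ l := Nat.cast_nonneg l
    linarith
  have s1 : Summable fun l : ℕ => p l * (((l : ℝ) + m + 1) + 1 / 2)⁻¹ :=
    h.summable_mul_of_bdd (C := 1) fun l => by
      simpa using inv_abs_le_one (A := ((l : ℝ) + m + 1) + 1 / 2) (by linarith [hM l]) 1
  have s2 : Summable fun l : ℕ => p l * (((l : ℝ) + m + 1) ^ 3)⁻¹ :=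
    h.summable_mul_of_bdd (C := 1) fun l => inv_abs_le_one (hM l) 3
  have s0 : Summable fun l : ℕ => p l * (√(((l : ℝ) + m + 1) * (l + m + 1 + 1)))⁻¹ :=
    h.summable_mul_of_bdd (C := 1) fun l => by
      have : 1 ≤ √(((l : ℝ) + m + 1) * (l + m + 1 + 1)) :=
        Real.le_sqrt_of_sq_le (by nlinarith [hM l])
      simpa using inv_abs_le_one this 1
  have s3 := s0.hasSum.sub s1.hasSum
  have q0 := s3.nonneg fun l => by
    have := mul_nonneg (h.nonneg l) (inv_sqrt_mul_bounds (hM l)).1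
    linarith
  have q1 := hasSum_le (fun l => by
    have := mul_le_mul_of_nonneg_left (inv_sqrt_mul_bounds (hM l)).2 (h.nonneg l)
    linarith) s3 s2.hasSum
  set E₀ := ∑' l : ℕ, p l * (√(((l : ℝ) + m + 1) * (l + m + 1 + 1)))⁻¹
  set E := ∑' l : ℕ, p l * (((l : ℝ) + m + 1) + 1 / 2)⁻¹
  set R := centre m ρ
  have hR0 : 0 < R := by linarith
  have e2 : ρ * E₀ - (1 - (2 * m + 3) / (4 * ρ)) = ρ * (E₀ - E) +
      ρ * (E - (1 / R - ((m : ℝ) / 2 + 3 / 2 - 3 / 4) / R ^ 2)) + ρ * (1 / R - 1 / ρ)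
      - (2 * m + 3) / 4 * ρ * (1 / R ^ 2 - 1 / ρ ^ 2) := by
    field_simp; ring
  have t1 : |ρ * (E₀ - E)| ≤ C₂ / ρ ^ 2 := by
    rw [abs_of_nonneg (by positivity)]
    calc ρ * (E₀ - E) ≤ ρ * (C₂ / R ^ 3) := by gcongr; linarith
      _ ≤ ρ * (C₂ / ρ ^ 3) := by gcongr
      _ = _ := by field_simp
  have t2 : |ρ * (E - (1 / R - ((m : ℝ) / 2 + 3 / 2 - 3 / 4) / R ^ 2))| ≤ |C| / ρ ^ 2 := by
    rw [abs_mul, abs_of_pos hρ0]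
    calc _ ≤ ρ * (C / R ^ 3) := by gcongr
      _ ≤ ρ * (|C| / ρ ^ 3) := by gcongr; exact le_abs_self _
      _ = _ := by field_simp
  have t3 : |ρ * (1 / R - 1 / ρ)| ≤ m ^ 2 / ρ ^ 2 := by
    rw [abs_mul, abs_of_pos hρ0]
    calc _ ≤ ρ * (m ^ 2 / ρ ^ 3) := by gcongr
      _ = _ := by field_simp
  have t4 : |(2 * m + 3) / 4 * ρ * (1 / R ^ 2 - 1 / ρ ^ 2)| ≤
      ((2 * m + 3) / 4 * m ^ 2) / ρ ^ 2 := by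
    rw [abs_mul, abs_of_pos (by positivity)]
    calc _ ≤ (2 * m + 3) / 4 * ρ * (m ^ 2 / ρ ^ 4) := by gcongr
      _ = (2 * m + 3) / 4 * m ^ 2 / ρ ^ 3 := by field_simp
      _ ≤ _ := by
        have h23 : ρ ^ 2 ≤ ρ ^ 3 := pow_le_pow_right₀ hρ (by norm_num)
        gcongr
  rw [e2, add_div _ _ (ρ ^ 2), add_div _ _ (ρ ^ 2), add_div _ _ (ρ ^ 2)]
  refine (abs_sub _ _).trans (add_le_add ?_ t4)
  exact (abs_add_le _ _).trans (add_le_add ((abs_add_le _ _).trans (add_le_add t1 t2)) t3)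

/-- The denominator is replaced by `(l + m + 2)²`, at the cost of an inverse fourth moment. With `e
= m/2 + 2` the coefficient `2e - 2` of `inv_sq_moment` is `m + 2`. -/
theorem expansion_inv_mul_sqrt (m : ℕ) :
    ∃ C : ℝ, ∀ (ρ : ℝ) (p : ℕ → ℝ), IsBesselWeight m ρ p → 1 ≤ ρ →
      |ρ ^ 2 * ∑' l : ℕ, p l * (((l : ℝ) + m + 2) * √(((l : ℝ) + m + 1) * (l + m + 3)))⁻¹ -
        (1 - (m + 2) / ρ)| ≤ C / ρ ^ 2 := by
  have hm : (0 : ℝ) ≤ m := Nat.cast_nonneg m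
  obtain ⟨C, hC⟩ := inv_sq_moment m (e := (m : ℝ) / 2 + 2) (by linarith)
  obtain ⟨C₂, hC₂0, hC₂⟩ := inv_pow_moment_le m (e := (m : ℝ) / 2 + 2) (by linarith)
  refine ⟨2 * C₂ + |C| + m ^ 2 + (m + 2) * (3 * m ^ 2), fun ρ p h hρ => ?_⟩
  have h1 := hC ρ p h hρ
  obtain ⟨-, h2⟩ := hC₂ ρ p h hρ
  have hρ0 : 0 < ρ := by linarith
  have hR := le_centre m ρ
  obtain ⟨-, c2, c3⟩ := centre_compare m hρ
  have e : ∀ l : ℕ, (l : ℝ) + m / 2 + ((m : ℝ) / 2 + 2) = l + m + 2 := fun l => by ring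
  have e' : ∀ l : ℕ, (l : ℝ) + m + 1 = (l + m + 2) - 1 := fun l => by ring
  have e'' : ∀ l : ℕ, (l : ℝ) + m + 3 = (l + m + 2) + 1 := fun l => by ring
  simp only [e] at h1 h2
  simp only [e', e'']
  have hB : ∀ l : ℕ, 2 ≤ (l : ℝ) + m + 2 := fun l => by
    have : (0 : ℝ) ≤ l := Nat.cast_nonneg l
    linarith
  have s1 : Summable fun l : ℕ => p l * (((l : ℝ) + m + 2) ^ 2)⁻¹ :=
    h.summable_mul_of_bdd (C := 1) fun l => inv_abs_le_one (by linarith [hB l]) 2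
  have s2 : Summable fun l : ℕ => p l * (((l : ℝ) + m + 2) ^ 4)⁻¹ :=
    h.summable_mul_of_bdd (C := 1) fun l => inv_abs_le_one (by linarith [hB l]) 4
  have s0 : Summable fun l : ℕ => p l *
      (((l : ℝ) + m + 2) * √(((l : ℝ) + m + 2 - 1) * (l + m + 2 + 1)))⁻¹ :=
    h.summable_mul_of_bdd (C := 1) fun l => by
      have h3 : 1 ≤ √(((l : ℝ) + m + 2 - 1) * (l + m + 2 + 1)) :=
        Real.le_sqrt_of_sq_le (by nlinarith [hB l])
      have : 1 ≤ ((l : ℝ) + m + 2) * √(((l : ℝ) + m + 2 - 1) * (l + m + 2 + 1)) := by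
        nlinarith [hB l]
      simpa using inv_abs_le_one this 1
  have s3 := s0.hasSum.sub s1.hasSum
  have q0 := s3.nonneg fun l => by
    have := mul_nonneg (h.nonneg l) (inv_mul_sqrt_bounds (hB l)).1
    linarith
  have q1 := hasSum_le (fun l => by
    have := mul_le_mul_of_nonneg_left (inv_mul_sqrt_bounds (hB l)).2 (h.nonneg l)
    linarith) s3 (s2.hasSum.mul_left 2)
  set E₀ := ∑' l : ℕ, p l *
      (((l : ℝ) + m + 2) * √(((l : ℝ) + m + 2 - 1) * (l + m + 2 + 1)))⁻¹
  set E := ∑' l : ℕ, p l * (((l : ℝ) + m + 2) ^ 2)⁻¹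
  set R := centre m ρ
  have hR0 : 0 < R := by linarith
  have e2 : ρ ^ 2 * E₀ - (1 - (m + 2) / ρ) = ρ ^ 2 * (E₀ - E) +
      ρ ^ 2 * (E - (1 / R ^ 2 - (2 * ((m : ℝ) / 2 + 2) - 2) / R ^ 3)) +
      ρ ^ 2 * (1 / R ^ 2 - 1 / ρ ^ 2)
      - (m + 2) * ρ ^ 2 * (1 / R ^ 3 - 1 / ρ ^ 3) := by
    field_simp; ring
  have t1 : |ρ ^ 2 * (E₀ - E)| ≤ (2 * C₂) / ρ ^ 2 := by
    rw [abs_of_nonneg (by positivity)]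
    calc ρ ^ 2 * (E₀ - E) ≤ ρ ^ 2 * (2 * (C₂ / R ^ 4)) := by gcongr; linarith
      _ ≤ ρ ^ 2 * (2 * (C₂ / ρ ^ 4)) := by gcongr
      _ = _ := by field_simp
  have t2 : |ρ ^ 2 * (E - (1 / R ^ 2 - (2 * ((m : ℝ) / 2 + 2) - 2) / R ^ 3))| ≤ |C| / ρ ^ 2 := by
    rw [abs_mul, abs_of_pos (by positivity)]
    calc _ ≤ ρ ^ 2 * (C / R ^ 4) := by gcongr
      _ ≤ ρ ^ 2 * (|C| / ρ ^ 4) := by gcongr; exact le_abs_self _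
      _ = _ := by field_simp
  have t3 : |ρ ^ 2 * (1 / R ^ 2 - 1 / ρ ^ 2)| ≤ m ^ 2 / ρ ^ 2 := by
    rw [abs_mul, abs_of_pos (by positivity)]
    calc _ ≤ ρ ^ 2 * (m ^ 2 / ρ ^ 4) := by gcongr
      _ = _ := by field_simp
  have t4 : |(m + 2) * ρ ^ 2 * (1 / R ^ 3 - 1 / ρ ^ 3)| ≤ ((m + 2) * (3 * m ^ 2)) / ρ ^ 2 := by
    rw [abs_mul, abs_of_pos (by positivity)]
    calc _ ≤ (m + 2) * ρ ^ 2 * (3 * m ^ 2 / ρ ^ 5) := by gcongr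
      _ = (m + 2) * (3 * m ^ 2) / ρ ^ 3 := by field_simp
      _ ≤ _ := by
        have h23 : ρ ^ 2 ≤ ρ ^ 3 := pow_le_pow_right₀ hρ (by norm_num)
        gcongr
  rw [e2, add_div, add_div, add_div]
  refine (abs_sub _ _).trans (add_le_add ?_ t4)
  exact (abs_add_le _ _).trans (add_le_add ((abs_add_le _ _).trans (add_le_add t1 t2)) t3)

end IsBesselWeight

/-! ### Symmetries and moments of the surface measure -/

/-- The homeomorphism of the sphere given by a real-linear isometry. -/
def sphereMap {n : ℕ} (T : Cn n ≃ₗᵢ[ℝ] Cn n) : Sph n ≃ₜ Sph n where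
  toFun x := ⟨T x, by simp⟩
  invFun x := ⟨T.symm x, by simp⟩
  left_inv x := by ext1; simp
  right_inv x := by ext1; simp
  continuous_toFun := by fun_prop
  continuous_invFun := by fun_prop

@[simp]
theorem coe_sphereMap {n : ℕ} (T : Cn n ≃ₗᵢ[ℝ] Cn n) (x : Sph n) :
    (sphereMap T x : Cn n) = T x := rfl

-- The surface measure of a set is, up to a constant, the volume of the cone over it in the unit
-- ball, and a linear isometry carries cones to cones and preserves volume.
open scoped Pointwise in
theorem measurePreserving_sphereMap {n : ℕ} (T : Cn n ≃ₗᵢ[ℝ] Cn n) :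
    MeasurePreserving (sphereMap T) (sigma n) (sigma n) := by
  refine MeasurePreserving.smul_measure ⟨(sphereMap T).measurable, ?_⟩ _
  ext s hs
  rw [Measure.map_apply (sphereMap T).measurable hs, Measure.toSphere_apply' _ hs,
    Measure.toSphere_apply' _ ((sphereMap T).measurable hs)]
  congr 1
  have h1 : T ⁻¹' (Ioo (0 : ℝ) 1 • ((↑) '' s : Set (Cn n))) =
      Ioo (0 : ℝ) 1 • ((↑) '' ((sphereMap T) ⁻¹' s) : Set (Cn n)) := by
    ext x
    simp only [mem_preimage, Set.mem_smul, mem_image]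
    constructor
    · rintro ⟨c, hc, _, ⟨y, hy, rfl⟩, hx⟩
      refine ⟨c, hc, _, ⟨(sphereMap T).symm y, by simpa using hy, rfl⟩, ?_⟩
      apply T.injective
      rw [← hx, map_smul, ← coe_sphereMap, Homeomorph.apply_symm_apply]
    · rintro ⟨c, hc, _, ⟨y, hy, rfl⟩, hx⟩
      refine ⟨c, hc, _, ⟨sphereMap T y, hy, rfl⟩, ?_⟩
      rw [← hx, map_smul, coe_sphereMap]
  rw [← h1]
  have hT : MeasurePreserving T (volume : Measure (Cn n)) volume := T.measurePreserving
  exact hT.measure_preimage_equiv (f := T.toHomeomorph.toMeasurableEquiv) _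

theorem integral_sphereMap {n : ℕ} (T : Cn n ≃ₗᵢ[ℝ] Cn n) (f : Sph n → ℂ) :
    ∫ x, f (sphereMap T x) ∂(sigma n) = ∫ x, f x ∂(sigma n) :=
  (measurePreserving_sphereMap T).integral_comp (sphereMap T).measurableEmbedding f

/-- Integration of products of a function on the sphere and a radial function. -/
theorem integral_polar {n : ℕ} [NeZero n] {F : Cn n → ℝ} {f : Sph n → ℝ} {g : ℝ → ℝ}
    (hF : ∀ (s : Sph n) (r : ℝ), 0 < r → F (r • (s : Cn n)) = f s * g r) :
    ∫ x, F x = (∫ s, f s ∂(volume : Measure (Cn n)).toSphere) *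
      ∫ y in Ioi (0 : ℝ), y ^ (2 * n - 1) * g y := by
  have hdim : Module.finrank ℝ (Cn n) - 1 = 2 * n - 1 := by
    rw [(finrank_fact n).out]; rfl
  have : Nontrivial (Cn n) := Module.nontrivial_of_finrank_pos (R := ℂ) (by
    rw [finrank_euclideanSpace_fin]; exact NeZero.pos n)
  calc
    ∫ x, F x = ∫ x : ({(0)}ᶜ : Set (Cn n)), F x.1 ∂((volume : Measure (Cn n)).comap (↑)) := by
      rw [integral_subtype_comap (measurableSet_singleton _).compl fun x ↦ F x,
        restrict_compl_singleton]
    _ = ∫ x, f x.1 * g x.2 ∂(volume : Measure (Cn n)).toSphere.prod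
          (.volumeIoiPow (Module.finrank ℝ (Cn n) - 1)) := by
      rw [← (volume : Measure (Cn n)).measurePreserving_homeomorphUnitSphereProd.integral_comp
        (Homeomorph.measurableEmbedding _) (fun x => f x.1 * g x.2)]
      congr 1
      ext x
      have hx : (x : Cn n) ≠ 0 := x.2
      rw [← hF _ _ ((homeomorphUnitSphereProd (Cn n) x).2).2]
      simp [smul_smul, norm_ne_zero_iff.2 hx]
    _ = (∫ s, f s ∂(volume : Measure (Cn n)).toSphere) *
        ∫ x : Ioi (0 : ℝ), g x ∂.volumeIoiPow (Module.finrank ℝ (Cn n) - 1) :=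
      integral_prod_mul f fun x : Ioi (0 : ℝ) => g x
    _ = _ := by
      simp only [Measure.volumeIoiPow, ENNReal.ofReal]
      rw [integral_withDensity_eq_integral_smul,
        integral_subtype_comap measurableSet_Ioi
          fun a ↦ Real.toNNReal (a ^ (Module.finrank ℝ (Cn n) - 1)) • g a,
        setIntegral_congr_fun measurableSet_Ioi fun x hx ↦ ?_]
      · rw [NNReal.smul_def, Real.coe_toNNReal _ (pow_nonneg hx.out.le _), hdim, smul_eq_mul]
      · exact (measurable_subtype_coe.pow_const _).real_toNNReal

/-- A unit vector is the image of the first basis vector under a unitary map. -/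
theorem exists_unitary {n : ℕ} [NeZero n] {ζ : Cn n} (hζ : ‖ζ‖ = 1) :
    ∃ T : Cn n ≃ₗᵢ[ℝ] Cn n, ∀ x, inner ℂ ζ (T x) = x 0 := by
  have ho : Orthonormal ℂ (Set.domRestrict ({0} : Set (Fin n)) fun _ : Fin n => ζ) := by
    refine ⟨fun _ => hζ, fun i j hij => ?_⟩
    exact absurd (Subsingleton.elim i j) hij
  obtain ⟨b, hb⟩ := Orthonormal.exists_orthonormalBasis_extension_of_card_eq
    (by simp : Module.finrank ℂ (Cn n) = Fintype.card (Fin n)) ho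
  have hb0 : b 0 = ζ := hb 0 rfl
  refine ⟨⟨b.repr.symm.toLinearEquiv.restrictScalars ℝ, fun x => b.repr.symm.norm_map x⟩, ?_⟩
  intro x
  change inner ℂ ζ (b.repr.symm x) = x 0
  rw [← hb0, ← OrthonormalBasis.repr_apply_apply, LinearIsometryEquiv.apply_symm_apply]

/-- Gaussian moments, up to a constant. -/
theorem exists_integral_gaussian (n : ℕ) [NeZero n] : ∃ c : ℝ, ∀ (ζ : Cn n), ‖ζ‖ = 1 → ∀ a : ℕ,
    ∫ x : Cn n, ‖inner ℂ ζ x‖ ^ (2 * a) * Real.exp (-‖x‖ ^ 2) = c * a.factorial := by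
  let L : Cn n ≃L[ℝ] (Fin n → ℂ) := PiLp.continuousLinearEquiv 2 ℝ (fun _ : Fin n => ℂ)
  let μ : Measure (Fin n → ℂ) := (volume : Measure (Cn n)).map L
  have hμ : μ.IsAddHaarMeasure := L.isAddHaarMeasure_map volume
  -- Uniqueness of Haar measure passes to the product measure on `Fin n → ℂ`. The factor `k` need
  -- not be computed: the constant `c` cancels when the sphere is normalized.
  obtain ⟨k, hk⟩ : ∃ k : NNReal, μ = k • (volume : Measure (Fin n → ℂ)) :=
    ⟨_, Measure.isAddLeftInvariant_eq_smul μ volume⟩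
  refine ⟨k * Real.pi ^ n, fun ζ hζ a => ?_⟩
  obtain ⟨T, hT⟩ := exists_unitary hζ
  have h1 : ∫ x : Cn n, ‖inner ℂ ζ x‖ ^ (2 * a) * Real.exp (-‖x‖ ^ 2) =
      ∫ x : Cn n, ‖x 0‖ ^ (2 * a) * Real.exp (-‖x‖ ^ 2) := by
    rw [← T.measurePreserving.integral_comp T.toHomeomorph.measurableEmbedding]
    simp only [hT, LinearIsometryEquiv.norm_map]
  have h2 : ∫ x : Cn n, ‖x 0‖ ^ (2 * a) * Real.exp (-‖x‖ ^ 2) =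
      ∫ y : Fin n → ℂ, ∏ i, ‖y i‖ ^ (if i = 0 then 2 * a else 0) * Real.exp (-‖y i‖ ^ 2) ∂μ := by
    change _ = ∫ y, _ ∂(Measure.map L.toHomeomorph volume)
    rw [L.toHomeomorph.measurableEmbedding.integral_map]
    congr 1
    ext x
    rw [Finset.prod_mul_distrib, ← Real.exp_sum, EuclideanSpace.norm_sq_eq]
    simp only [Finset.sum_neg_distrib, pow_ite, pow_zero]
    rw [Finset.prod_ite_eq' Finset.univ 0]
    simp [L]
  have h3 : ∀ b : ℕ, ∫ w : ℂ, ‖w‖ ^ (2 * b) * Real.exp (-‖w‖ ^ 2) = Real.pi * b.factorial := by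
    intro b
    have := Complex.integral_rpow_mul_exp_neg_rpow (p := 2) (q := (2 * b : ℕ)) (by norm_num)
      (by have : (0 : ℝ) ≤ (2 * b : ℕ) := Nat.cast_nonneg _
          linarith)
    simp only [Real.rpow_natCast, Real.rpow_two] at this
    rw [this, ← Real.Gamma_nat_eq_factorial]
    push_cast
    rw [show (2 * (b : ℝ) + 2) / 2 = b + 1 by ring]
    ring
  rw [h1, h2, hk, integral_smul_nnreal_measure, volume_pi,
    integral_fintype_prod_eq_prod (fun i (w : ℂ) => ‖w‖ ^ (if i = 0 then 2 * a else 0) *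
      Real.exp (-‖w‖ ^ 2)), NNReal.smul_def, smul_eq_mul, mul_assoc]
  congr 1
  have h4 : ∀ i : Fin n, ∫ w : ℂ, ‖w‖ ^ (if i = 0 then 2 * a else 0) * Real.exp (-‖w‖ ^ 2) =
      Real.pi * (if i = 0 then (a.factorial : ℝ) else 1) := by
    intro i
    split_ifs
    · exact h3 a
    · simpa using h3 0
  simp_rw [h4]
  rw [Finset.prod_mul_distrib, Finset.prod_ite_eq' Finset.univ 0]
  simp

/-- The moments `∫ |x · ζ| ^ (2 a) dσ` of the sphere. -/
theorem integral_norm_inner_pow {n : ℕ} [NeZero n] {ζ : Cn n} (hζ : ‖ζ‖ = 1) (a : ℕ) :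
    ∫ x : Sph n, ‖inner ℂ ζ (x : Cn n)‖ ^ (2 * a) ∂(sigma n) =
      a.factorial * (n - 1).factorial / (n - 1 + a).factorial := by
  obtain ⟨c, hc⟩ := exists_integral_gaussian n
  have hn : 1 ≤ n := NeZero.pos n
  have hrad : ∀ b : ℕ, ∫ y in Ioi (0 : ℝ), y ^ (2 * n - 1) * (y ^ (2 * b) * Real.exp (-y ^ 2)) =
      1 / 2 * (n - 1 + b).factorial := by
    intro b
    have := integral_rpow_mul_exp_neg_rpow (p := 2) (q := (2 * n - 1 + 2 * b : ℕ)) (by norm_num)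
      (by have : (0 : ℝ) ≤ (2 * n - 1 + 2 * b : ℕ) := Nat.cast_nonneg _
          linarith)
    simp only [Real.rpow_natCast, Real.rpow_two] at this
    simp_rw [← mul_assoc, ← pow_add]
    rw [this, ← Real.Gamma_nat_eq_factorial]
    have e : ((2 * n - 1 + 2 * b : ℕ) : ℝ) = 2 * n - 1 + 2 * b := by
      rw [Nat.cast_add, Nat.cast_sub (by omega)]; push_cast; ring
    have e' : ((n - 1 + b : ℕ) : ℝ) = n - 1 + b := by
      rw [Nat.cast_add, Nat.cast_sub (by omega)]; push_cast; ring
    rw [e, e']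
    congr 2
    ring
  have hp : ∀ b : ℕ, c * b.factorial =
      (∫ s : Sph n, ‖inner ℂ ζ (s : Cn n)‖ ^ (2 * b) ∂(volume : Measure (Cn n)).toSphere) *
        (1 / 2 * (n - 1 + b).factorial) := by
    intro b
    rw [← hc ζ hζ b, ← hrad b]
    refine integral_polar fun s r hr => ?_
    have hs : ‖(s : Cn n)‖ = 1 := by simp
    have hin : inner ℂ ζ (r • (s : Cn n)) = (r : ℂ) * inner ℂ ζ (s : Cn n) := by
      rw [← inner_smul_right]; rfl
    rw [hin, norm_mul, Complex.norm_real, Real.norm_of_nonneg hr.le, norm_smul, hs, mul_one,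
      Real.norm_of_nonneg hr.le, mul_pow]
    ring
  -- The case `b = 0` expresses `c` through the total mass of the sphere; dividing the case `b = a`
  -- by it removes the Gaussian constant.
  have h0 := hp 0
  simp only [Nat.factorial_zero, Nat.cast_one, mul_one, mul_zero, pow_zero, integral_const,
    smul_eq_mul, add_zero] at h0
  have ha := hp a
  rw [sigma, integral_smul_measure, ENNReal.toReal_inv, smul_eq_mul]
  change ((volume : Measure (Cn n)).toSphere.real univ)⁻¹ * _ = _
  have hτ : (volume : Measure (Cn n)).toSphere.real univ ≠ 0 := by
    have : Nontrivial (Cn n) := Module.nontrivial_of_finrank_pos (R := ℂ) (by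
      rw [finrank_euclideanSpace_fin]; exact NeZero.pos n)
    rw [Measure.real, ENNReal.toReal_ne_zero]
    refine ⟨?_, measure_ne_top _ _⟩
    rw [Measure.measure_univ_ne_zero]
    exact Measure.toSphere_ne_zero _
  have f1 : ((n - 1 + a).factorial : ℝ) ≠ 0 := by positivity
  rw [h0] at ha
  field_simp
  linear_combination (-2) * ha

/-- Multiplication by a unit scalar on the line spanned by `ζ`-orthogonal vectors: the map
`x ↦ (x · ζ) α ζ + β (x - (x · ζ) ζ)`. -/
theorem exists_rotation {n : ℕ} {ζ : Cn n} (hζ : ‖ζ‖ = 1) {α β : ℂ} (hα : ‖α‖ = 1) (hβ : ‖β‖ = 1) :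
    ∃ T : Cn n ≃ₗᵢ[ℝ] Cn n, ∀ x, T x = (α * inner ℂ ζ x) • ζ + β • (x - inner ℂ ζ x • ζ) := by
  let L : Cn n →ₗ[ℂ] Cn n :=
    { toFun := fun x => (α * inner ℂ ζ x) • ζ + β • (x - inner ℂ ζ x • ζ)
      map_add' := fun x y => by simp only [inner_add_right]; module
      map_smul' := fun c x => by simp only [inner_smul_right, RingHom.id_apply]; module }
  have hζζ : inner ℂ ζ ζ = 1 := by rw [inner_self_eq_norm_sq_to_K, hζ]; simp
  have hL : ∀ x, ‖L x‖ = ‖x‖ := by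
    intro x
    have ho : inner ℂ ζ (x - inner ℂ ζ x • ζ) = 0 := by
      rw [inner_sub_right, inner_smul_right, hζζ]; ring
    have h1 : ‖L x‖ ^ 2 = ‖(α * inner ℂ ζ x) • ζ‖ ^ 2 + ‖β • (x - inner ℂ ζ x • ζ)‖ ^ 2 := by
      have := norm_add_sq_eq_norm_sq_add_norm_sq_of_inner_eq_zero (𝕜 := ℂ)
        ((α * inner ℂ ζ x) • ζ) (β • (x - inner ℂ ζ x • ζ))
        (by rw [inner_smul_left, inner_smul_right, ho]; simp)
      rw [sq, sq, sq]
      exact this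
    have h2 : ‖x‖ ^ 2 = ‖inner ℂ ζ x • ζ‖ ^ 2 + ‖x - inner ℂ ζ x • ζ‖ ^ 2 := by
      have := norm_add_sq_eq_norm_sq_add_norm_sq_of_inner_eq_zero (𝕜 := ℂ)
        (inner ℂ ζ x • ζ) (x - inner ℂ ζ x • ζ)
        (by rw [inner_smul_left, ho]; simp)
      simpa only [sq, add_sub_cancel] using this
    rw [← sq_eq_sq₀ (norm_nonneg _) (norm_nonneg _), h1, h2]
    simp only [norm_smul, norm_mul, hα, hβ, one_mul]
  let I : Cn n →ₗᵢ[ℂ] Cn n := ⟨L, hL⟩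
  let T := I.toLinearIsometryEquiv rfl
  refine ⟨⟨T.toLinearEquiv.restrictScalars ℝ, fun x => T.norm_map x⟩, fun x => rfl⟩

theorem exists_unit_pow_eq_neg_one {d : ℕ} (hd : d ≠ 0) : ∃ α : ℂ, ‖α‖ = 1 ∧ α ^ d = -1 := by
  refine ⟨Complex.exp ((Real.pi / d : ℝ) * Complex.I), Complex.norm_exp_ofReal_mul_I _, ?_⟩
  rw [← Complex.exp_nat_mul]
  have : (d : ℂ) ≠ 0 := by exact_mod_cast hd
  have e : (d : ℂ) * (((Real.pi / d : ℝ) : ℂ) * Complex.I) = Real.pi * Complex.I := by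
    push_cast
    field_simp
  rw [e, Complex.exp_pi_mul_I]

/-- A rotation multiplying `x · ζ` by a unit `α` multiplies the integrand by `α^d`. With `α^d = -1`
the integral equals its own negative. -/
theorem integral_inner_pow_of_lt {n : ℕ} {ζ : Cn n} (hζ : ‖ζ‖ = 1) {d : ℕ} (hd : d ≠ 0) (b : ℕ) :
    ∫ x : Sph n, inner ℂ ζ (x : Cn n) ^ (b + d) *
      (starRingEnd ℂ) (inner ℂ ζ (x : Cn n)) ^ b ∂(sigma n) = 0 := by
  obtain ⟨α, hα, hαd⟩ := exists_unit_pow_eq_neg_one hd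
  obtain ⟨T, hT⟩ := exists_rotation hζ hα (β := 1) (by simp)
  have hζζ : inner ℂ ζ ζ = 1 := by rw [inner_self_eq_norm_sq_to_K, hζ]; simp
  have hT' : ∀ x, inner ℂ ζ (T x) = α * inner ℂ ζ x := by
    intro x
    rw [hT, inner_add_right, inner_smul_right, inner_smul_right, inner_sub_right, inner_smul_right,
      hζζ]
    ring
  have h := integral_sphereMap T (fun x : Sph n => inner ℂ ζ (x : Cn n) ^ (b + d) *
      (starRingEnd ℂ) (inner ℂ ζ (x : Cn n)) ^ b)
  have e : ∀ x : Sph n, inner ℂ ζ (sphereMap T x : Cn n) ^ (b + d) *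
      (starRingEnd ℂ) (inner ℂ ζ (sphereMap T x : Cn n)) ^ b =
      -(inner ℂ ζ (x : Cn n) ^ (b + d) * (starRingEnd ℂ) (inner ℂ ζ (x : Cn n)) ^ b) := by
    intro x
    have hαα : α * (starRingEnd ℂ) α = 1 := by
      rw [Complex.mul_conj, Complex.normSq_eq_norm_sq, hα]; simp
    rw [coe_sphereMap, hT', map_mul]
    calc _ = (α * (starRingEnd ℂ) α) ^ b * α ^ d * (inner ℂ ζ (x : Cn n) ^ (b + d) *
          (starRingEnd ℂ) (inner ℂ ζ (x : Cn n)) ^ b) := by ring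
      _ = _ := by rw [hαα, hαd]; ring
  simp only [e, integral_neg] at h
  linear_combination (-1 / 2) * h

/-- The moments of `x · ζ` on the sphere. -/
theorem integral_inner_pow {n : ℕ} [NeZero n] {ζ : Cn n} (hζ : ‖ζ‖ = 1) (a b : ℕ) :
    ∫ x : Sph n, inner ℂ ζ (x : Cn n) ^ a * (starRingEnd ℂ) (inner ℂ ζ (x : Cn n)) ^ b ∂(sigma n) =
      if a = b then ((a.factorial * (n - 1).factorial / (n - 1 + a).factorial : ℝ) : ℂ) else 0 := by
  rcases lt_trichotomy a b with h | rfl | h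
  · obtain ⟨d, rfl⟩ := Nat.exists_eq_add_of_lt h
    rw [if_neg (by omega)]
    have := congrArg (starRingEnd ℂ) (integral_inner_pow_of_lt hζ (Nat.succ_ne_zero d) a)
    rw [← integral_conj, map_zero] at this
    rw [← this]
    congr 1
    ext x
    simp only [map_mul, map_pow, Complex.conj_conj]
    rw [mul_comm]
    rfl
  · rw [if_pos rfl, ← integral_norm_inner_pow hζ a, ← integral_complex_ofReal]
    congr 1
    ext x
    rw [← mul_pow, Complex.mul_conj, Complex.normSq_eq_norm_sq, pow_mul]
    push_cast
    rfl
  · obtain ⟨d, rfl⟩ := Nat.exists_eq_add_of_lt h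
    rw [if_neg (by omega)]
    exact integral_inner_pow_of_lt hζ (Nat.succ_ne_zero d) b

/-! ### Poisson extensions of holomorphic polynomials -/

/-- The terms of the series `∑ⱼ C(2 j + k, j) sʲ / (1 + s) ^ (2 j + k)`. -/
def walkTerm (s : ℝ) (k j : ℕ) : ℝ := ((2 * j + k).choose j : ℝ) * s ^ j / (1 + s) ^ (2 * j + k)

theorem walkTerm_zero_zero (s : ℝ) : walkTerm s 0 0 = 1 := by simp [walkTerm]

theorem walkTerm_nonneg {s : ℝ} (hs : 0 ≤ s) (k j : ℕ) : 0 ≤ walkTerm s k j := by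
  unfold walkTerm; positivity

theorem walkTerm_le {s : ℝ} (hs : 0 ≤ s) (k j : ℕ) :
    walkTerm s k j ≤ (2 / (1 + s)) ^ k * (4 * s / (1 + s) ^ 2) ^ j := by
  have h : ((2 * j + k).choose j : ℝ) ≤ 2 ^ (2 * j + k) := by
    exact_mod_cast Nat.choose_le_two_pow _ _
  calc walkTerm s k j ≤ 2 ^ (2 * j + k) * s ^ j / (1 + s) ^ (2 * j + k) := by
        unfold walkTerm; gcongr
    _ = _ := by
      rw [pow_add, pow_mul, pow_add, pow_mul, div_pow, div_pow, mul_pow]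
      norm_num
      field_simp

theorem walk_ratio_lt {s : ℝ} (hs1 : s < 1) : 4 * s / (1 + s) ^ 2 < 1 ∨ 1 + s = 0 := by
  by_cases h : 1 + s = 0
  · exact Or.inr h
  · left
    have : 0 < (1 + s) ^ 2 := by positivity
    rw [div_lt_one this]
    nlinarith [sq_pos_of_pos (sub_pos.2 hs1)]

theorem summable_walkTerm {s : ℝ} (hs : 0 ≤ s) (hs1 : s < 1) (k : ℕ) :
    Summable (walkTerm s k) := by
  have h1 : 4 * s / (1 + s) ^ 2 < 1 := (walk_ratio_lt hs1).resolve_right (by positivity)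
  exact Summable.of_nonneg_of_le (walkTerm_nonneg hs k) (walkTerm_le hs k)
    ((summable_geometric_of_lt_one (by positivity) h1).mul_left _)

/-- Pascal's rule, or conditioning on one step of the walk. -/
theorem walkTerm_succ {s : ℝ} (hs : 0 ≤ s) (k j : ℕ) :
    walkTerm s (k + 1) (j + 1) =
      1 / (1 + s) * walkTerm s k (j + 1) + s / (1 + s) * walkTerm s (k + 2) j := by
  have h : (2 * (j + 1) + (k + 1)).choose (j + 1) =
      (2 * j + (k + 2)).choose j + (2 * (j + 1) + k).choose (j + 1) := by
    rw [show 2 * (j + 1) + (k + 1) = (2 * j + k + 2) + 1 by ring, Nat.choose_succ_succ]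
    congr 2
    ring
  unfold walkTerm
  rw [h]
  have : 1 + s ≠ 0 := by positivity
  push_cast
  field_simp
  ring

theorem walkTerm_succ_zero {s : ℝ} (hs : 0 ≤ s) (k : ℕ) :
    walkTerm s (k + 1) 0 = 1 / (1 + s) * walkTerm s k 0 := by
  have : 1 + s ≠ 0 := by positivity
  simp [walkTerm]
  field_simp
  ring

theorem walkTerm_zero_succ {s : ℝ} (hs : 0 ≤ s) (j : ℕ) :
    walkTerm s 0 (j + 1) = 2 * (s / (1 + s)) * walkTerm s 1 j := by
  have h : (2 * (j + 1) + 0).choose (j + 1) = 2 * (2 * j + 1).choose j := by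
    rw [show 2 * (j + 1) + 0 = (2 * j + 1) + 1 by ring, Nat.choose_succ_succ, Nat.succ_eq_add_one,
      Nat.choose_symm_of_eq_add (n := 2 * j + 1) (a := j + 1) (b := j) (by ring)]
    ring
  unfold walkTerm
  rw [h]
  have : 1 + s ≠ 0 := by positivity
  push_cast
  field_simp
  ring

/-- The series `∑ⱼ C(2 j + k, j) sʲ / (1 + s) ^ (2 j + k)` does not depend on `k`. -/
theorem hasSum_walkTerm {s : ℝ} (hs : 0 ≤ s) (hs1 : s < 1) (k : ℕ) :
    HasSum (walkTerm s k) ((1 + s) / (1 - s)) := by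
  -- The series is the expected number of visits to site `k ≥ 0` of a walk from 0 that steps up with
  -- probability `1/(1+s)` and down with probability `s/(1+s)`. Since `s < 1` it drifts upwards and
  -- reaches every such site, so the number does not depend on `k`. The argument below is an
  -- analytic version; it divides by `s`, hence the separate case `s = 0`.
  rcases hs.eq_or_lt with rfl | hs0
  · have : HasSum (walkTerm 0 k) (walkTerm 0 k 0) := hasSum_single 0 fun j hj => by
      simp [walkTerm, hj]
    simpa [walkTerm] using this
  set G : ℕ → ℝ := fun k => ∑' j, walkTerm s k j with hG
  have hsum := summable_walkTerm hs hs1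
  have hrec : ∀ k, G (k + 1) = 1 / (1 + s) * G k + s / (1 + s) * G (k + 2) := by
    intro k
    simp only [hG]
    rw [(hsum (k + 1)).tsum_eq_zero_add, (hsum k).tsum_eq_zero_add, walkTerm_succ_zero hs]
    simp_rw [walkTerm_succ hs]
    rw [Summable.tsum_add (((summable_nat_add_iff 1).2 (hsum k)).mul_left _)
      ((hsum (k + 2)).mul_left _), tsum_mul_left, tsum_mul_left]
    ring
  have h0 : G 0 = 1 + 2 * (s / (1 + s)) * G 1 := by
    simp only [hG]
    rw [(hsum 0).tsum_eq_zero_add, walkTerm_zero_zero]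
    simp_rw [walkTerm_zero_succ hs]
    rw [tsum_mul_left]
  set C := ∑' j, (4 * s / (1 + s) ^ 2) ^ j with hC
  have hr : 4 * s / (1 + s) ^ 2 < 1 := (walk_ratio_lt hs1).resolve_right (by positivity)
  have hbound : ∀ k, |G k| ≤ (2 / (1 + s)) ^ k * C := by
    intro k
    rw [abs_of_nonneg (tsum_nonneg (walkTerm_nonneg hs k)), hC, ← tsum_mul_left]
    exact (hsum k).tsum_le_tsum (walkTerm_le hs k)
      ((summable_geometric_of_lt_one (by positivity) hr).mul_left _)
  -- The recursion says that `G (k+1) - G k = s (G (k+2) - G (k+1))`, so the increments grow like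
  -- `s⁻ᵏ` unless they vanish.
  have hstep : ∀ k, G (k + 1) - G k = (1 / s) ^ k * (G 1 - G 0) := by
    intro k
    induction k with
    | zero => simp
    | succ k ih =>
      have h1 := hrec k
      rw [pow_succ, mul_right_comm, ← ih]
      field_simp at h1 ⊢
      linarith
  -- Growth like `s⁻ᵏ` contradicts `hbound`, because `2s/(1+s) < 1`.
  have hd : G 1 - G 0 = 0 := by
    have hlim : Tendsto (fun k : ℕ => (2 * s / (1 + s)) ^ k * (3 * C)) atTop (𝓝 (0 * (3 * C))) := by
      refine (tendsto_pow_atTop_nhds_zero_of_lt_one (by positivity) ?_).mul_const _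
      rw [div_lt_one (by positivity)]
      linarith
    rw [zero_mul] at hlim
    have hC0 : 0 ≤ C := tsum_nonneg fun j => by positivity
    have hle : ∀ k : ℕ, |G 1 - G 0| ≤ (2 * s / (1 + s)) ^ k * (3 * C) := by
      intro k
      have h1 : |G (k + 1) - G k| ≤ (2 / (1 + s)) ^ k * (3 * C) := by
        refine (abs_sub _ _).trans ((add_le_add (hbound (k + 1)) (hbound k)).trans ?_)
        have : 2 / (1 + s) ≤ 2 := div_le_self (by norm_num) (by linarith)
        have h2 : (2 / (1 + s)) ^ (k + 1) * C ≤ (2 / (1 + s)) ^ k * (2 * C) := by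
          rw [pow_succ, mul_assoc]; gcongr
        linarith
      rw [hstep, abs_mul, abs_of_pos (by positivity)] at h1
      have h3 : s ^ k * ((1 / s) ^ k * |G 1 - G 0|) ≤ s ^ k * ((2 / (1 + s)) ^ k * (3 * C)) := by
        gcongr
      rw [← mul_assoc, ← mul_pow, mul_one_div_cancel hs0.ne', one_pow, one_mul, ← mul_assoc,
        ← mul_pow] at h3
      rwa [show 2 * s / (1 + s) = s * (2 / (1 + s)) by ring]
    exact abs_eq_zero.1 (le_antisymm (ge_of_tendsto' hlim hle) (abs_nonneg _))
  have hconst : ∀ k, G k = G 0 := by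
    intro k
    induction k with
    | zero => rfl
    | succ k ih => have := hstep k; rw [hd, mul_zero] at this; linarith
  have hval : G k = (1 + s) / (1 - s) := by
    rw [hconst k]
    rw [hconst 1] at h0
    have h1 : 1 - s ≠ 0 := by linarith
    have h2 : 1 + s ≠ 0 := by linarith
    field_simp at h0 ⊢
    linarith
  rw [← hval]
  exact (hsum k).hasSum

/-- Termwise integration of a dominated series of continuous functions on the sphere. -/
theorem hasSum_integral_of_bound {n : ℕ} {F : ℕ → Sph n → ℂ} {b : ℕ → ℝ} {g : Sph n → ℂ}
    (hc : ∀ i, Continuous (F i)) (hb : ∀ i x, ‖F i x‖ ≤ b i) (hs : Summable b)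
    (hg : ∀ x, HasSum (fun i => F i x) (g x)) :
    HasSum (fun i => ∫ x, F i x ∂(sigma n)) (∫ x, g x ∂(sigma n)) :=
  hasSum_integral_of_dominated_convergence (fun i _ => b i)
    (fun i => (hc i).aestronglyMeasurable) (fun i => ae_of_all _ (hb i)) (ae_of_all _ fun _ => hs)
    (integrable_const _) (ae_of_all _ hg)

theorem integrable_of_continuous {n : ℕ} {f : Sph n → ℂ} (hf : Continuous f) :
    Integrable f (sigma n) := by
  have := (BoundedContinuousFunction.mkOfCompact ⟨f, hf⟩).integrable (sigma n)
  exact this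

theorem norm_inner_sphere_le {n : ℕ} {ζ : Cn n} (hζ : ‖ζ‖ = 1) (x : Sph n) :
    ‖inner ℂ ζ (x : Cn n)‖ ≤ 1 := by
  have := norm_inner_le_norm (𝕜 := ℂ) ζ (x : Cn n)
  have hx : ‖(x : Cn n)‖ = 1 := by simp
  rwa [hζ, hx, one_mul] at this

theorem integral_re_pow {n : ℕ} [NeZero n] {ζ : Cn n} (hζ : ‖ζ‖ = 1) (l m : ℕ) :
    ∫ x : Sph n, (inner ℂ ζ (x : Cn n) + (starRingEnd ℂ) (inner ℂ ζ (x : Cn n))) ^ m *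
      inner ℂ ζ (x : Cn n) ^ l ∂(sigma n) = ∑ i ∈ Finset.range (m + 1), (m.choose i : ℂ) *
        (if i + l = m - i then (((i + l).factorial * (n - 1).factorial /
          (n - 1 + (i + l)).factorial : ℝ) : ℂ) else 0) := by
  simp_rw [← integral_inner_pow hζ, ← integral_const_mul]
  rw [← integral_finsetSum]
  · congr 1
    ext x
    rw [add_pow, Finset.sum_mul]
    refine Finset.sum_congr rfl fun i _ => ?_
    rw [pow_add]
    ring
  · intro i _
    exact integrable_of_continuous (by fun_prop)

theorem poissonKernel_eq {n : ℕ} {ζ : Cn n} (hζ : ‖ζ‖ = 1) {r : ℝ} (x : Sph n) :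
    poissonKernel ((r : ℂ) • ζ) x =
      (1 - r ^ 2) / (1 + r ^ 2 - 2 * r * (inner ℂ ζ (x : Cn n)).re) ^ n := by
  have hx : ‖(x : Cn n)‖ = 1 := by simp
  have h := norm_sub_sq (𝕜 := ℂ) (x : Cn n) ((r : ℂ) • ζ)
  have h2 : ‖(r : ℂ) • ζ‖ ^ 2 = r ^ 2 := by
    rw [norm_smul, hζ, mul_one, Complex.norm_real, Real.norm_eq_abs, sq_abs]
  have h3 : RCLike.re (inner ℂ (x : Cn n) ((r : ℂ) • ζ)) = r * (inner ℂ ζ (x : Cn n)).re := by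
    rw [inner_re_symm, inner_smul_left]
    simp
  rw [hx, h2, h3] at h
  rw [poissonKernel, h2, pow_mul, h]
  congr 2
  ring

/-- At `rζ` the Poisson kernel depends on `x` only through `Re (x · ζ)` and expands as a negative
binomial series in `u = r (X + X̄)/(1 + r²)`, with `|u| ≤ 2r/(1 + r²) < 1`. Orthogonality leaves a
walk series with offset `N + l`, where `n = N + 1`. Its sum is independent of the offset, which is
why exactly `r^l` remains. -/
theorem integral_poisson_inner_pow {n : ℕ} [NeZero n] {ζ : Cn n} (hζ : ‖ζ‖ = 1) {r : ℝ}
    (hr : 0 ≤ r) (hr1 : r < 1) (l : ℕ) :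
    ∫ x : Sph n, (poissonKernel ((r : ℂ) • ζ) x : ℂ) * inner ℂ ζ (x : Cn n) ^ l ∂(sigma n) =
      (r : ℂ) ^ l := by
  obtain ⟨N, rfl⟩ : ∃ N, n = N + 1 := ⟨n - 1, (Nat.succ_pred_eq_of_pos (NeZero.pos n)).symm⟩
  set s := r ^ 2 with hs
  have hs0 : 0 ≤ s := sq_nonneg r
  have hs1 : s < 1 := by nlinarith
  have hs2 : (1 + s : ℝ) ≠ 0 := by positivity
  have hs3 : (1 - s : ℝ) ≠ 0 := by linarith
  have hθ : 2 * r / (1 + s) < 1 := by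
    rw [div_lt_one (by positivity)]
    nlinarith [sq_pos_of_pos (sub_pos.2 hr1)]
  set X : Sph (N + 1) → ℂ := fun x => inner ℂ ζ (x : Cn (N + 1)) with hX
  have hXc : Continuous X := by simp only [hX]; fun_prop
  set u : Sph (N + 1) → ℂ := fun x => ((r / (1 + s) : ℝ) : ℂ) * (X x + (starRingEnd ℂ) (X x))
    with hu
  have hub : ∀ x, ‖u x‖ ≤ 2 * r / (1 + s) := by
    intro x
    have h1 := norm_inner_sphere_le hζ x
    rw [hu, norm_mul, Complex.norm_real, Real.norm_of_nonneg (by positivity)]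
    calc r / (1 + s) * ‖X x + (starRingEnd ℂ) (X x)‖ ≤ r / (1 + s) * (1 + 1) := by
          gcongr
          refine (norm_add_le _ _).trans (add_le_add h1 ?_)
          rw [RCLike.norm_conj]; exact h1
      _ = _ := by ring
  have hP : ∀ x, (poissonKernel ((r : ℂ) • ζ) x : ℂ) * X x ^ l =
      ((1 - s) / (1 + s) ^ (N + 1) : ℝ) * (1 / (1 - u x) ^ (N + 1) * X x ^ l) := by
    intro x
    have hur : u x = ((2 * r * (X x).re / (1 + s) : ℝ) : ℂ) := by
      rw [hu]
      simp only [Complex.add_conj]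
      push_cast
      ring
    rw [poissonKernel_eq hζ, hur]
    have e : 1 + r ^ 2 - 2 * r * (X x).re = (1 + s) * (1 - 2 * r * (X x).re / (1 + s)) := by
      field_simp
      rw [hs]
    change (((1 - r ^ 2) / (1 + r ^ 2 - 2 * r * (X x).re) ^ (N + 1) : ℝ) : ℂ) * _ = _
    rw [e, mul_pow]
    push_cast
    rw [hs]
    push_cast
    rw [div_mul_eq_div_div]
    ring
  have hser : HasSum (fun m : ℕ => ∫ x, ((m + N).choose N : ℂ) * u x ^ m * X x ^ l
      ∂(sigma (N + 1))) (∫ x, 1 / (1 - u x) ^ (N + 1) * X x ^ l ∂(sigma (N + 1))) := by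
    refine hasSum_integral_of_bound (b := fun m => ((m + N).choose N : ℝ) * (2 * r / (1 + s)) ^ m)
      (fun m => by fun_prop) (fun m x => ?_)
      (hasSum_choose_mul_geometric_of_norm_lt_one N ?_).summable (fun x => ?_)
    · rw [norm_mul, norm_mul, norm_pow, norm_pow, Complex.norm_natCast]
      have h1 : ‖X x‖ ^ l ≤ 1 := pow_le_one₀ (norm_nonneg _) (norm_inner_sphere_le hζ x)
      calc ((m + N).choose N : ℝ) * ‖u x‖ ^ m * ‖X x‖ ^ l
          ≤ ((m + N).choose N : ℝ) * (2 * r / (1 + s)) ^ m * 1 := by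
            gcongr
            exact hub x
        _ = _ := mul_one _
    · rwa [Real.norm_of_nonneg (by positivity)]
    · exact (hasSum_choose_mul_geometric_of_norm_lt_one N ((hub x).trans_lt hθ)).mul_right _
  have hterm : ∀ m : ℕ, ∫ x, ((m + N).choose N : ℂ) * u x ^ m * X x ^ l ∂(sigma (N + 1)) =
      ((m + N).choose N : ℂ) * ((r / (1 + s) : ℝ) : ℂ) ^ m *
        ∑ i ∈ Finset.range (m + 1), (m.choose i : ℂ) *
        (if i + l = m - i then (((i + l).factorial * N.factorial /
          (N + (i + l)).factorial : ℝ) : ℂ) else 0) := by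
    intro m
    have := integral_re_pow hζ l m
    simp only [Nat.add_sub_cancel] at this
    rw [← this, ← integral_const_mul]
    congr 1
    ext x
    rw [hu]
    simp only [mul_pow]
    ring
  -- In `(X + X̄)^m X^l` a nonzero integral needs `i + l = m - i`; only `m = 2j + l` contributes,
  -- through `i = j`.
  have hinj : Function.Injective fun j : ℕ => 2 * j + l := fun i j h => by
    simp only at h; omega
  rw [← hinj.hasSum_iff] at hser
  · have hwalk : HasSum (fun j : ℕ => ((r ^ l * (1 + s) ^ N * walkTerm s (N + l) j : ℝ) : ℂ))
        ((r ^ l * (1 + s) ^ N * ((1 + s) / (1 - s)) : ℝ) : ℂ) := by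
      rw [Complex.hasSum_ofReal]
      exact (hasSum_walkTerm hs0 hs1 (N + l)).mul_left _
    have heq := hser.unique (hwalk.congr_fun fun j => ?_)
    · rw [show (fun x : Sph (N + 1) => (poissonKernel ((r : ℂ) • ζ) x : ℂ) *
        inner ℂ ζ (x : Cn (N + 1)) ^ l) = fun x => _ from funext hP, integral_const_mul, heq,
        ← Complex.ofReal_mul, ← Complex.ofReal_pow]
      congr 1
      field_simp
      ring
    · simp only [Function.comp]
      rw [hterm, Finset.sum_eq_single j]
      · rw [if_pos (by omega)]
        have hc : ((2 * j + l + N).choose N : ℝ) * ((2 * j + l).choose j) *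
            ((j + l).factorial * N.factorial / (N + (j + l)).factorial) =
            ((2 * j + (N + l)).choose j : ℝ) := by
          rw [Nat.cast_choose ℝ (by omega : N ≤ 2 * j + l + N),
            Nat.cast_choose ℝ (by omega : j ≤ 2 * j + l),
            Nat.cast_choose ℝ (by omega : j ≤ 2 * j + (N + l)),
            show 2 * j + l + N - N = 2 * j + l by omega, show 2 * j + l - j = j + l by omega,
            show 2 * j + (N + l) - j = N + (j + l) by omega,
            show 2 * j + (N + l) = 2 * j + l + N by omega]
          field_simp
        rw [← Complex.ofReal_natCast, ← Complex.ofReal_natCast, ← Complex.ofReal_pow,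
          ← Complex.ofReal_mul, ← Complex.ofReal_mul, ← Complex.ofReal_mul, Complex.ofReal_inj,
          walkTerm, ← hc, hs]
        rw [div_pow]
        field_simp
        ring
      · intro i _ hi
        rw [if_neg (by omega), mul_zero]
      · intro hj
        exact absurd (Finset.mem_range.2 (by omega)) hj
  · intro m hm
    rw [hterm, Finset.sum_eq_zero, mul_zero]
    intro i hi
    rw [if_neg, mul_zero]
    intro h
    have := Finset.mem_range.1 hi
    exact hm ⟨i, by simp only; omega⟩

/-- The Poisson extension of a power of a linear form is that power. -/
theorem integral_poisson_pow {n : ℕ} [NeZero n] (w z : Cn n) (hz : ‖z‖ < 1) (l : ℕ) :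
    ∫ x : Sph n, (poissonKernel z x : ℂ) * inner ℂ w (x : Cn n) ^ l ∂(sigma n) =
      inner ℂ w z ^ l := by
  obtain ⟨ζ, hζ, hzζ⟩ : ∃ ζ : Cn n, ‖ζ‖ = 1 ∧ z = ((‖z‖ : ℝ) : ℂ) • ζ := by
    by_cases h : z = 0
    · exact ⟨EuclideanSpace.single 0 1, by simp, by simp [h]⟩
    · refine ⟨(direction z h : Cn n), by simp, ?_⟩
      have : ((‖z‖ : ℝ) : ℂ) ≠ 0 := by exact_mod_cast norm_ne_zero_iff.2 h
      simp only [direction, smul_smul]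
      rw [Complex.ofReal_inv, mul_inv_cancel₀ this, one_smul]
  set r := ‖z‖ with hr
  have hr0 : 0 ≤ r := norm_nonneg z
  have hζζ : inner ℂ ζ ζ = 1 := by rw [inner_self_eq_norm_sq_to_K, hζ]; simp
  set Y : Cn n → ℂ := fun x => inner ℂ w (x - inner ℂ ζ x • ζ) with hY
  have hcP : Continuous fun x : Sph n => (poissonKernel z x : ℂ) := by
    have h := fun x => poissonMap_apply (n := n) (z := z) (by simpa [hr] using hz) x
    simp_rw [← h]
    exact (poissonMap z).continuous
  -- `Y` is the part of `x ↦ x · w` seen by the complement of `ζ`. Rotating that complement by `β`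
  -- fixes `x · ζ`, hence the kernel at `z = rζ`, and multiplies `Y^m` by `β^m = -1`.
  have hvan : ∀ i m : ℕ, m ≠ 0 → ∫ x : Sph n, (poissonKernel z x : ℂ) *
      (inner ℂ ζ (x : Cn n) ^ i * Y x ^ m) ∂(sigma n) = 0 := by
    intro i m hm
    obtain ⟨β, hβ, hβm⟩ := exists_unit_pow_eq_neg_one hm
    obtain ⟨T, hT⟩ := exists_rotation hζ (α := 1) (by simp) hβ
    have hT' : ∀ x, inner ℂ ζ (T x) = inner ℂ ζ x := by
      intro x
      rw [hT, inner_add_right, inner_smul_right, inner_smul_right, inner_sub_right,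
        inner_smul_right, hζζ]
      ring
    have hYT : ∀ x, Y (T x) = β * Y x := by
      intro x
      simp only [hY]
      rw [hT', ← inner_smul_right, hT]
      congr 1
      module
    have h := integral_sphereMap T (fun x : Sph n => (poissonKernel z x : ℂ) *
      (inner ℂ ζ (x : Cn n) ^ i * Y x ^ m))
    have e : ∀ x : Sph n, (poissonKernel z (sphereMap T x) : ℂ) *
        (inner ℂ ζ (sphereMap T x : Cn n) ^ i * Y (sphereMap T x) ^ m) =
        -((poissonKernel z x : ℂ) * (inner ℂ ζ (x : Cn n) ^ i * Y x ^ m)) := by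
      intro x
      have hp : poissonKernel z (sphereMap T x) = poissonKernel z x := by
        rw [hzζ, poissonKernel_eq hζ, poissonKernel_eq hζ, coe_sphereMap, hT']
      rw [hp, coe_sphereMap, hT', hYT, mul_pow, hβm]
      ring
    simp only [e, integral_neg] at h
    linear_combination (-1 / 2) * h
  have hdec : ∀ x : Cn n, inner ℂ w x = Y x + inner ℂ w ζ * inner ℂ ζ x := by
    intro x
    simp only [hY, inner_sub_right, inner_smul_right]
    ring
  have hexp : ∀ x : Sph n, (poissonKernel z x : ℂ) * inner ℂ w (x : Cn n) ^ l =
      ∑ m ∈ Finset.range (l + 1), (inner ℂ w ζ ^ (l - m) * (l.choose m : ℂ)) *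
        ((poissonKernel z x : ℂ) * (inner ℂ ζ (x : Cn n) ^ (l - m) * Y x ^ m)) := by
    intro x
    rw [hdec, add_pow, Finset.mul_sum]
    refine Finset.sum_congr rfl fun m _ => ?_
    rw [mul_pow]
    ring
  simp_rw [hexp]
  rw [integral_finsetSum]
  · simp_rw [integral_const_mul]
    rw [Finset.sum_eq_single 0]
    · have h := integral_poisson_inner_pow hζ hr0 hz l
      rw [← hzζ] at h
      simp only [Nat.sub_zero, Nat.choose_zero_right, Nat.cast_one, mul_one, pow_zero]
      rw [h, ← mul_pow]
      conv_rhs => rw [hzζ, inner_smul_right, mul_comm]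
    · intro m _ hm
      rw [hvan _ m hm, mul_zero]
    · intro h
      exact absurd (Finset.mem_range.2 (by omega)) h
  · intro m _
    refine integrable_of_continuous ?_
    simp only [hY]
    fun_prop

/-! ### Membership of the kernel in the Hardy space -/

/-- The function `x ↦ (x · w) ^ l` on the sphere. -/
def innerPow {n : ℕ} (w : Cn n) (l : ℕ) : C(Sph n, ℂ) :=
  ⟨fun x => inner ℂ w (x : Cn n) ^ l, by fun_prop⟩

theorem innerPow_mem_hardy {n : ℕ} [NeZero n] (w : Cn n) (l : ℕ) :
    ContinuousMap.toLp 2 (sigma n) ℂ (innerPow w l) ∈ hardy n := by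
  change DifferentiableOn ℂ (poissonExt _) (ball 0 1)
  have h : ∀ z ∈ ball (0 : Cn n) 1,
      poissonExt (ContinuousMap.toLp 2 (sigma n) ℂ (innerPow w l)) z = inner ℂ w z ^ l := by
    intro z hz
    rw [← integral_poisson_pow w z (by simpa using hz) l, poissonExt]
    refine integral_congr_ae ?_
    filter_upwards [ContinuousMap.coeFn_toLp (p := 2) (𝕜 := ℂ) (sigma n) (innerPow w l)] with x hx
    rw [hx]
    rfl
  refine DifferentiableOn.congr ?_ h
  have : Differentiable ℂ fun z : Cn n => innerSL ℂ w z ^ l := by fun_prop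
  exact this.differentiableOn

theorem coeff_nonneg (n : ℕ) (p : ℝ) (l : ℕ) : 0 ≤ coeff n p l := Real.sqrt_nonneg _

theorem norm_innerPow_le {n : ℕ} (w : Cn n) (l : ℕ) : ‖innerPow w l‖ ≤ ‖w‖ ^ l := by
  rw [ContinuousMap.norm_le _ (by positivity)]
  intro x
  have h := norm_inner_le_norm (𝕜 := ℂ) w (x : Cn n)
  have hx : ‖(x : Cn n)‖ = 1 := by simp
  rw [hx, mul_one] at h
  change ‖inner ℂ w (x : Cn n) ^ l‖ ≤ _
  rw [norm_pow]
  gcongr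

theorem hasSum_kernel {n : ℕ} (h p : ℝ) (z : Cn n) :
    HasSum (fun l : ℕ => (((coeff n p l / (l.factorial : ℝ) : ℝ) : ℂ) * ((h : ℂ)⁻¹) ^ l) •
      innerPow z l) ⟨fun x => kernelFun h p (x : Cn n) z, continuous_kernelFun h p z⟩ := by
  have hs : Summable (fun l : ℕ => (((coeff n p l / (l.factorial : ℝ) : ℝ) : ℂ) *
      ((h : ℂ)⁻¹) ^ l) • innerPow z l) := by
    refine Summable.of_norm_bounded (summable_coeff n p (|h|⁻¹ * ‖z‖)) fun l => ?_
    rw [norm_smul, norm_mul, norm_pow, norm_inv, Complex.norm_real, Complex.norm_real,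
      Real.norm_eq_abs, Real.norm_eq_abs, mul_pow, mul_assoc,
      abs_of_nonneg (div_nonneg (coeff_nonneg n p l) (Nat.cast_nonneg _))]
    have := norm_innerPow_le z l
    have := div_nonneg (coeff_nonneg n p l) (Nat.cast_nonneg l.factorial)
    gcongr
  convert hs.hasSum using 1
  ext x
  rw [← ContinuousMap.tsum_apply hs]
  simp only [ContinuousMap.coe_mk, kernelFun, ContinuousMap.smul_apply, innerPow, smul_eq_mul,
    div_eq_mul_inv, mul_pow]
  refine tsum_congr fun l => ?_
  ring

theorem kernelL2_mem_hardy {n : ℕ} [NeZero n] (h p : ℝ) (z : Cn n) :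
    kernelL2 n h p z ∈ hardy n := by
  have hs := (hasSum_kernel h p z).mapL (ContinuousMap.toLp 2 (sigma n) ℂ)
  refine (isClosed_hardy n).mem_of_tendsto hs (Eventually.of_forall fun s => ?_)
  refine Submodule.sum_mem _ fun l _ => ?_
  rw [map_smul]
  exact Submodule.smul_mem _ _ (innerPow_mem_hardy z l)

/-- The Berezin transform as a quotient of integrals. -/
theorem berezin_eq {n : ℕ} [NeZero n] (h p : ℝ) (φ : SmoothFun n) (z : Cn n) :
    berezin h p φ z = (∫ x : Sph n, φ x * ((‖kernelFun h p (x : Cn n) z‖ ^ 2 : ℝ) : ℂ) ∂(sigma n)) /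
      ∫ x : Sph n, ((‖kernelFun h p (x : Cn n) z‖ ^ 2 : ℝ) : ℂ) ∂(sigma n) := by
  have hmul : ∀ w : ℂ, inner ℂ w w = ((‖w‖ ^ 2 : ℝ) : ℂ) := fun w => by
    rw [inner_self_eq_norm_sq_to_K]; norm_cast
  have hk := ContinuousMap.coeFn_toLp (p := 2) (𝕜 := ℂ) (sigma n)
    ⟨fun x => kernelFun h p (x : Cn n) z, continuous_kernelFun h p z⟩
  have hφ := ContinuousMap.coeFn_toLp (p := ∞) (𝕜 := ℂ) (sigma n) (φ : C(Sph n, ℂ))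
  -- The projection is moved to the other side of the inner product, where it fixes the kernel.
  rw [berezin, covariantSymbol, toeplitz, ContinuousLinearMap.comp_apply,
    ← Submodule.inner_starProjection_left_eq_right,
    Submodule.starProjection_eq_self_iff.2 (kernelL2_mem_hardy h p z), L2.inner_def, L2.inner_def]
  congr 1
  · refine integral_congr_ae ?_
    have hm := ContinuousLinearMap.coeFn_holder (B := ContinuousLinearMap.mul ℂ ℂ)
      (r := 2) (ContinuousMap.toLp ∞ (sigma n) ℂ (φ : C(Sph n, ℂ))) (kernelL2 n h p z)
    filter_upwards [hk, hφ, hm] with x h1 h2 h3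
    change inner ℂ (kernelL2 n h p z x) (((ContinuousLinearMap.mul ℂ ℂ).holder 2
      (ContinuousMap.toLp ∞ (sigma n) ℂ (φ : C(Sph n, ℂ))) (kernelL2 n h p z)) x) = _
    rw [h3, h2, kernelL2, h1]
    simp only [ContinuousLinearMap.mul_apply', ContinuousMap.coe_mk]
    rw [← smul_eq_mul, inner_smul_right, hmul]
  · refine integral_congr_ae ?_
    filter_upwards [hk] with x h1
    rw [kernelL2, h1, hmul]
    rfl

/-! ### The probability measure defining the Berezin transform -/

/-- `∫ |x · ζ| ^ (2 a) dσ` for a unit vector `ζ`. -/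
def sphereMoment (n a : ℕ) : ℝ := a.factorial * (n - 1).factorial / (n - 1 + a).factorial

/-- The coefficients of `K₋₁` as a power series in `x · ζ`. -/
def kernelCoeff (n : ℕ) (ρ : ℝ) (l : ℕ) : ℝ := coeff n (-1) l / l.factorial * ρ ^ l

/-- From here on `n = m + 2`. The quotient of the Pochhammer symbols `(m+2)_l` and `(m+1)_l`
telescopes. -/
theorem coeff_neg_one (m l : ℕ) : coeff (m + 2) (-1) l = √(((l : ℝ) + m + 1) / (m + 1)) := by
  have h : ∀ l : ℕ, (ascPochhammer ℝ l).eval ((m : ℝ) + 2) * (m + 1) =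
      (ascPochhammer ℝ l).eval ((m : ℝ) + 1) * (l + m + 1) := by
    intro l
    induction l with
    | zero => simp
    | succ l ih =>
      rw [ascPochhammer_succ_eval, ascPochhammer_succ_eval]
      push_cast
      linear_combination ((m : ℝ) + 2 + l) * ih
  have hpos : 0 < (ascPochhammer ℝ l).eval ((m : ℝ) + 1) := ascPochhammer_pos _ _ (by positivity)
  have e : (((m + 2 : ℕ) : ℝ) + -1) = m + 1 := by push_cast; ring
  rw [coeff, e]
  congr 1
  have := h l
  push_cast
  rw [div_eq_div_iff hpos.ne' (by positivity)]
  linarith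

theorem kernelCoeff_nonneg (n : ℕ) {ρ : ℝ} (hρ : 0 ≤ ρ) (l : ℕ) : 0 ≤ kernelCoeff n ρ l :=
  mul_nonneg (div_nonneg (coeff_nonneg _ _ _) (Nat.cast_nonneg _)) (pow_nonneg hρ _)

theorem direction_norm {n : ℕ} (z : Cn n) (hz : z ≠ 0) : ‖(direction z hz : Cn n)‖ = 1 := by simp

theorem inner_direction {n : ℕ} (z : Cn n) (hz : z ≠ 0) (x : Cn n) :
    inner ℂ z x = (‖z‖ : ℂ) * inner ℂ (direction z hz : Cn n) x := by
  have : (‖z‖ : ℂ) ≠ 0 := by exact_mod_cast norm_ne_zero_iff.2 hz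
  simp only [direction, inner_smul_left]
  rw [Complex.conj_ofReal, Complex.ofReal_inv, mul_inv_cancel_left₀ this]

theorem hasSum_kernelFun {n : ℕ} (h : ℝ) (z : Cn n) (hz : z ≠ 0) (x : Sph n) :
    HasSum (fun l : ℕ => (kernelCoeff n (‖z‖ / h) l : ℂ) *
      inner ℂ (direction z hz : Cn n) (x : Cn n) ^ l) (kernelFun h (-1) (x : Cn n) z) := by
  have h1 := ContinuousMap.hasSum_apply (hasSum_kernel h (-1) z) x
  refine h1.congr_fun fun l => ?_
  simp only [ContinuousMap.smul_apply, smul_eq_mul, innerPow, ContinuousMap.coe_mk, kernelCoeff]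
  rw [inner_direction z hz]
  push_cast
  rw [mul_pow, div_eq_mul_inv (‖z‖ : ℂ), mul_pow]
  ring

theorem summable_kernelCoeff (n : ℕ) (ρ : ℝ) : Summable (kernelCoeff n ρ) :=
  summable_coeff n (-1) ρ

section Series

variable {n : ℕ} [NeZero n] {h : ℝ} {z : Cn n}

/-- Orthogonality selects the single term `l = i` of the conjugate kernel. Expanding the two factors
of `|K|²` one after the other avoids a double series. -/
theorem integral_pow_mul_conj_kernel (hh : 0 < h) (hz : z ≠ 0) (b i : ℕ) :
    ∫ x : Sph n, inner ℂ (direction z hz : Cn n) (x : Cn n) ^ (b + i) *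
      (starRingEnd ℂ) (inner ℂ (direction z hz : Cn n) (x : Cn n)) ^ b *
      (starRingEnd ℂ) (kernelFun h (-1) (x : Cn n) z) ∂(sigma n) =
      ((kernelCoeff n (‖z‖ / h) i * sphereMoment n (b + i) : ℝ) : ℂ) := by
  set ζ : Cn n := ((direction z hz : Sph n) : Cn n) with hζdef
  have hζ : ‖ζ‖ = 1 := direction_norm z hz
  set κ := kernelCoeff n (‖z‖ / h) with hκ
  have hκ0 : ∀ l, 0 ≤ κ l := kernelCoeff_nonneg n (by positivity)
  have hs := hasSum_integral_of_bound (n := n) (b := κ)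
    (F := fun l x => inner ℂ ζ (x : Cn n) ^ (b + i) * (starRingEnd ℂ) (inner ℂ ζ (x : Cn n)) ^ b *
      ((κ l : ℂ) * (starRingEnd ℂ) (inner ℂ ζ (x : Cn n)) ^ l))
    (g := fun x => inner ℂ ζ (x : Cn n) ^ (b + i) *
      (starRingEnd ℂ) (inner ℂ ζ (x : Cn n)) ^ b * (starRingEnd ℂ) (kernelFun h (-1) (x : Cn n) z))
    (fun l => by fun_prop) (fun l x => ?_) (summable_kernelCoeff n _) (fun x => ?_)
  · refine hs.unique ?_
    have e : ∀ l, ∫ x : Sph n, inner ℂ ζ (x : Cn n) ^ (b + i) *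
        (starRingEnd ℂ) (inner ℂ ζ (x : Cn n)) ^ b *
        ((κ l : ℂ) * (starRingEnd ℂ) (inner ℂ ζ (x : Cn n)) ^ l) ∂(sigma n) =
        (κ l : ℂ) * (if b + i = b + l then (sphereMoment n (b + i) : ℂ) else 0) := by
      intro l
      rw [sphereMoment, ← integral_inner_pow hζ, ← integral_const_mul]
      congr 1
      ext x
      rw [pow_add _ b l]
      ring
    simp only [e]
    convert hasSum_single i fun l hl => ?_ using 1
    · rw [if_pos rfl]; push_cast; rfl
    · rw [if_neg (by omega), mul_zero]
  · have h1 := norm_inner_sphere_le hζ x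
    rw [norm_mul, norm_mul, norm_mul, norm_pow, norm_pow, norm_pow, RCLike.norm_conj,
      Complex.norm_real, Real.norm_of_nonneg (hκ0 l)]
    have hp : ∀ k, ‖inner ℂ ζ (x : Cn n)‖ ^ k ≤ 1 := fun k => pow_le_one₀ (norm_nonneg _) h1
    have := hκ0 l
    calc _ ≤ 1 * 1 * (κ l * 1) := by gcongr <;> exact hp _
      _ = _ := by ring
  · have h1 := (hasSum_kernelFun h z hz x).map (starRingEnd ℂ) Complex.continuous_conj
    refine (h1.mul_left _).congr_fun fun l => ?_
    simp only [Function.comp, map_mul, map_pow, Complex.conj_ofReal]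
    rfl

/-- Moments of the density `|K₋₁(·, z)|²` as series. -/
theorem hasSum_moment (hh : 0 < h) (hz : z ≠ 0) (b d : ℕ) :
    HasSum (fun l : ℕ => ((kernelCoeff n (‖z‖ / h) l * kernelCoeff n (‖z‖ / h) (l + d) *
        sphereMoment n (b + (l + d)) : ℝ) : ℂ))
      (∫ x : Sph n, inner ℂ (direction z hz : Cn n) (x : Cn n) ^ (b + d) *
        (starRingEnd ℂ) (inner ℂ (direction z hz : Cn n) (x : Cn n)) ^ b *
        ((‖kernelFun h (-1) (x : Cn n) z‖ ^ 2 : ℝ) : ℂ) ∂(sigma n)) := by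
  set ζ : Cn n := ((direction z hz : Sph n) : Cn n) with hζdef
  have hζ : ‖ζ‖ = 1 := direction_norm z hz
  set κ := kernelCoeff n (‖z‖ / h) with hκ
  have hκ0 : ∀ l, 0 ≤ κ l := kernelCoeff_nonneg n (by positivity)
  have hKc : Continuous fun x : Sph n => kernelFun h (-1) (x : Cn n) z :=
    continuous_kernelFun h (-1) z
  obtain ⟨B, hB⟩ : ∃ B, ∀ x : Sph n, ‖kernelFun h (-1) (x : Cn n) z‖ ≤ B := by
    obtain ⟨B, hB⟩ := isCompact_univ.exists_bound_of_continuousOn hKc.continuousOn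
    exact ⟨B, fun x => hB x (mem_univ x)⟩
  have hs := hasSum_integral_of_bound (n := n) (b := fun l => κ l * B)
    (F := fun l x => ((κ l : ℂ) * inner ℂ ζ (x : Cn n) ^ l) * (inner ℂ ζ (x : Cn n) ^ (b + d) *
      (starRingEnd ℂ) (inner ℂ ζ (x : Cn n)) ^ b * (starRingEnd ℂ) (kernelFun h (-1) (x : Cn n) z)))
    (g := fun x => kernelFun h (-1) (x : Cn n) z * (inner ℂ ζ (x : Cn n) ^ (b + d) *
      (starRingEnd ℂ) (inner ℂ ζ (x : Cn n)) ^ b * (starRingEnd ℂ) (kernelFun h (-1) (x : Cn n) z)))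
    (fun l => by fun_prop) (fun l x => ?_) ((summable_kernelCoeff n _).mul_right B) (fun x => ?_)
  · convert hs using 1
    · ext l
      have := integral_pow_mul_conj_kernel hh hz b (l + d)
      rw [mul_assoc, Complex.ofReal_mul, ← this, ← integral_const_mul]
      congr 1
      ext x
      ring
    · congr 1
      ext x
      rw [← Complex.normSq_eq_norm_sq, ← Complex.mul_conj]
      ring
  · have h1 := norm_inner_sphere_le hζ x
    rw [norm_mul, norm_mul, norm_mul, norm_mul, norm_pow, norm_pow, norm_pow, RCLike.norm_conj,
      RCLike.norm_conj, Complex.norm_real, Real.norm_of_nonneg (hκ0 l)]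
    have hp : ∀ k, ‖inner ℂ ζ (x : Cn n)‖ ^ k ≤ 1 := fun k => pow_le_one₀ (norm_nonneg _) h1
    have := hκ0 l
    calc _ ≤ (κ l * 1) * (1 * 1 * B) := by
          gcongr
          · exact hp _
          · exact hp _
          · exact hp _
          · exact hB x
      _ = _ := by ring
  · exact (hasSum_kernelFun h z hz x).mul_right _

end Series

/-- The unnormalized weights `ρ ^ (2 l) m! / (l! (l + m)!)`. -/
def besselTerm (m : ℕ) (ρ : ℝ) (l : ℕ) : ℝ :=
  ρ ^ (2 * l) * m.factorial / (l.factorial * (l + m).factorial)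

/-- For `p = -1` the squared coefficient contributes `(l+m+1)/(m+1)`, which lowers `(l+m+1)!` to
`(l+m)!` and `(m+1)!` to `m!`. -/
theorem besselTerm_eq (m : ℕ) (ρ : ℝ) (l : ℕ) :
    kernelCoeff (m + 2) ρ l * kernelCoeff (m + 2) ρ l * sphereMoment (m + 2) l =
      besselTerm m ρ l := by
  have hc : coeff (m + 2) (-1) l * coeff (m + 2) (-1) l = ((l : ℝ) + m + 1) / (m + 1) := by
    rw [coeff_neg_one, Real.mul_self_sqrt (by positivity)]
  have e : kernelCoeff (m + 2) ρ l * kernelCoeff (m + 2) ρ l * sphereMoment (m + 2) l =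
      (coeff (m + 2) (-1) l * coeff (m + 2) (-1) l) * (ρ ^ l / l.factorial) ^ 2 *
        sphereMoment (m + 2) l := by
    unfold kernelCoeff; ring
  rw [e, hc, sphereMoment, besselTerm, show m + 2 - 1 = m + 1 from rfl,
    show m + 1 + l = (l + m) + 1 by ring, Nat.factorial_succ, Nat.factorial_succ]
  push_cast
  have : (l : ℝ) + m + 1 ≠ 0 := by positivity
  field_simp
  ring

theorem coeff_mul_coeff (m l d : ℕ) : coeff (m + 2) (-1) l * coeff (m + 2) (-1) (l + d) =
    √(((l : ℝ) + m + 1) * (l + d + m + 1)) / (m + 1) := by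
  rw [coeff_neg_one, coeff_neg_one, ← Real.sqrt_mul (by positivity), div_mul_div_comm,
    Real.sqrt_div' _ (by positivity), Real.sqrt_mul_self (by positivity)]
  push_cast
  rfl

theorem kernelCoeff_mul (m : ℕ) (ρ : ℝ) (l d : ℕ) :
    kernelCoeff (m + 2) ρ l * kernelCoeff (m + 2) ρ (l + d) =
      √(((l : ℝ) + m + 1) * (l + d + m + 1)) / (m + 1) * ρ ^ (2 * l + d) /
        (l.factorial * (l + d).factorial) := by
  have : kernelCoeff (m + 2) ρ l * kernelCoeff (m + 2) ρ (l + d) =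
      (coeff (m + 2) (-1) l * coeff (m + 2) (-1) (l + d)) * ρ ^ (2 * l + d) /
        (l.factorial * (l + d).factorial) := by
    unfold kernelCoeff; ring
  rw [this, coeff_mul_coeff]

/-- The coefficients give the root of `(l+m+1)(l+m+2)` and the factorials give its inverse, so an
inverse root remains. The index `0 + (l + 1)` matches `b = 0`, `d = 1` in `hasSum_moment`. -/
theorem moment_one_eq (m : ℕ) (ρ : ℝ) (l : ℕ) :
    kernelCoeff (m + 2) ρ l * kernelCoeff (m + 2) ρ (l + 1) * sphereMoment (m + 2) (0 + (l + 1)) =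
      ρ * (besselTerm m ρ l * (√(((l : ℝ) + m + 1) * (l + m + 2)))⁻¹) := by
  have hs : √(((l : ℝ) + m + 1) * (l + m + 2)) ^ 2 = ((l : ℝ) + m + 1) * (l + m + 2) :=
    Real.sq_sqrt (by positivity)
  have hs0 : √(((l : ℝ) + m + 1) * (l + m + 2)) ≠ 0 := (Real.sqrt_pos.2 (by positivity)).ne'
  rw [kernelCoeff_mul, sphereMoment, besselTerm, show m + 2 - 1 = m + 1 from rfl, zero_add,
    show m + 1 + (l + 1) = (l + m) + 1 + 1 by ring, Nat.factorial_succ (l + m + 1),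
    Nat.factorial_succ (l + m), Nat.factorial_succ m]
  push_cast
  rw [show (l : ℝ) + 1 + m + 1 = l + m + 2 by ring, show (l : ℝ) + m + 1 + 1 = l + m + 2 by ring]
  set x := √(((l : ℝ) + m + 1) * (l + m + 2))
  have : (l : ℝ) + m + 1 ≠ 0 := by positivity
  have : (l : ℝ) + m + 2 ≠ 0 := by positivity
  field_simp
  linear_combination ρ * ρ ^ (2 * l) * hs

theorem moment_two_eq (m : ℕ) (ρ : ℝ) (l : ℕ) :
    kernelCoeff (m + 2) ρ l * kernelCoeff (m + 2) ρ (l + 2) * sphereMoment (m + 2) (0 + (l + 2)) =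
      ρ ^ 2 * (besselTerm m ρ l * (((l : ℝ) + m + 2) *
        √(((l : ℝ) + m + 1) * (l + m + 3)))⁻¹) := by
  have hs : √(((l : ℝ) + m + 1) * (l + m + 3)) ^ 2 = ((l : ℝ) + m + 1) * (l + m + 3) :=
    Real.sq_sqrt (by positivity)
  have hs0 : √(((l : ℝ) + m + 1) * (l + m + 3)) ≠ 0 := (Real.sqrt_pos.2 (by positivity)).ne'
  rw [kernelCoeff_mul, sphereMoment, besselTerm, show m + 2 - 1 = m + 1 from rfl, zero_add,
    show m + 1 + (l + 2) = (l + m) + 1 + 1 + 1 by ring, Nat.factorial_succ (l + m + 1 + 1),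
    Nat.factorial_succ (l + m + 1), Nat.factorial_succ (l + m), Nat.factorial_succ m]
  push_cast
  rw [show (l : ℝ) + 2 + m + 1 = l + m + 3 by ring, show (l : ℝ) + m + 1 + 1 = l + m + 2 by ring,
    show (l : ℝ) + m + 2 + 1 = l + m + 3 by ring]
  set x := √(((l : ℝ) + m + 1) * (l + m + 3))
  have : (l : ℝ) + m + 1 ≠ 0 := by positivity
  have : (l : ℝ) + m + 2 ≠ 0 := by positivity
  have : (l : ℝ) + m + 3 ≠ 0 := by positivity
  field_simp
  linear_combination ρ ^ 2 * ρ ^ (2 * l) * hs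

/-- Passing from the moment of index `l` to `l + 1` multiplies by `(l+1)/(l+m+2) = 1 -
(m+1)/(l+m+2)`. -/
theorem moment_norm_eq (m : ℕ) (ρ : ℝ) (l : ℕ) :
    kernelCoeff (m + 2) ρ l * kernelCoeff (m + 2) ρ (l + 0) * sphereMoment (m + 2) (1 + (l + 0)) =
      besselTerm m ρ l - (m + 1) * (besselTerm m ρ l * ((l : ℝ) + m + 2)⁻¹) := by
  have h : sphereMoment (m + 2) (1 + l) = sphereMoment (m + 2) l * ((l + 1) / (l + m + 2)) := by
    rw [sphereMoment, sphereMoment, show m + 2 - 1 = m + 1 from rfl, add_comm 1 l,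
      show m + 1 + (l + 1) = (l + m + 1) + 1 by ring, show m + 1 + l = l + m + 1 by ring,
      Nat.factorial_succ, Nat.factorial_succ (l + m + 1)]
    push_cast
    rw [show (l : ℝ) + m + 1 + 1 = l + m + 2 by ring]
    have : (l : ℝ) + m + 2 ≠ 0 := by positivity
    field_simp
  rw [add_zero, h, ← mul_assoc, besselTerm_eq]
  have : (l : ℝ) + m + 2 ≠ 0 := by positivity
  field_simp
  ring

theorem summable_besselTerm_mul_pow (m : ℕ) (ρ : ℝ) (k : ℕ) :
    Summable fun l : ℕ => besselTerm m ρ l * (l : ℝ) ^ k := by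
  refine Summable.of_nonneg_of_le (fun l => ?_) (fun l => ?_)
    ((Real.summable_pow_div_factorial (ρ ^ 2 * Real.exp 1)).mul_left ((m.factorial : ℝ) * k.factorial))
  · unfold besselTerm
    rw [pow_mul]
    positivity
  · have h1 : (l : ℝ) ^ k ≤ k.factorial * Real.exp 1 ^ l := by
      have := Real.pow_div_factorial_le_exp (l : ℝ) (Nat.cast_nonneg l) k
      rw [div_le_iff₀ (by positivity)] at this
      rw [← Real.exp_nat_mul, mul_one]
      linarith
    have h2 : (1 : ℝ) ≤ (l + m).factorial := by exact_mod_cast Nat.one_le_of_lt (Nat.factorial_pos _)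
    calc besselTerm m ρ l * (l : ℝ) ^ k
        ≤ ((ρ ^ 2) ^ l * m.factorial / (l.factorial * 1)) * (k.factorial * Real.exp 1 ^ l) := by
          unfold besselTerm
          rw [pow_mul]
          gcongr
      _ = _ := by rw [mul_pow]; field_simp

/-- The normalized weights form a Bessel distribution. -/
theorem isBesselWeight_normalized (m : ℕ) (ρ : ℝ) :
    0 < ∑' l, besselTerm m ρ l ∧
      IsBesselWeight m ρ fun l => besselTerm m ρ l / ∑' l, besselTerm m ρ l := by
  have h0 : ∀ l, 0 ≤ besselTerm m ρ l := fun l => by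
    unfold besselTerm
    rw [pow_mul]
    positivity
  have hs : Summable (besselTerm m ρ) := by simpa using summable_besselTerm_mul_pow m ρ 0
  have hpos : 0 < ∑' l, besselTerm m ρ l := by
    refine hs.tsum_pos h0 0 ?_
    unfold besselTerm
    simp
    positivity
  refine ⟨hpos, ⟨fun l => div_nonneg (h0 l) hpos.le, ?_, fun l => ?_, fun k => ?_⟩⟩
  · have := hs.hasSum.div_const (∑' l, besselTerm m ρ l)
    rwa [div_self hpos.ne'] at this
  · have : besselTerm m ρ (l + 1) * (((l : ℝ) + 1) * (l + 1 + m)) = ρ ^ 2 * besselTerm m ρ l := by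
      unfold besselTerm
      rw [show l + 1 + m = (l + m) + 1 by ring, Nat.factorial_succ, Nat.factorial_succ (l + m)]
      push_cast
      have : (l : ℝ) + m + 1 ≠ 0 := by positivity
      field_simp
      ring
    rw [div_mul_eq_mul_div, this]
    ring
  · refine ((summable_besselTerm_mul_pow m ρ k).div_const (∑' l, besselTerm m ρ l)).congr fun l => ?_
    ring

/-- The total mass of `|K₋₁(·, z)|² σ`. -/
def kernelMass {n : ℕ} (h : ℝ) (z : Cn n) : ℝ :=
  ∫ x : Sph n, ‖kernelFun h (-1) (x : Cn n) z‖ ^ 2 ∂(sigma n)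

/-- The measure `|K₋₁(·, z)|² σ`, normalized. -/
def berezinMeasure {n : ℕ} (h : ℝ) (z : Cn n) : Measure (Sph n) :=
  (sigma n).withDensity fun x =>
    ENNReal.ofReal (‖kernelFun h (-1) (x : Cn n) z‖ ^ 2 / kernelMass h z)

theorem integral_berezinMeasure {n : ℕ} (h : ℝ) (z : Cn n) (f : Sph n → ℂ) :
    ∫ x, f x ∂(berezinMeasure h z) =
      (∫ x : Sph n, f x * ((‖kernelFun h (-1) (x : Cn n) z‖ ^ 2 : ℝ) : ℂ) ∂(sigma n)) /
        kernelMass h z := by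
  have hK := continuous_kernelFun (n := n) h (-1) z
  have hKm := hK.measurable
  have hm : 0 ≤ kernelMass h z := integral_nonneg fun x => by positivity
  rw [berezinMeasure, integral_withDensity_eq_integral_toReal_smul (by fun_prop)
    (ae_of_all _ fun _ => ENNReal.ofReal_lt_top), ← integral_div]
  congr 1
  ext x
  rw [ENNReal.toReal_ofReal (by positivity), Complex.real_smul]
  push_cast
  ring

theorem isProbabilityMeasure_berezinMeasure {n : ℕ} {h : ℝ} {z : Cn n} (hm : 0 < kernelMass h z) :
    IsProbabilityMeasure (berezinMeasure h z) := by
  have hK := continuous_kernelFun (n := n) h (-1) z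
  refine ⟨?_⟩
  rw [berezinMeasure, withDensity_apply _ MeasurableSet.univ, Measure.restrict_univ,
    ← ofReal_integral_eq_lintegral_ofReal, integral_div]
  · change ENNReal.ofReal (kernelMass h z / kernelMass h z) = 1
    rw [div_self hm.ne', ENNReal.ofReal_one]
  · exact (BoundedContinuousFunction.mkOfCompact ⟨fun x : Sph n =>
      ‖kernelFun h (-1) (x : Cn n) z‖ ^ 2 / kernelMass h z, by fun_prop⟩).integrable (sigma n)
  · exact ae_of_all _ fun x => by positivity

theorem berezin_eq_integral {n : ℕ} [NeZero n] (h : ℝ) (φ : SmoothFun n) (z : Cn n) :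
    berezin h (-1) φ z = ∫ x, φ x ∂(berezinMeasure h z) := by
  rw [berezin_eq, integral_berezinMeasure, integral_complex_ofReal]
  rfl

/-- Isometries that fix `x · ζ`, or conjugate it, preserve the measure. -/
theorem integral_berezinMeasure_comp {n : ℕ} {h : ℝ} {z : Cn n} (hz : z ≠ 0)
    (T : Cn n ≃ₗᵢ[ℝ] Cn n)
    (hT : (∀ x, inner ℂ (direction z hz : Cn n) (T x) = inner ℂ (direction z hz : Cn n) x) ∨
      ∀ x, inner ℂ (direction z hz : Cn n) (T x) =
        (starRingEnd ℂ) (inner ℂ (direction z hz : Cn n) x))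
    (f : Sph n → ℂ) :
    ∫ x, f (sphereMap T x) ∂(berezinMeasure h z) = ∫ x, f x ∂(berezinMeasure h z) := by
  -- The kernel is a power series in `x · ζ` with real coefficients, so conjugating `x · ζ`
  -- conjugates the kernel and keeps its modulus.
  have hK : ∀ x : Sph n, ‖kernelFun h (-1) (sphereMap T x : Cn n) z‖ =
      ‖kernelFun h (-1) (x : Cn n) z‖ := by
    intro x
    have h1 := hasSum_kernelFun h z hz (sphereMap T x)
    have h2 := hasSum_kernelFun h z hz x
    rcases hT with hT | hT
    · simp only [coe_sphereMap, hT] at h1 ⊢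
      rw [h1.unique h2]
    · have h3 := h2.map (starRingEnd ℂ) Complex.continuous_conj
      have h4 := h1.unique (h3.congr_fun fun l => by
        simp only [coe_sphereMap, hT, Function.comp, map_mul, map_pow, Complex.conj_ofReal])
      rw [h4, RCLike.norm_conj]
  rw [integral_berezinMeasure, integral_berezinMeasure, ← integral_sphereMap T
    (fun x => f x * ((‖kernelFun h (-1) (x : Cn n) z‖ ^ 2 : ℝ) : ℂ))]
  simp only [hK]

theorem integrable_berezinMeasure {n : ℕ} {E : Type*} [NormedAddCommGroup E] {h : ℝ} {z : Cn n}
    (hm : 0 < kernelMass h z) {f : Sph n → E} (hf : Continuous f) :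
    Integrable f (berezinMeasure h z) := by
  have := isProbabilityMeasure_berezinMeasure hm
  exact hf.integrable_of_hasCompactSupport (HasCompactSupport.of_compactSpace f)

section Moments

variable {m : ℕ} {h : ℝ} {z : Cn (m + 2)}

theorem kernelMass_eq (hh : 0 < h) (hz : z ≠ 0) :
    kernelMass h z = ∑' l, besselTerm m (‖z‖ / h) l := by
  have h1 := hasSum_moment hh hz 0 0
  simp only [add_zero, zero_add, pow_zero, mul_one, one_mul, besselTerm_eq] at h1
  rw [integral_complex_ofReal, Complex.hasSum_ofReal] at h1
  exact h1.tsum_eq.symm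

theorem kernelMass_pos (hh : 0 < h) (hz : z ≠ 0) : 0 < kernelMass h z := by
  rw [kernelMass_eq hh hz]
  exact (isBesselWeight_normalized m _).1

theorem integral_moment_eq (hh : 0 < h) (hz : z ≠ 0) {b d : ℕ} {g : ℕ → ℝ}
    (hg : ∀ l, kernelCoeff (m + 2) (‖z‖ / h) l * kernelCoeff (m + 2) (‖z‖ / h) (l + d) *
        sphereMoment (m + 2) (b + (l + d)) = besselTerm m (‖z‖ / h) l * g l) :
    ∫ x : Sph (m + 2), inner ℂ (direction z hz : Cn (m + 2)) (x : Cn (m + 2)) ^ (b + d) *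
        (starRingEnd ℂ) (inner ℂ (direction z hz : Cn (m + 2)) (x : Cn (m + 2))) ^ b
        ∂(berezinMeasure h z) =
      ((∑' l, besselTerm m (‖z‖ / h) l / (∑' l, besselTerm m (‖z‖ / h) l) * g l : ℝ) : ℂ) := by
  have h1 := hasSum_moment hh hz b d
  simp only [hg] at h1
  rw [integral_berezinMeasure, kernelMass_eq hh hz, ← h1.tsum_eq, ← Complex.ofReal_tsum,
    ← Complex.ofReal_div, ← tsum_div_const]
  congr 1
  refine tsum_congr fun l => ?_
  ring

/-- First order asymptotics of the moments of `x · ζ`. -/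
theorem moment_asymptotics (m : ℕ) : ∃ C : ℝ, ∀ (h : ℝ) (z : Cn (m + 2)) (hz : z ≠ 0), 0 < h →
    1 ≤ ‖z‖ / h →
    |∫ x : Sph (m + 2), ((inner ℂ (direction z hz : Cn (m + 2)) (x : Cn (m + 2))).re - 1)
      ∂(berezinMeasure h z) + (2 * m + 3) / (4 * (‖z‖ / h))| ≤ C / (‖z‖ / h) ^ 2 ∧
    |∫ x : Sph (m + 2), (inner ℂ (direction z hz : Cn (m + 2)) (x : Cn (m + 2))).im ^ 2
      ∂(berezinMeasure h z) - 1 / (2 * (‖z‖ / h))| ≤ C / (‖z‖ / h) ^ 2 ∧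
    |∫ x : Sph (m + 2), ((inner ℂ (direction z hz : Cn (m + 2)) (x : Cn (m + 2))).re - 1) ^ 2
      ∂(berezinMeasure h z)| ≤ C / (‖z‖ / h) ^ 2 ∧
    |∫ x : Sph (m + 2), (1 - ‖inner ℂ (direction z hz : Cn (m + 2)) (x : Cn (m + 2))‖ ^ 2)
      ∂(berezinMeasure h z) - (m + 1) / (‖z‖ / h)| ≤ C / (‖z‖ / h) ^ 2 := by
  obtain ⟨C₀, h₀⟩ := IsBesselWeight.expansion_inv m
  obtain ⟨C₁, h₁⟩ := IsBesselWeight.expansion_inv_sqrt m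
  obtain ⟨C₂, h₂⟩ := IsBesselWeight.expansion_inv_mul_sqrt m
  refine ⟨(m + 1) * |C₀| + 2 * |C₁| + |C₂|, fun h z hz hh hρ => ?_⟩
  have hm := kernelMass_pos hh hz
  have hprob := isProbabilityMeasure_berezinMeasure hm
  set ρ := ‖z‖ / h with hρdef
  obtain ⟨hpos, hp⟩ := isBesselWeight_normalized m ρ
  have k₀ := h₀ ρ _ hp hρ
  have k₁ := h₁ ρ _ hp hρ
  have k₂ := h₂ ρ _ hp hρ
  have hs₀ : Summable fun l : ℕ => besselTerm m ρ l / (∑' l, besselTerm m ρ l) *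
      ((l : ℝ) + m + 2)⁻¹ := hp.summable_mul_of_bdd (C := 1) fun l => by
    simpa using IsBesselWeight.inv_abs_le_one (A := (l : ℝ) + m + 2)
      (by have : (0 : ℝ) ≤ l := Nat.cast_nonneg l
          have : (0 : ℝ) ≤ m := Nat.cast_nonneg m
          linarith) 1
  have i₁ := integral_moment_eq hh hz (b := 0) (d := 1) (g := fun l => ρ *
    (√(((l : ℝ) + m + 1) * (l + m + 2)))⁻¹) (fun l => by rw [moment_one_eq]; ring)
  have i₂ := integral_moment_eq hh hz (b := 0) (d := 2) (g := fun l => ρ ^ 2 *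
    (((l : ℝ) + m + 2) * √(((l : ℝ) + m + 1) * (l + m + 3)))⁻¹)
    (fun l => by rw [moment_two_eq]; ring)
  have i₀ := integral_moment_eq hh hz (b := 1) (d := 0) (g := fun l => 1 - (m + 1) *
    ((l : ℝ) + m + 2)⁻¹) (fun l => by rw [moment_norm_eq]; ring)
  simp only [← hρdef, mul_left_comm _ ρ, mul_left_comm _ (ρ ^ 2), tsum_mul_left, mul_sub, mul_one,
    mul_left_comm _ ((m : ℝ) + 1)] at i₀ i₁ i₂
  rw [hp.hasSum.summable.tsum_sub (hs₀.mul_left _), tsum_mul_left, hp.hasSum.tsum_eq] at i₀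
  set S₀ := ∑' l : ℕ, besselTerm m ρ l / (∑' l, besselTerm m ρ l) * ((l : ℝ) + m + 2)⁻¹
  set S₁ := ∑' l : ℕ, besselTerm m ρ l / (∑' l, besselTerm m ρ l) *
    (√(((l : ℝ) + m + 1) * (l + m + 2)))⁻¹
  set S₂ := ∑' l : ℕ, besselTerm m ρ l / (∑' l, besselTerm m ρ l) *
    (((l : ℝ) + m + 2) * √(((l : ℝ) + m + 1) * (l + m + 3)))⁻¹
  set ζ : Cn (m + 2) := ((direction z hz : Sph (m + 2)) : Cn (m + 2))
  set ν := berezinMeasure h z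
  simp only [zero_add, pow_one, pow_zero, mul_one, add_zero] at i₀ i₁ i₂
  have hintegral : ∀ {f : Sph (m + 2) → ℝ}, Continuous f → Integrable f ν :=
    fun hf => integrable_berezinMeasure hm hf
  have hX : Continuous fun x : Sph (m + 2) => inner ℂ ζ (x : Cn (m + 2)) := by fun_prop
  have hre : Continuous fun x : Sph (m + 2) => (inner ℂ ζ (x : Cn (m + 2))).re := by fun_prop
  have him : Continuous fun x : Sph (m + 2) => (inner ℂ ζ (x : Cn (m + 2))).im := by fun_prop
  have hX2 : Continuous fun x : Sph (m + 2) => inner ℂ ζ (x : Cn (m + 2)) ^ 2 := by fun_prop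
  have hre2 : Continuous fun x : Sph (m + 2) => (inner ℂ ζ (x : Cn (m + 2))).re ^ 2 := by fun_prop
  have him2 : Continuous fun x : Sph (m + 2) => (inner ℂ ζ (x : Cn (m + 2))).im ^ 2 := by fun_prop
  have j₁ : ∫ x : Sph (m + 2), (inner ℂ ζ (x : Cn (m + 2))).re ∂ν = ρ * S₁ := by
    have := integral_re (integrable_berezinMeasure hm hX)
    simp only [RCLike.re_to_complex] at this
    rw [this, i₁, Complex.ofReal_re]
  have j₂ : ∫ x : Sph (m + 2), (inner ℂ ζ (x : Cn (m + 2))).re ^ 2 ∂ν -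
      ∫ x : Sph (m + 2), (inner ℂ ζ (x : Cn (m + 2))).im ^ 2 ∂ν = ρ ^ 2 * S₂ := by
    have := integral_re (integrable_berezinMeasure hm hX2)
    simp only [RCLike.re_to_complex] at this
    rw [i₂, Complex.ofReal_re] at this
    rw [← this, ← integral_sub (hintegral hre2)
      (hintegral him2)]
    congr 1
    ext x
    rw [sq (inner ℂ ζ (x : Cn (m + 2))), Complex.mul_re]
    ring
  have j₀ : ∫ x : Sph (m + 2), (inner ℂ ζ (x : Cn (m + 2))).re ^ 2 ∂ν +
      ∫ x : Sph (m + 2), (inner ℂ ζ (x : Cn (m + 2))).im ^ 2 ∂ν = 1 - (m + 1) * S₀ := by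
    rw [← Complex.ofReal_inj, ← i₀, ← integral_add (hintegral hre2)
      (hintegral him2), ← integral_complex_ofReal]
    congr 1
    ext x
    rw [Complex.mul_conj, Complex.normSq_apply]
    push_cast
    ring
  have j₃ : ∫ x : Sph (m + 2), ((inner ℂ ζ (x : Cn (m + 2))).re - 1) ∂ν =
      ∫ x : Sph (m + 2), (inner ℂ ζ (x : Cn (m + 2))).re ∂ν - 1 := by
    rw [integral_sub (hintegral hre) (integrable_const _)]
    simp
  have j₄ : ∫ x : Sph (m + 2), ((inner ℂ ζ (x : Cn (m + 2))).re - 1) ^ 2 ∂ν =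
      ∫ x : Sph (m + 2), (inner ℂ ζ (x : Cn (m + 2))).re ^ 2 ∂ν -
        2 * ∫ x : Sph (m + 2), (inner ℂ ζ (x : Cn (m + 2))).re ∂ν + 1 := by
    have e : ∀ x : Sph (m + 2), ((inner ℂ ζ (x : Cn (m + 2))).re - 1) ^ 2 =
      (inner ℂ ζ (x : Cn (m + 2))).re ^ 2 - 2 * (inner ℂ ζ (x : Cn (m + 2))).re + 1 :=
      fun x => by ring
    simp only [e]
    rw [integral_add (hintegral (by fun_prop)) (integrable_const _),
      integral_sub (hintegral (by fun_prop))
      (hintegral (by fun_prop)), integral_const_mul]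
    simp
  have j₅ : ∫ x : Sph (m + 2), (1 - ‖inner ℂ ζ (x : Cn (m + 2))‖ ^ 2) ∂ν =
      1 - (∫ x : Sph (m + 2), (inner ℂ ζ (x : Cn (m + 2))).re ^ 2 ∂ν +
      ∫ x : Sph (m + 2), (inner ℂ ζ (x : Cn (m + 2))).im ^ 2 ∂ν) := by
    rw [← integral_add (hintegral hre2)
      (hintegral him2), integral_sub (integrable_const _)
      (hintegral (by fun_prop))]
    congr 1
    · simp
    · congr 1
      ext x
      rw [← Complex.normSq_eq_norm_sq, Complex.normSq_apply]
      ring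
  have hρ0 : 0 < ρ := by linarith
  have c₀ : |(m + 1) * (S₀ - 1 / ρ)| ≤ (m + 1) * |C₀| / ρ ^ 2 := by
    rw [abs_mul, abs_of_pos (by positivity : (0 : ℝ) < m + 1), mul_div_assoc]
    refine mul_le_mul_of_nonneg_left (k₀.trans ?_) (by positivity)
    gcongr
    exact le_abs_self _
  have c₁ : |ρ * S₁ - (1 - (2 * m + 3) / (4 * ρ))| ≤ |C₁| / ρ ^ 2 :=
    k₁.trans (by gcongr; exact le_abs_self _)
  have c₂ : |ρ ^ 2 * S₂ - (1 - (m + 2) / ρ)| ≤ |C₂| / ρ ^ 2 :=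
    k₂.trans (by gcongr; exact le_abs_self _)
  -- All four quantities are now linear in `ρ S₁` and in `A ± B`, the means of `|X|²` and `Re X²`.
  -- In `A - 2ρS₁ + 1` the orders `1` and `1/ρ` both cancel, which makes the mean of `(Re X - 1)²`
  -- of order `ρ⁻²`.
  rw [j₅, j₄, j₃, j₀, j₁]
  set A := ∫ x : Sph (m + 2), (inner ℂ ζ (x : Cn (m + 2))).re ^ 2 ∂ν
  set B := ∫ x : Sph (m + 2), (inner ℂ ζ (x : Cn (m + 2))).im ^ 2 ∂ν
  have n₀ : 0 ≤ (m + 1) * |C₀| / ρ ^ 2 := by positivity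
  have n₁ : 0 ≤ |C₁| / ρ ^ 2 := by positivity
  have n₂ : 0 ≤ |C₂| / ρ ^ 2 := by positivity
  have hsplit : ((m + 1) * |C₀| + 2 * |C₁| + |C₂|) / ρ ^ 2 =
      (m + 1) * |C₀| / ρ ^ 2 + 2 * (|C₁| / ρ ^ 2) + |C₂| / ρ ^ 2 := by ring
  have r1 : (2 * (m : ℝ) + 3) / (4 * ρ) = (2 * m + 3) / 4 * (1 / ρ) := by field_simp
  have r2 : 1 / (2 * ρ) = 1 / 2 * (1 / ρ) := by field_simp
  have r3 : ((m : ℝ) + 1) / ρ = (m + 1) * (1 / ρ) := by field_simp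
  have r4 : ((m : ℝ) + 2) / ρ = (m + 2) * (1 / ρ) := by field_simp
  rw [r1] at c₁ ⊢
  rw [r4] at c₂
  rw [r2, r3, hsplit]
  generalize 1 / ρ = t at *
  rw [abs_le] at c₀ c₁ c₂
  refine ⟨?_, ?_, ?_, ?_⟩ <;> rw [abs_le] <;> constructor <;> linarith

end Moments

/-! ### Second moments of the displacement from `z / |z|` -/

theorem real_inner_eq_re {n : ℕ} (x y : Cn n) : inner ℝ x y = (inner ℂ x y).re := by
  simp [PiLp.inner_apply]

theorem real_inner_I_smul {n : ℕ} (x y : Cn n) : inner ℝ (Complex.I • x) y = (inner ℂ x y).im := by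
  rw [real_inner_eq_re, inner_smul_left]
  simp

theorem inner_eq_add_I {n : ℕ} (x y : Cn n) :
    inner ℂ x y = (inner ℝ x y : ℝ) + (inner ℝ (Complex.I • x) y : ℝ) * Complex.I := by
  rw [real_inner_eq_re, real_inner_I_smul, Complex.re_add_im]

theorem reflection_orthogonal_singleton {n : ℕ} (a x : Cn n) :
    (ℝ ∙ a)ᗮ.reflection x = x - (2 * (inner ℝ a x / ‖a‖ ^ 2)) • a := by
  rw [Submodule.reflection_orthogonal_apply, Submodule.reflection_singleton_apply]
  simp
  module

section Symmetry

variable {n : ℕ} {h : ℝ} {z : Cn n} (hz : z ≠ 0)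

theorem integral_real_comp (T : Cn n ≃ₗᵢ[ℝ] Cn n)
    (hT : (∀ x, inner ℂ (direction z hz : Cn n) (T x) = inner ℂ (direction z hz : Cn n) x) ∨
      ∀ x, inner ℂ (direction z hz : Cn n) (T x) =
        (starRingEnd ℂ) (inner ℂ (direction z hz : Cn n) x))
    (f : Sph n → ℝ) :
    ∫ x, f (sphereMap T x) ∂(berezinMeasure h z) = ∫ x, f x ∂(berezinMeasure h z) := by
  have := integral_berezinMeasure_comp (h := h) hz T hT fun x => (f x : ℂ)
  rwa [integral_complex_ofReal, integral_complex_ofReal, Complex.ofReal_inj] at this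

theorem inner_reflection_of_orthogonal {a : Cn n}
    (ha : inner ℂ (direction z hz : Cn n) a = 0) (x : Cn n) :
    inner ℂ (direction z hz : Cn n) ((ℝ ∙ a)ᗮ.reflection x) =
      inner ℂ (direction z hz : Cn n) x := by
  rw [reflection_orthogonal_singleton, inner_sub_right, inner_smul_right_eq_smul, ha]
  simp

theorem inner_reflection_I_smul (x : Cn n) :
    inner ℂ (direction z hz : Cn n)
      ((ℝ ∙ (Complex.I • (direction z hz : Cn n)))ᗮ.reflection x) =
      (starRingEnd ℂ) (inner ℂ (direction z hz : Cn n) x) := by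
  have h1 : inner ℂ (direction z hz : Cn n) (direction z hz : Cn n) = 1 := by
    rw [inner_self_eq_norm_sq_to_K, direction_norm]; simp
  rw [reflection_orthogonal_singleton, inner_sub_right, inner_smul_right_eq_smul,
    inner_smul_right, h1, real_inner_I_smul, norm_smul, direction_norm]
  generalize inner ℂ (direction z hz : Cn n) x = w
  apply Complex.ext <;> simp
  ring

theorem inner_reflection_direction (x : Cn n) :
    inner ℂ (direction z hz : Cn n) ((ℝ ∙ (direction z hz : Cn n)).reflection x) =
      (starRingEnd ℂ) (inner ℂ (direction z hz : Cn n) x) := by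
  have h1 : inner ℂ (direction z hz : Cn n) (direction z hz : Cn n) = 1 := by
    rw [inner_self_eq_norm_sq_to_K, direction_norm]; simp
  rw [Submodule.reflection_singleton_apply, inner_sub_right, direction_norm,
    inner_smul_right_eq_smul, real_inner_eq_re, ← Nat.cast_smul_eq_nsmul ℝ, inner_smul_right_eq_smul, h1]
  generalize inner ℂ (direction z hz : Cn n) x = w
  apply Complex.ext <;> simp
  ring

end Symmetry

/-! ### Real coordinates adapted to the direction of `z` -/

/-- A real orthonormal basis of `ℂⁿ` that contains `ζ` and `i ζ`. -/
structure AdaptedBasis {n : ℕ} (ζ : Cn n) (ι : Type) [Fintype ι] where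
  basis : OrthonormalBasis ι ℝ (Cn n)
  i₀ : ι
  i₁ : ι
  basis_i₀ : basis i₀ = ζ
  basis_i₁ : basis i₁ = Complex.I • ζ

theorem AdaptedBasis.exists {n : ℕ} {ζ : Cn n} (hζ : ‖ζ‖ = 1) :
    ∃ (N : ℕ), Nonempty (AdaptedBasis ζ (Fin N)) := by
  have h1 : inner ℂ ζ ζ = 1 := by
    rw [inner_self_eq_norm_sq_to_K, hζ]; simp
  have hne : ζ ≠ Complex.I • ζ := by
    intro h
    have := congrArg (inner ℂ ζ) h
    rw [inner_smul_right, h1] at this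
    have := congrArg Complex.re this
    simp at this
  have ho : Orthonormal ℝ ((↑) : ({ζ, Complex.I • ζ} : Set (Cn n)) → Cn n) := by
    rw [orthonormal_subtype_iff_ite]
    have h2 : inner ℝ (Complex.I • ζ) ζ = 0 := by rw [real_inner_I_smul, h1]; simp
    have h2' : inner ℝ ζ (Complex.I • ζ) = 0 := by rw [real_inner_comm, h2]
    rintro v (rfl | rfl) w (rfl | rfl)
    · simp [hζ]
    · rw [if_neg hne, h2']
    · rw [if_neg hne.symm, h2]
    · simp [hζ, norm_smul]
  obtain ⟨u, b, hu, hb⟩ := ho.exists_orthonormalBasis_extension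
  have e := Fintype.equivFin u
  refine ⟨_, ⟨⟨b.reindex e, e ⟨ζ, hu (by simp)⟩, e ⟨Complex.I • ζ, hu (by simp)⟩, ?_, ?_⟩⟩⟩ <;>
  simp [hb]

namespace AdaptedBasis

variable {n : ℕ} {h : ℝ} {z : Cn n} {hz : z ≠ 0} {ι : Type} [Fintype ι]
  (b : AdaptedBasis (direction z hz : Cn n) ι)

/-- The coordinates of `x - z / |z|`. -/
def coord (i : ι) (x : Sph n) : ℝ := inner ℝ (b.basis i) ((x : Cn n) - (direction z hz : Cn n))

theorem continuous_coord (i : ι) : Continuous (b.coord i) := by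
  unfold coord
  fun_prop

theorem sum_coord_smul (x : Sph n) :
    ∑ i, b.coord i x • b.basis i = (x : Cn n) - (direction z hz : Cn n) :=
  b.basis.sum_repr' _

theorem inner_basis [DecidableEq ι] (i j : ι) :
    inner ℝ (b.basis i) (b.basis j) = if i = j then 1 else 0 :=
  orthonormal_iff_ite.1 b.basis.orthonormal i j

theorem i₀_ne_i₁ : b.i₀ ≠ b.i₁ := by
  classical
  intro he
  have h1 := b.inner_basis b.i₀ b.i₁
  rw [if_pos he, b.basis_i₀, b.basis_i₁, real_inner_comm, real_inner_I_smul,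
    inner_self_eq_norm_sq_to_K, direction_norm] at h1
  simp at h1

theorem coord_of_ne {i : ι} (hi : i ≠ b.i₀) (x : Sph n) :
    b.coord i x = inner ℝ (b.basis i) (x : Cn n) := by
  classical
  have := b.inner_basis i b.i₀
  rw [b.basis_i₀, if_neg hi] at this
  rw [coord, inner_sub_right, this, sub_zero]

theorem coord_i₀ (x : Sph n) :
    b.coord b.i₀ x = (inner ℂ (direction z hz : Cn n) (x : Cn n)).re - 1 := by
  rw [coord, b.basis_i₀, inner_sub_right, real_inner_eq_re, real_inner_self_eq_norm_sq,
    direction_norm]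
  simp

theorem coord_i₁ (x : Sph n) :
    b.coord b.i₁ x = (inner ℂ (direction z hz : Cn n) (x : Cn n)).im := by
  rw [b.coord_of_ne b.i₀_ne_i₁.symm, b.basis_i₁, real_inner_I_smul]

theorem inner_basis_of_ne {i : ι} (h0 : i ≠ b.i₀) (h1 : i ≠ b.i₁) :
    inner ℂ (direction z hz : Cn n) (b.basis i) = 0 := by
  classical
  have h2 := b.inner_basis b.i₀ i
  have h3 := b.inner_basis b.i₁ i
  rw [if_neg h0.symm, b.basis_i₀] at h2
  rw [if_neg h1.symm, b.basis_i₁] at h3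
  rw [inner_eq_add_I, h2, h3]
  simp

/-- Reflection in the hyperplane orthogonal to the `j`-th basis vector negates the `j`-th coordinate
only. It conjugates `x · ζ` if `j = i₁` and fixes it otherwise. For `j = i₀` it would change `Re (x
· ζ)`. -/
theorem integral_coord_mul_coord {i j : ι} (hij : i ≠ j) (hj : j ≠ b.i₀) :
    ∫ x, b.coord i x * b.coord j x ∂(berezinMeasure h z) = 0 := by
  classical
  have key := integral_real_comp (h := h) hz ((ℝ ∙ (b.basis j))ᗮ.reflection) (by
    by_cases h1 : j = b.i₁
    · right
      rw [h1, b.basis_i₁]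
      exact inner_reflection_I_smul hz
    · left
      exact inner_reflection_of_orthogonal hz (b.inner_basis_of_ne hj h1))
    (fun x => b.coord i x * b.coord j x)
  have hc : ∀ k (x : Sph n), b.coord k (sphereMap ((ℝ ∙ (b.basis j))ᗮ.reflection) x) =
      b.coord k x - if k = j then 2 * b.coord j x else 0 := by
    intro k x
    rw [coord, coe_sphereMap, reflection_orthogonal_singleton, sub_right_comm, inner_sub_right,
      inner_smul_right, b.inner_basis, b.basis.norm_eq_one, ← coord, b.coord_of_ne hj]
    split_ifs <;> simp
  simp only [hc, if_neg hij, if_true] at key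
  have h2 : (fun x => (b.coord i x - 0) * (b.coord j x - 2 * b.coord j x)) =
      fun x => -(b.coord i x * b.coord j x) := by
    ext x; ring
  rw [h2, integral_neg] at key
  linarith

/-- The reflection exchanging the two basis vectors fixes `x · ζ`. -/
theorem integral_coord_sq_eq {i j : ι} (hi0 : i ≠ b.i₀) (hi1 : i ≠ b.i₁) (hj0 : j ≠ b.i₀)
    (hj1 : j ≠ b.i₁) :
    ∫ x, b.coord i x ^ 2 ∂(berezinMeasure h z) = ∫ x, b.coord j x ^ 2 ∂(berezinMeasure h z) := by
  classical
  rcases eq_or_ne i j with rfl | hij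
  · rfl
  have key := integral_real_comp (h := h) hz ((ℝ ∙ (b.basis i - b.basis j))ᗮ.reflection) (by
    left
    refine inner_reflection_of_orthogonal hz ?_
    rw [inner_sub_right, b.inner_basis_of_ne hi0 hi1, b.inner_basis_of_ne hj0 hj1, sub_zero])
    (fun x => b.coord j x ^ 2)
  rw [← key]
  congr 1
  ext x
  have hn : ‖b.basis i - b.basis j‖ ^ 2 = 2 := by
    rw [norm_sub_sq_real, b.inner_basis, if_neg hij]
    simp
    norm_num
  congr 1
  rw [b.coord_of_ne hi0, b.coord_of_ne hj0, coe_sphereMap, reflection_orthogonal_singleton,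
    inner_sub_right, inner_smul_right, hn, inner_sub_right (b.basis j), b.inner_basis,
    b.inner_basis, if_neg hij.symm, if_pos rfl, inner_sub_left]
  ring

theorem sum_coord_sq (x : Sph n) :
    ∑ i, b.coord i x ^ 2 = -2 * b.coord b.i₀ x := by
  have h1 := b.basis.sum_sq_norm_inner_right ((x : Cn n) - (direction z hz : Cn n))
  simp only [Real.norm_eq_abs, sq_abs] at h1
  have hx : ‖(x : Cn n)‖ = 1 := by simp
  rw [b.coord_i₀, ← real_inner_eq_re]
  change ∑ i, (inner ℝ (b.basis i) ((x : Cn n) - (direction z hz : Cn n))) ^ 2 = _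
  rw [h1, norm_sub_sq_real, direction_norm, hx, real_inner_comm]
  ring

/-- On the sphere `1 - |X|²` is the sum of the squares of the `2n - 2` coordinates other than `i₀`
and `i₁`, and these have equal means. -/
theorem integral_coord_sq [NeZero n] (hm : 0 < kernelMass h z) {i : ι} (h0 : i ≠ b.i₀) (h1 : i ≠ b.i₁) :
    (2 * n - 2) * ∫ x, b.coord i x ^ 2 ∂(berezinMeasure h z) =
      ∫ x : Sph n, (1 - ‖inner ℂ (direction z hz : Cn n) (x : Cn n)‖ ^ 2)
        ∂(berezinMeasure h z) := by
  classical
  have hcard : Fintype.card ι = 2 * n := by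
    rw [← Module.finrank_eq_card_basis b.basis.toBasis,
      ← Module.finrank_mul_finrank ℝ ℂ (Cn n), Complex.finrank_real_complex,
      finrank_euclideanSpace_fin]
  have hs : ∀ x : Sph n, (1 - ‖inner ℂ (direction z hz : Cn n) (x : Cn n)‖ ^ 2) =
      ∑ j ∈ (Finset.univ.erase b.i₀).erase b.i₁, b.coord j x ^ 2 := by
    intro x
    have h2 := b.sum_coord_sq x
    rw [← Finset.add_sum_erase _ _ (Finset.mem_univ b.i₀),
      ← Finset.add_sum_erase _ _ (Finset.mem_erase.2 ⟨b.i₀_ne_i₁.symm, Finset.mem_univ b.i₁⟩),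
      b.coord_i₀, b.coord_i₁] at h2
    rw [← Complex.normSq_eq_norm_sq, Complex.normSq_apply]
    linarith
  simp only [hs]
  rw [integral_finsetSum _ fun j _ =>
    integrable_berezinMeasure (f := fun x => b.coord j x ^ 2) hm ((b.continuous_coord j).pow 2),
    Finset.sum_congr rfl fun j hj => ?_, Finset.sum_const, nsmul_eq_mul]
  · congr 1
    rw [Finset.card_erase_of_mem (Finset.mem_erase.2 ⟨b.i₀_ne_i₁.symm, Finset.mem_univ b.i₁⟩),
      Finset.card_erase_of_mem (Finset.mem_univ b.i₀), Finset.card_univ, hcard]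
    have := NeZero.pos n
    rw [Nat.sub_sub, Nat.cast_sub (by omega)]
    push_cast
    ring
  · simp only [Finset.mem_erase] at hj
    exact b.integral_coord_sq_eq hj.2.1 hj.1 h0 h1

theorem integral_bilin (hm : 0 < kernelMass h z) (B : Cn n →L[ℝ] Cn n →L[ℝ] ℂ) :
    ∫ x : Sph n, B ((x : Cn n) - (direction z hz : Cn n)) ((x : Cn n) - (direction z hz : Cn n))
        ∂(berezinMeasure h z) =
      ∑ i, ((∫ x, b.coord i x ^ 2 ∂(berezinMeasure h z) : ℝ) : ℂ) * B (b.basis i) (b.basis i) := by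
  classical
  have he : ∀ x : Sph n, B ((x : Cn n) - (direction z hz : Cn n))
      ((x : Cn n) - (direction z hz : Cn n)) =
      ∑ i, ∑ j, ((b.coord i x * b.coord j x : ℝ) : ℂ) * B (b.basis i) (b.basis j) := by
    intro x
    conv_lhs => rw [← b.sum_coord_smul x]
    simp only [map_sum, map_smul, _root_.sum_apply, _root_.smul_apply,
      Complex.real_smul, Finset.mul_sum]
    refine (Finset.sum_comm).trans ?_
    refine Finset.sum_congr rfl fun i _ => Finset.sum_congr rfl fun j _ => ?_
    push_cast
    ring
  have hc : ∀ i j, Continuous fun x => ((b.coord i x * b.coord j x : ℝ) : ℂ) * B (b.basis i) (b.basis j) :=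
    fun i j => (Complex.continuous_ofReal.comp
      ((b.continuous_coord i).mul (b.continuous_coord j))).mul continuous_const
  simp only [he]
  rw [integral_finsetSum _ fun i _ => integrable_berezinMeasure hm
    (continuous_finsetSum _ fun j _ => hc i j)]
  refine Finset.sum_congr rfl fun i _ => ?_
  rw [integral_finsetSum _ fun j _ => integrable_berezinMeasure hm (hc i j)]
  rw [Finset.sum_eq_single i]
  · rw [integral_mul_const, integral_complex_ofReal]
    simp only [sq]
  · intro j _ hj
    rw [integral_mul_const, integral_complex_ofReal]
    -- At most one of the two distinct indices is `i₀`; the other one supplies the reflection.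
    have : ∫ x, b.coord i x * b.coord j x ∂(berezinMeasure h z) = 0 := by
      by_cases h0 : j = b.i₀
      · simp only [mul_comm (b.coord i _)]
        exact b.integral_coord_mul_coord hj (by rw [← h0]; exact hj.symm)
      · exact b.integral_coord_mul_coord hj.symm h0
    rw [this]
    simp
  · simp

end AdaptedBasis

/-! ### Taylor expansion and the differential operators -/

/-- Near `ζ` this is Taylor's formula with integral remainder, on a ball where the top derivative is
bounded. Off that ball `‖x - ζ‖ ≥ r`, and continuity on the compact set `K` suffices, so no
smoothness is needed along the segment from `ζ` to `x`. -/
theorem exists_taylor_bound {E G : Type*} [NormedAddCommGroup E] [NormedSpace ℝ E]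
    [NormedAddCommGroup G] [NormedSpace ℝ G] [CompleteSpace G] {F : E → G} {ζ : E} {K : Set E}
    (hK : IsCompact K) (hF : ContinuousOn F K) {n : ℕ} (hd : ContDiffAt ℝ (n + 1 : ℕ) F ζ) :
    ∃ C : ℝ, ∀ x ∈ K, ‖F x - ∑ k ∈ Finset.range (n + 1), (k.factorial : ℝ)⁻¹ •
      iteratedFDeriv ℝ k F ζ fun _ => x - ζ‖ ≤ C * ‖x - ζ‖ ^ (n + 1) := by
  have h1 : ∀ᶠ y in 𝓝 ζ, ContDiffAt ℝ (n + 1 : ℕ) F y := hd.eventually (by simp)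
  have h2 : ContinuousAt (iteratedFDeriv ℝ (n + 1) F) ζ :=
    (hd.iteratedFDeriv_right (m := 0) (by simp)).continuousAt
  have h3 := h2.norm.eventually_lt continuousAt_const
    (lt_add_one ‖iteratedFDeriv ℝ (n + 1) F ζ‖)
  set M := ‖iteratedFDeriv ℝ (n + 1) F ζ‖ + 1
  obtain ⟨r, hr, hball⟩ := Metric.eventually_nhds_iff_ball.1 (h1.and h3)
  have hc : ContinuousOn (fun x => ‖F x - ∑ k ∈ Finset.range (n + 1), (k.factorial : ℝ)⁻¹ •
      iteratedFDeriv ℝ k F ζ fun _ => x - ζ‖) K := by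
    refine (hF.sub (Continuous.continuousOn ?_)).norm
    refine continuous_finsetSum _ fun k _ => Continuous.const_smul ?_ _
    exact (iteratedFDeriv ℝ k F ζ).cont.comp (continuous_pi fun _ => continuous_id.sub continuous_const)
  obtain ⟨M', hM'⟩ := hK.bddAbove_image hc
  have hM0 : 0 ≤ M := by positivity
  refine ⟨M + |M'| / r ^ (n + 1), fun x hx => ?_⟩
  rw [add_mul]
  by_cases hxr : ‖x - ζ‖ < r
  · refine le_trans ?_ (le_add_of_nonneg_right (by positivity))
    have hseg : ∀ t ∈ Icc (0 : ℝ) 1, ζ + t • (x - ζ) ∈ ball ζ r := by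
      intro t ht
      rw [mem_ball_iff_norm, add_sub_cancel_left, norm_smul, Real.norm_of_nonneg ht.1]
      nlinarith [norm_nonneg (x - ζ), ht.2]
    have ht := map_add_eq_sum_add_integral_iteratedFDeriv (f := F) (x := ζ) (y := x - ζ) (n := n)
      fun t ht => by simpa using (hball _ (hseg t ht)).1
    rw [add_sub_cancel] at ht
    rw [ht, add_sub_cancel_left, norm_smul]
    have hi : ‖∫ t in (0 : ℝ)..1, (1 - t) ^ n •
        iteratedFDeriv ℝ (n + 1) F (ζ + t • (x - ζ)) fun _ => x - ζ‖ ≤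
        M * ‖x - ζ‖ ^ (n + 1) * |1 - 0| := by
      refine intervalIntegral.norm_integral_le_of_norm_le_const fun t ht => ?_
      rw [uIoc_of_le zero_le_one] at ht
      have hle := (iteratedFDeriv ℝ (n + 1) F (ζ + t • (x - ζ))).le_opNorm fun _ => x - ζ
      rw [Finset.prod_const, Finset.card_univ, Fintype.card_fin] at hle
      have hb := (hball _ (hseg t ⟨ht.1.le, ht.2⟩)).2
      have hp : ‖(1 - t) ^ n‖ ≤ 1 := by
        rw [norm_pow, Real.norm_of_nonneg (by linarith [ht.2])]
        exact pow_le_one₀ (by linarith [ht.2]) (by linarith [ht.1])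
      rw [norm_smul]
      calc _ ≤ 1 * (M * ‖x - ζ‖ ^ (n + 1)) := by
            refine mul_le_mul hp (hle.trans ?_) (norm_nonneg _) zero_le_one
            exact mul_le_mul_of_nonneg_right hb.le (by positivity)
        _ = _ := one_mul _
    have hf : ‖(n.factorial : ℝ)⁻¹‖ ≤ 1 := by
      rw [norm_inv, RCLike.norm_natCast]
      exact inv_le_one_of_one_le₀ (by exact_mod_cast Nat.one_le_iff_ne_zero.2 n.factorial_ne_zero)
    simp only [sub_zero, abs_one, mul_one] at hi
    calc _ ≤ 1 * (M * ‖x - ζ‖ ^ (n + 1)) := mul_le_mul hf hi (norm_nonneg _) zero_le_one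
      _ = _ := one_mul _
  · refine le_trans ?_ (le_add_of_nonneg_left (by positivity))
    push Not at hxr
    refine (hM' ⟨x, hx, rfl⟩).trans ((le_abs_self _).trans ?_)
    rw [div_mul_eq_mul_div, le_div_iff₀ (by positivity)]
    gcongr

/-! ### The Wirtinger operators in terms of real derivatives -/

theorem sum_re_im_smul_single {n : ℕ} (x : Cn n) :
    ∑ j, ((x j).re • (EuclideanSpace.single j 1 : Cn n) +
      (x j).im • (EuclideanSpace.single j Complex.I : Cn n)) = x := by
  ext i
  simp only [PiLp.add_apply, PiLp.smul_apply, WithLp.ofLp_sum, Finset.sum_apply]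
  rw [Finset.sum_eq_single i]
  · simp [Complex.re_add_im]
  · intro j _ hj
    simp [hj.symm]
  · simp

theorem radial_eq {n : ℕ} (F : Cn n → ℂ) : radial F = fun x => fderiv ℝ F x x := by
  funext x
  have h := congrArg (fderiv ℝ F x) (sum_re_im_smul_single x)
  simp only [map_sum, map_add, map_smul] at h
  rw [radial, ← h]
  refine Finset.sum_congr rfl fun j _ => ?_
  rw [dz, dzbar, Complex.real_smul, Complex.real_smul]
  generalize fderiv ℝ F x (EuclideanSpace.single j 1) = p
  generalize fderiv ℝ F x (EuclideanSpace.single j Complex.I) = q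
  apply Complex.ext <;> simp <;> ring

section Operators

variable {n : ℕ} {F : Cn n → ℂ} {ζ : Cn n}

theorem differentiableAt_fderiv (hF : ContDiffAt ℝ 2 F ζ) : DifferentiableAt ℝ (fderiv ℝ F) ζ :=
  (hF.fderiv_right (m := 1) (by norm_num)).differentiableAt (by simp)

/-- The first order term comes from differentiating the argument in `x ↦ DF(x) x`. -/
theorem radial_radial_eq (hF : ContDiffAt ℝ 2 F ζ) :
    radial (radial F) ζ = fderiv ℝ (fderiv ℝ F) ζ ζ ζ + fderiv ℝ F ζ ζ := by
  have h := (differentiableAt_fderiv hF).hasFDerivAt.clm_apply (hasFDerivAt_id ζ)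
  rw [radial_eq (radial F), radial_eq F]
  have h2 := h.fderiv
  simp only [id] at h2
  simp only [h2]
  simp [add_comm]

/-- In the basis `eⱼ, i eⱼ` the mixed terms of `∂ⱼ∂̄ⱼ` cancel by symmetry of the second derivative;
the trace is the same in every real orthonormal basis. -/
theorem four_mul_laplace_eq (hF : ContDiffAt ℝ 2 F ζ) {ι : Type} [Fintype ι]
    (b : OrthonormalBasis ι ℝ (Cn n)) :
    4 * laplace F ζ = ∑ i, fderiv ℝ (fderiv ℝ F) ζ (b i) (b i) := by
  have hd := (differentiableAt_fderiv hF).hasFDerivAt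
  have hsymm : IsSymmSndFDerivAt ℝ F ζ := hF.isSymmSndFDerivAt (by simp)
  set B := fderiv ℝ (fderiv ℝ F) ζ with hB
  have h1 := InnerProductSpace.laplacian_eq_iteratedFDeriv_orthonormalBasis F b
  rw [InnerProductSpace.laplacian_eq_iteratedFDeriv_orthonormalBasis F
    (Pi.orthonormalBasis fun _ : Fin n => Complex.orthonormalBasisOneI)] at h1
  have h2 := congrFun h1 ζ
  simp only [iteratedFDeriv_two_apply, Matrix.cons_val_zero, Matrix.cons_val_one,
    Fintype.sum_sigma, Fin.sum_univ_two, Pi.orthonormalBasis_apply,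
    Complex.coe_orthonormalBasisOneI, ← hB] at h2
  rw [← h2, laplace, Finset.mul_sum]
  refine Finset.sum_congr rfl fun j _ => ?_
  have hzb : HasFDerivAt (dzbar j F) _ ζ :=
    ((hd.clm_apply (hasFDerivAt_const (EuclideanSpace.single j 1 : Cn n) ζ)).add
      ((hd.clm_apply (hasFDerivAt_const (EuclideanSpace.single j Complex.I : Cn n) ζ)).const_mul
        Complex.I)).const_mul (1 / 2 : ℂ)
  rw [dz, hzb.fderiv]
  have hs := hsymm (EuclideanSpace.single j 1) (EuclideanSpace.single j Complex.I)
  rw [← hB] at hs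
  simp only [_root_.smul_apply, _root_.add_apply,
    ContinuousLinearMap.comp_zero, zero_add, ContinuousLinearMap.flip_apply, smul_eq_mul, hs]
  change _ = B (EuclideanSpace.single j 1) (EuclideanSpace.single j 1) +
    B (EuclideanSpace.single j Complex.I) (EuclideanSpace.single j Complex.I)
  linear_combination (-(B (EuclideanSpace.single j Complex.I)) (EuclideanSpace.single j Complex.I)) *
    Complex.I_mul_I

end Operators

/-- The radial extension `x ↦ φ (x / |x|)` of a smooth function on the sphere. -/
theorem exists_smooth_extension {n : ℕ} [NeZero n] (φ : SmoothFun n) :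
    ∃ F : Cn n → ℂ, IsSmoothExtension φ F := by
  classical
  let U : TopologicalSpace.Opens (Cn n) := ⟨{0}ᶜ, isOpen_compl_singleton⟩
  let F : Cn n → ℂ := fun x => if hx : x ≠ 0 then φ (direction x hx) else 0
  refine ⟨F, ⟨U, U.isOpen, ?_, ?_⟩, ?_⟩
  · intro x hx h0
    rw [mem_singleton_iff] at h0
    simp [h0] at hx
  · have hs : ContMDiff 𝓘(ℝ, Cn n) 𝓘(ℝ, Cn n) ∞ fun x : U => ((‖(x : Cn n)‖⁻¹ : ℝ) : ℂ) • (x : Cn n) := by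
      intro x
      refine (contMDiffAt_subtype_iff (f := fun x : Cn n => ((‖x‖⁻¹ : ℝ) : ℂ) • x)).2 ?_
      rw [contMDiffAt_iff_contDiffAt]
      have hx : (x : Cn n) ≠ 0 := x.2
      have h1 : ContDiffAt ℝ ∞ (fun x : Cn n => ‖x‖⁻¹) (x : Cn n) :=
        ((contDiffAt_norm ℝ hx).inv (norm_ne_zero_iff.2 hx))
      exact h1.smul contDiffAt_id
    have hs' := hs.codRestrict_sphere (n := 2 * n - 1) fun x => (direction (x : Cn n) x.2).2
    have hφ := φ.contMDiff.comp hs'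
    intro x hx
    refine ContDiffAt.contDiffWithinAt ?_
    rw [← contMDiffAt_iff_contDiffAt]
    refine (contMDiffAt_subtype_iff (U := U) (x := ⟨x, hx⟩)).1 ?_
    refine (hφ ⟨x, hx⟩).congr_of_eventuallyEq (Eventually.of_forall fun y => ?_)
    have hy : (y : Cn n) ≠ 0 := y.2
    simp only [F, dif_pos hy]
    rfl
  · intro x
    have hx : ‖(x : Cn n)‖ = 1 := by simp
    have h0 : (x : Cn n) ≠ 0 := by
      intro h
      rw [h, norm_zero] at hx
      exact zero_ne_one hx
    simp only [F, dif_pos h0]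
    congr 1
    ext1
    simp [direction]

/-! ### The asymptotic expansion -/

/-- Reflection in the real line `ℝζ` conjugates `x · ζ`, so it preserves the measure, and it negates
the component of `x` that is real-orthogonal to `ζ`. -/
theorem integral_odd {n : ℕ} {h : ℝ} {z : Cn n} (hz : z ≠ 0) {f : Cn n → ℂ}
    (hf : ∀ y, f (-y) = -f y) :
    ∫ x : Sph n, f ((x : Cn n) - (inner ℝ (direction z hz : Cn n) (x : Cn n) : ℝ) •
      (direction z hz : Cn n)) ∂(berezinMeasure h z) = 0 := by
  have key := integral_berezinMeasure_comp (h := h) hz (ℝ ∙ (direction z hz : Cn n)).reflection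
    (Or.inr (inner_reflection_direction hz)) fun x : Sph n =>
      f ((x : Cn n) - (inner ℝ (direction z hz : Cn n) (x : Cn n) : ℝ) • (direction z hz : Cn n))
  set ζ : Cn n := (direction z hz : Cn n) with hζ
  have h1 : ∀ x : Sph n, ((sphereMap (ℝ ∙ ζ).reflection x : Sph n) : Cn n) -
      (inner ℝ ζ ((sphereMap (ℝ ∙ ζ).reflection x : Sph n) : Cn n) : ℝ) • ζ =
      -((x : Cn n) - (inner ℝ ζ (x : Cn n) : ℝ) • ζ) := by
    intro x
    have hn : ‖ζ‖ = 1 := direction_norm z hz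
    rw [coe_sphereMap, Submodule.reflection_singleton_apply, hn, inner_sub_right,
      ← Nat.cast_smul_eq_nsmul ℝ, inner_smul_right, inner_smul_right, real_inner_self_eq_norm_sq,
      hn]
    simp
    module
  simp only [h1, hf, integral_neg] at key
  exact self_eq_neg.1 key.symm

section Expansion

variable {m : ℕ} {h : ℝ} {z : Cn (m + 2)} (hz : z ≠ 0)

theorem sub_direction_eq (x : Cn (m + 2)) :
    x - (direction z hz : Cn (m + 2)) =
      ((inner ℂ (direction z hz : Cn (m + 2)) x).re - 1) • (direction z hz : Cn (m + 2)) +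
      (x - (inner ℝ (direction z hz : Cn (m + 2)) x : ℝ) • (direction z hz : Cn (m + 2))) := by
  rw [real_inner_eq_re]
  module

theorem continuous_re_inner_sub_one : Continuous fun x : Sph (m + 2) =>
    (inner ℂ (direction z hz : Cn (m + 2)) (x : Cn (m + 2))).re - 1 :=
  (Complex.continuous_re.comp (by fun_prop)).sub continuous_const

theorem integral_linear (hm : 0 < kernelMass h z) (D : Cn (m + 2) →L[ℝ] ℂ) :
    ∫ x : Sph (m + 2), D ((x : Cn (m + 2)) - (direction z hz : Cn (m + 2)))
        ∂(berezinMeasure h z) =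
      ((∫ x : Sph (m + 2), ((inner ℂ (direction z hz : Cn (m + 2)) (x : Cn (m + 2))).re - 1)
        ∂(berezinMeasure h z) : ℝ) : ℂ) * D (direction z hz : Cn (m + 2)) := by
  have hodd := integral_odd (h := h) hz (f := D) (map_neg D)
  have h1 : ∀ x : Sph (m + 2), D ((x : Cn (m + 2)) - (direction z hz : Cn (m + 2))) =
      (((inner ℂ (direction z hz : Cn (m + 2)) (x : Cn (m + 2))).re - 1 : ℝ) : ℂ) *
        D (direction z hz : Cn (m + 2)) + D ((x : Cn (m + 2)) -
        (inner ℝ (direction z hz : Cn (m + 2)) (x : Cn (m + 2)) : ℝ) •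
          (direction z hz : Cn (m + 2))) := by
    intro x
    conv_lhs => rw [sub_direction_eq, map_add, map_smul, Complex.real_smul]
  simp only [h1]
  rw [integral_add, hodd, add_zero, integral_mul_const, integral_complex_ofReal]
  · exact integrable_berezinMeasure hm ((Complex.continuous_ofReal.comp
      (continuous_re_inner_sub_one hz)).mul continuous_const)
  · exact integrable_berezinMeasure hm (by fun_prop)

theorem norm_sub_direction_sq (x : Sph (m + 2)) :
    ‖(x : Cn (m + 2)) - (direction z hz : Cn (m + 2))‖ ^ 2 =
      -2 * ((inner ℂ (direction z hz : Cn (m + 2)) (x : Cn (m + 2))).re - 1) := by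
  have hx : ‖(x : Cn (m + 2))‖ = 1 := by simp
  rw [norm_sub_sq_real, direction_norm, hx, real_inner_comm, real_inner_eq_re]
  ring

/-- This turns fourth order errors into the mean of `(Re X - 1)²`, which is `O(ρ⁻²)`. -/
theorem norm_sub_direction_pow_four (x : Sph (m + 2)) :
    ‖(x : Cn (m + 2)) - (direction z hz : Cn (m + 2))‖ ^ 4 =
      4 * ((inner ℂ (direction z hz : Cn (m + 2)) (x : Cn (m + 2))).re - 1) ^ 2 := by
  have := norm_sub_direction_sq hz x
  rw [show 4 = 2 * 2 from rfl, pow_mul, this]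
  ring

theorem norm_integral_le_sq (hm : 0 < kernelMass h z) {f : Sph (m + 2) → ℂ} {C : ℝ}
    (hf : ∀ x : Sph (m + 2), ‖f x‖ ≤
      C * ‖(x : Cn (m + 2)) - (direction z hz : Cn (m + 2))‖ ^ 4) :
    ‖∫ x, f x ∂(berezinMeasure h z)‖ ≤ 4 * C *
      ∫ x : Sph (m + 2), ((inner ℂ (direction z hz : Cn (m + 2)) (x : Cn (m + 2))).re - 1) ^ 2
        ∂(berezinMeasure h z) := by
  rw [← integral_const_mul]
  refine norm_integral_le_of_norm_le (integrable_berezinMeasure hm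
    (continuous_const.mul ((continuous_re_inner_sub_one hz).pow 2))) (ae_of_all _ fun x => ?_)
  refine (hf x).trans (le_of_eq ?_)
  rw [norm_sub_direction_pow_four]
  ring

/-- A bound by `|x - ζ|³` alone would lose half an order. With `v = x - ζ` and `w` its part
orthogonal to `ζ`, the mean of `Q(w,w,w)` vanishes by oddness. On the sphere `|v - w| = |v|²/2`, so
`Q(v,v,v) - Q(w,w,w)` is of fourth order in `v`. -/
theorem norm_integral_cubic_le (hm : 0 < kernelMass h z)
    (Q : ContinuousMultilinearMap ℝ (fun _ : Fin 3 => Cn (m + 2)) ℂ) :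
    ‖∫ x : Sph (m + 2), Q (fun _ => (x : Cn (m + 2)) - (direction z hz : Cn (m + 2)))
        ∂(berezinMeasure h z)‖ ≤ 4 * (6 * ‖Q‖) *
      ∫ x : Sph (m + 2), ((inner ℂ (direction z hz : Cn (m + 2)) (x : Cn (m + 2))).re - 1) ^ 2
        ∂(berezinMeasure h z) := by
  set ζ : Cn (m + 2) := (direction z hz : Cn (m + 2)) with hζ
  have hodd := integral_odd (h := h) hz (f := fun y => Q fun _ => y) (fun y => by
    have := Q.map_smul_univ (fun _ : Fin 3 => (-1 : ℝ)) fun _ => y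
    simp only [neg_smul, one_smul] at this
    rw [this]
    simp
    norm_num)
  have hc1 : Continuous fun x : Sph (m + 2) => Q fun _ => (x : Cn (m + 2)) - ζ :=
    Q.cont.comp (continuous_pi fun _ => by fun_prop)
  have hc2 : Continuous fun x : Sph (m + 2) => Q fun _ => (x : Cn (m + 2)) -
      (inner ℝ ζ (x : Cn (m + 2)) : ℝ) • ζ :=
    Q.cont.comp (continuous_pi fun _ => by fun_prop)
  have he : ∫ x : Sph (m + 2), Q (fun _ => (x : Cn (m + 2)) - ζ) ∂(berezinMeasure h z) =
      ∫ x : Sph (m + 2), (Q (fun _ => (x : Cn (m + 2)) - ζ) - Q fun _ => (x : Cn (m + 2)) -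
      (inner ℝ ζ (x : Cn (m + 2)) : ℝ) • ζ) ∂(berezinMeasure h z) := by
    rw [integral_sub (integrable_berezinMeasure hm hc1) (integrable_berezinMeasure hm hc2), hodd,
      sub_zero]
  rw [he]
  refine norm_integral_le_sq hz hm fun x => ?_
  have hu := norm_sub_direction_sq hz x
  have hd := sub_direction_eq hz (x : Cn (m + 2))
  rw [← hζ] at hu hd ⊢
  set v := (x : Cn (m + 2)) - ζ
  set w := (x : Cn (m + 2)) - (inner ℝ ζ (x : Cn (m + 2)) : ℝ) • ζ
  set u := (inner ℂ ζ (x : Cn (m + 2))).re - 1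
  have hn : ‖ζ‖ = 1 := direction_norm z hz
  have hau : |u| = ‖v‖ ^ 2 / 2 := by
    rw [hu, abs_of_nonpos (by nlinarith [sq_nonneg ‖v‖])]
    ring
  have hvw : ‖v - w‖ = ‖v‖ ^ 2 / 2 := by
    have : v - w = u • ζ := sub_eq_of_eq_add hd
    rw [this, norm_smul, hn, mul_one, Real.norm_eq_abs, hau]
  have hv2 : ‖v‖ ≤ 2 := by
    refine (norm_sub_le _ _).trans ?_
    rw [hn]
    simp
    norm_num
  have hw : ‖w‖ ≤ 2 * ‖v‖ := by
    have : ‖w‖ ≤ ‖v‖ + ‖v - w‖ := by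
      simpa using norm_sub_le v (v - w)
    nlinarith [norm_nonneg v]
  have hmax : max ‖fun _ : Fin 3 => v‖ ‖fun _ : Fin 3 => w‖ ≤ 2 * ‖v‖ := by
    rw [pi_norm_const, pi_norm_const]
    exact max_le (by linarith [norm_nonneg v]) hw
  have hs : ‖(fun _ : Fin 3 => v) - fun _ : Fin 3 => w‖ = ‖v‖ ^ 2 / 2 := by
    rw [← hvw]
    exact pi_norm_const (v - w)
  refine (Q.norm_image_sub_le _ _).trans ?_
  rw [hs, Fintype.card_fin]
  calc ‖Q‖ * (3 : ℕ) * max ‖fun _ : Fin 3 => v‖ ‖fun _ : Fin 3 => w‖ ^ (3 - 1) * (‖v‖ ^ 2 / 2)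
      ≤ ‖Q‖ * (3 : ℕ) * (2 * ‖v‖) ^ (3 - 1) * (‖v‖ ^ 2 / 2) := by gcongr
    _ = 6 * ‖Q‖ * ‖v‖ ^ 4 := by norm_num; ring

theorem exists_expansion {F : Cn (m + 2) → ℂ} (hF : ContinuousOn F (sphere 0 1))
    (hd : ContDiffAt ℝ 4 F (direction z hz : Cn (m + 2))) :
    ∃ C : ℝ, ∀ h : ℝ, 0 < h → 1 ≤ ‖z‖ / h →
      ‖∫ x : Sph (m + 2), F (x : Cn (m + 2)) ∂(berezinMeasure h z) -
        (F (direction z hz : Cn (m + 2)) + ((1 / (4 * (‖z‖ / h)) : ℝ) : ℂ) *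
          (4 * laplace F (direction z hz : Cn (m + 2)) -
            radial (radial F) (direction z hz : Cn (m + 2)) -
            (2 * m + 2) * radial F (direction z hz : Cn (m + 2))))‖ ≤ C / (‖z‖ / h) ^ 2 := by
  classical
  set ζ : Cn (m + 2) := (direction z hz : Cn (m + 2)) with hζ
  obtain ⟨C₀, hC₀⟩ := moment_asymptotics m
  obtain ⟨N, ⟨b⟩⟩ := AdaptedBasis.exists (direction_norm z hz)
  obtain ⟨C₁, hC₁⟩ := exists_taylor_bound (isCompact_sphere (0 : Cn (m + 2)) 1) hF (n := 3) hd
  have hd2 : ContDiffAt ℝ 2 F ζ := hd.of_le (by norm_num)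
  rw [four_mul_laplace_eq hd2 b.basis, radial_radial_eq hd2]
  simp only [radial_eq F]
  have hb0 : b.basis b.i₀ = ζ := b.basis_i₀
  set D := fderiv ℝ F ζ with hD
  set B := fderiv ℝ (fderiv ℝ F) ζ with hB
  set Q := iteratedFDeriv ℝ 3 F ζ with hQ
  refine ⟨C₀ * ‖D ζ‖ + 2⁻¹ * ∑ i, C₀ * ‖B (b.basis i) (b.basis i)‖ + 6⁻¹ * (4 * (6 * ‖Q‖) * C₀) +
    4 * |C₁| * C₀, fun h hh hρ => ?_⟩
  have hm := kernelMass_pos hh hz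
  have hprob := isProbabilityMeasure_berezinMeasure hm
  obtain ⟨k₁, k₂, k₃, k₄⟩ := hC₀ h z hz hh hρ
  have hlin := integral_linear hz hm D
  have hcub := norm_integral_cubic_le hz hm Q
  have hrem := norm_integral_le_sq hz hm (C := |C₁|) fun x =>
    (hC₁ (x : Cn (m + 2)) x.2).trans (mul_le_mul_of_nonneg_right (le_abs_self _) (by positivity))
  rw [← hζ] at k₁ k₃ hlin hcub hrem
  set ρ := ‖z‖ / h
  have hρ0 : 0 < ρ := by linarith
  set ν := berezinMeasure h z with hν
  have hbil : ∫ x : Sph (m + 2), B ((x : Cn (m + 2)) - ζ) ((x : Cn (m + 2)) - ζ) ∂ν =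
      ∑ i, ((∫ x, b.coord i x ^ 2 ∂ν : ℝ) : ℂ) * B (b.basis i) (b.basis i) := b.integral_bilin hm B
  -- The coordinate along `ζ` is negligible, the one along `iζ` is `Im X`, and the others share `1 -
  -- |X|²` equally; both non-radial cases have leading term `1/(2ρ)`.
  have hsec : ∀ i, |∫ x, b.coord i x ^ 2 ∂ν - if i = b.i₀ then 0 else 1 / (2 * ρ)| ≤
      C₀ / ρ ^ 2 := by
    intro i
    by_cases h0 : i = b.i₀
    · rw [if_pos h0, h0, sub_zero]
      simpa only [b.coord_i₀] using k₃
    rw [if_neg h0]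
    by_cases h1 : i = b.i₁
    · rw [h1]
      simpa only [b.coord_i₁] using k₂
    have h2 := b.integral_coord_sq hm h0 h1
    rw [← hν] at h2
    rw [← h2] at k₄
    have hm1 : (0 : ℝ) < 2 * m + 2 := by positivity
    have e : (2 * ((m + 2 : ℕ) : ℝ) - 2) * ∫ x, b.coord i x ^ 2 ∂ν - (m + 1) / ρ =
        (2 * m + 2) * (∫ x, b.coord i x ^ 2 ∂ν - 1 / (2 * ρ)) := by
      push_cast
      field_simp
      ring
    rw [e, abs_mul, abs_of_pos hm1] at k₄
    refine le_trans ?_ k₄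
    have : (0 : ℝ) ≤ m := Nat.cast_nonneg m
    nlinarith [abs_nonneg (∫ x, b.coord i x ^ 2 ∂ν - 1 / (2 * ρ))]
  rw [abs_of_nonneg (integral_nonneg fun x => sq_nonneg _)] at k₃
  set u₁ := ∫ x : Sph (m + 2), ((inner ℂ ζ (x : Cn (m + 2))).re - 1) ∂ν
  set u₂ := ∫ x : Sph (m + 2), ((inner ℂ ζ (x : Cn (m + 2))).re - 1) ^ 2 ∂ν
  have hsum : ∀ x : Cn (m + 2), ∑ k ∈ Finset.range (3 + 1), (k.factorial : ℝ)⁻¹ •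
      (iteratedFDeriv ℝ k F ζ fun _ => x - ζ) = F ζ + D (x - ζ) +
        (2 : ℂ)⁻¹ * B (x - ζ) (x - ζ) + (6 : ℂ)⁻¹ * Q fun _ => x - ζ := by
    intro x
    simp only [Finset.sum_range_succ, Finset.range_zero, Finset.sum_empty, zero_add,
      iteratedFDeriv_zero_apply, iteratedFDeriv_one_apply, iteratedFDeriv_two_apply,
      Complex.real_smul, ← hD, ← hB, ← hQ]
    norm_num [Nat.factorial]
  simp only [hsum] at hrem
  have c0 : Continuous fun x : Sph (m + 2) => F (x : Cn (m + 2)) :=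
    continuousOn_iff_continuous_domRestrict.1 hF
  have i0 := integrable_berezinMeasure hm c0
  have i1 : Integrable (fun _ : Sph (m + 2) => F ζ) ν := integrable_const _
  have i2 : Integrable (fun x : Sph (m + 2) => D ((x : Cn (m + 2)) - ζ)) ν :=
    integrable_berezinMeasure hm (by fun_prop)
  have i3 : Integrable (fun x : Sph (m + 2) =>
      (2 : ℂ)⁻¹ * B ((x : Cn (m + 2)) - ζ) ((x : Cn (m + 2)) - ζ)) ν :=
    integrable_berezinMeasure hm (by fun_prop)
  have i4 : Integrable (fun x : Sph (m + 2) => (6 : ℂ)⁻¹ * Q fun _ => (x : Cn (m + 2)) - ζ) ν :=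
    integrable_berezinMeasure hm
      (continuous_const.mul (Q.cont.comp (continuous_pi fun _ => by fun_prop)))
  have i12 : Integrable (fun x : Sph (m + 2) => F ζ + D ((x : Cn (m + 2)) - ζ)) ν := i1.add i2
  have i123 : Integrable (fun x : Sph (m + 2) => F ζ + D ((x : Cn (m + 2)) - ζ) +
      (2 : ℂ)⁻¹ * B ((x : Cn (m + 2)) - ζ) ((x : Cn (m + 2)) - ζ)) ν := i12.add i3
  have i1234 : Integrable (fun x : Sph (m + 2) => F ζ + D ((x : Cn (m + 2)) - ζ) +
      (2 : ℂ)⁻¹ * B ((x : Cn (m + 2)) - ζ) ((x : Cn (m + 2)) - ζ) +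
      (6 : ℂ)⁻¹ * Q fun _ => (x : Cn (m + 2)) - ζ) ν := i123.add i4
  rw [integral_sub i0 i1234, integral_add i123 i4,
    integral_add i12 i3, integral_add i1 i2, integral_const_mul, integral_const_mul,
    hlin, hbil, integral_const, probReal_univ, one_smul] at hrem
  set I := ∫ x : Sph (m + 2), F (x : Cn (m + 2)) ∂ν
  set J := ∫ x : Sph (m + 2), Q (fun _ => (x : Cn (m + 2)) - ζ) ∂ν
  set a : Fin N → ℝ := fun i => ∫ x, b.coord i x ^ 2 ∂ν with ha
  have hT : ‖∑ i, (((a i - if i = b.i₀ then 0 else 1 / (2 * ρ) : ℝ) : ℝ) : ℂ) *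
      B (b.basis i) (b.basis i)‖ ≤ ∑ i, C₀ / ρ ^ 2 * ‖B (b.basis i) (b.basis i)‖ := by
    refine (norm_sum_le _ _).trans (Finset.sum_le_sum fun i _ => ?_)
    rw [norm_mul, Complex.norm_real]
    exact mul_le_mul_of_nonneg_right (hsec i) (norm_nonneg _)
  have hTe : ∑ i, (((a i - if i = b.i₀ then 0 else 1 / (2 * ρ) : ℝ) : ℝ) : ℂ) *
      B (b.basis i) (b.basis i) = ∑ i, (a i : ℂ) * B (b.basis i) (b.basis i) -
        ((1 / (2 * ρ) : ℝ) : ℂ) * (∑ i, B (b.basis i) (b.basis i) - B ζ ζ) := by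
    have h1 : ∑ i, B (b.basis i) (b.basis i) - B ζ ζ =
        ∑ i, if i = b.i₀ then 0 else B (b.basis i) (b.basis i) := by
      rw [← hb0, sub_eq_iff_eq_add, ← Finset.sum_erase_add _ _ (Finset.mem_univ b.i₀),
        ← Finset.sum_erase_add _ _ (Finset.mem_univ b.i₀), if_pos rfl, add_zero]
      congr 1
      refine Finset.sum_congr rfl fun i hi => ?_
      rw [if_neg (Finset.ne_of_mem_erase hi)]
    rw [h1, Finset.mul_sum, ← Finset.sum_sub_distrib]
    refine Finset.sum_congr rfl fun i _ => ?_
    split_ifs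
    · simp
    · push_cast
      ring
  rw [hTe] at hT
  have hL : ‖((u₁ + (2 * m + 3) / (4 * ρ) : ℝ) : ℂ) * D ζ‖ ≤ C₀ / ρ ^ 2 * ‖D ζ‖ := by
    rw [norm_mul, Complex.norm_real]
    exact mul_le_mul_of_nonneg_right k₁ (norm_nonneg _)
  set S := ∑ i, B (b.basis i) (b.basis i)
  set A := ∑ i, (a i : ℂ) * B (b.basis i) (b.basis i)
  -- The coefficient `2m + 3` of the mean displacement splits as `(2m + 2) + 1`; the extra 1 is the
  -- first order part of `ℛ²`. The four summands are the errors of the Taylor terms of degree 1, 2,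
  -- 3 and of the remainder.
  have hfin : I - (F ζ + ((1 / (4 * ρ) : ℝ) : ℂ) *
      (S - (B ζ ζ + D ζ) - (2 * m + 2) * D ζ)) =
      ((u₁ + (2 * m + 3) / (4 * ρ) : ℝ) : ℂ) * D ζ +
      2⁻¹ * (A - ((1 / (2 * ρ) : ℝ) : ℂ) * (S - B ζ ζ)) + 6⁻¹ * J +
      (I - (F ζ + (u₁ : ℂ) * D ζ + 2⁻¹ * A + 6⁻¹ * J)) := by
    have hρc : (ρ : ℂ) ≠ 0 := by exact_mod_cast hρ0.ne'
    push_cast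
    field_simp
    ring
  rw [add_div, add_div, add_div, hfin]
  refine (norm_add_le _ _).trans ?_
  refine add_le_add ((norm_add_le _ _).trans (add_le_add ((norm_add_le _ _).trans
    (add_le_add ?_ ?_)) ?_)) ?_
  · exact hL.trans (le_of_eq (by ring))
  · rw [norm_mul]
    calc ‖(2⁻¹ : ℂ)‖ * _ ≤ 2⁻¹ * ∑ i, C₀ / ρ ^ 2 * ‖B (b.basis i) (b.basis i)‖ := by
          rw [norm_inv, RCLike.norm_ofNat]
          gcongr
      _ = _ := by
          rw [mul_div_assoc, Finset.sum_div]
          congr 1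
          refine Finset.sum_congr rfl fun i _ => by ring
  · rw [norm_mul, norm_inv, RCLike.norm_ofNat, mul_div_assoc, mul_div_assoc]
    gcongr
    exact hcub.trans (mul_le_mul_of_nonneg_left k₃ (by positivity))
  · refine hrem.trans ?_
    rw [mul_div_assoc]
    exact mul_le_mul_of_nonneg_left k₃ (by positivity)

end Expansion

end BerezinSphere

end

open BerezinSphere in
theorem mainTheorem2 (n : ℕ) [NeZero n] (hn : 2 ≤ n) (z : Cn n) (hz : z ≠ 0)
    (φ : SmoothFun n) :
    (∃ F : Cn n → ℂ, IsSmoothExtension φ F) ∧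
    ∀ F : Cn n → ℂ, IsSmoothExtension φ F →
      (fun h : ℝ => berezin h (-1) φ z -
        (φ (direction z hz) + ((h / (4 * ‖z‖) : ℝ) : ℂ) *
          (4 * laplace F (direction z hz) - radial (radial F) (direction z hz)
            - (2 * (n : ℂ) - 2) * radial F (direction z hz))))
      =O[𝓝[>] (0 : ℝ)] fun h : ℝ => h ^ 2 := by
  refine ⟨exists_smooth_extension φ, ?_⟩
  rintro F ⟨⟨U, hU, hSU, hFU⟩, hFφ⟩
  obtain ⟨m, rfl⟩ := Nat.exists_eq_add_of_le' hn
  have hζU : U ∈ 𝓝 (direction z hz : Cn (m + 2)) := hU.mem_nhds (hSU (direction z hz).2)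
  obtain ⟨C, hC⟩ := exists_expansion hz (hFU.continuousOn.mono hSU)
    ((hFU.contDiffAt hζU).of_le (ENat.LEInfty.out))
  have hzn : 0 < ‖z‖ := norm_pos_iff.2 hz
  refine IsBigO.of_bound (C / ‖z‖ ^ 2) ?_
  -- For `0 < h < |z|` one has `ρ = |z|/h ≥ 1`, and `ρ⁻² = h²/|z|²` accounts for the constant.
  filter_upwards [Ioo_mem_nhdsGT hzn] with h hh
  have key := hC h hh.1 ((one_le_div hh.1).2 hh.2.le)
  rw [berezin_eq_integral]
  simp only [← hFφ]
  have e1 : 1 / (4 * (‖z‖ / h)) = h / (4 * ‖z‖) := by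
    have := hh.1.ne'
    field_simp
  have e2 : C / (‖z‖ / h) ^ 2 = C / ‖z‖ ^ 2 * ‖h ^ 2‖ := by
    have := hh.1.ne'
    rw [Real.norm_of_nonneg (sq_nonneg h)]
    field_simp
  have e3 : 2 * ((m + 2 : ℕ) : ℂ) - 2 = 2 * m + 2 := by
    push_cast
    ring
  rw [e1, e2] at key
  rw [e3]
  exact key
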